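/- Let $d\ge 1$, $\mathbb T=\mathbb R/\mathbb Z$ and $\mathbb A^d_r=\mathbb T^d\times[-r,r]^d$. For a vector $\beta\in\mathbb R^d$, a real $d\times d$ matrix $A$ and families of functions $R_{\varepsilon,\varphi},R_{\varepsilon,J},P_{\varepsilon,\varphi},P_{\varepsilon,J}$ on $\mathbb A^d_1$ with values in $\mathbb R^d$ consider the maps $\mathbb A^d_1\to\mathbb T^d\times\mathbb R^d$ $$T_\varepsilon(\varphi,J)=\big(\varphi+\beta+AJ+R_{\varepsilon,\varphi}(\varphi,J),\ J+R_{\varepsilon,J}(\varphi,J)\big),\qquad S_\varepsilon(\varphi,J)=\big(\varphi+\varepsilon P_{\varepsilon,\varphi}(\varphi,J),\ J+\varepsilon P_{\varepsilon,J}(\varphi,J)\big).$$ *Theorem (symbolic blender).* Given $d$, $A$, a real $d\times d$ matrix $B$, $\gamma>0$, $e>0$ and $K$, there is $\varepsilon_0\in(0,\min(e,1)]$, depending only on these, such that the following holds for all $\beta,R_{\varepsilon,\varphi},R_{\varepsilon,J},P_{\varepsilon,\varphi},P_{\varepsilon,J}$ with the properties 1. $\beta$ is of constant type: $|\beta\cdot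 k-l|\ge\gamma|k|^{-d}$ for all $k\in\mathbb Z^d\setminus\{0\}$, $l\in\mathbb Z$ ($|k|$ is the maximum norm); 2. $R_{\varepsilon,\varphi},R_{\varepsilon,J},P_{\varepsilon,\varphi},P_{\varepsilon,J}$ are $C^2$ functions of $(\varepsilon,\varphi,J)\in[-e,e]\times\mathbb A^d_1$, and they and their derivatives of order at most two are bounded by $K$; 3. for $|\varepsilon|\le e$: $\partial_J^nR_{\varepsilon,\varphi}(\varphi,0)=0$ for $n\le 1$, $\partial_J^nR_{\varepsilon,J}(\varphi,0)=0$ for $n\le 2$, and $|D_{(\varphi,J)}R_{\varepsilon,J}(\varphi,J)|\le K|J|^2$; 4. $P_{0,J}(0,0)=0$, $D_\varphi P_{0,J}(0,0)=B$, and the spectrum of $AB$ is simple, real and does not contain zero. For every $0<\varepsilon\le\varepsilon_0$ the iterated function system (IFS) generated by $G_1=T_\varepsilon$ and $G_2=S_\varepsilon$ displays a symbolic double blender, and it is topologically mixing on $\mathbb A^d_{\sqrt\varepsilon}$: for all nonempty (relatively) open sets $B_0,B_1\subset\mathbb A^d_{\sqrt\varepsilon}$ there is $\widetilde L\in\mathbb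 N$ such that for every $L\ge\widetilde L$ there is $\omega\in\{1,2\}^L$ with $G_{\omega_{L-1}}\circ\cdots\circ G_{\omega_0}(B_0)\cap B_1\ne\emptyset$. *Definitions.* All compositions of $G_1,G_2$ are partial maps, defined at the points at which each factor is applied to a point of $\mathbb A^d_1$. Consider an open ball $Q\subset\mathbb A^d_1$ (a smoothly embedded open $2d$-ball), a finite set $\mathcal W$ of compositions of $G_1,G_2$, and a hyperbolic fixed point $P\in Q$ of some $F\in\mathcal W$. Suppose that there are on $Q$ two continuous fields $\mathcal C^s,\mathcal C^u$ of cones $\{|\eta|\le|\xi|\}$, where $(\xi,\eta)\in\mathbb R^d\times\mathbb R^d$ are coordinates in a continuous linear frame (one frame for each field), with $\mathcal C^s\cap\mathcal C^u=\{0\}$, which are common to the return maps to $Q$ of all elements of $\mathcal W$: whenever $z\in Q$ and $H\in\mathcal W$ with $H(z)\in Q$, the differential $DH(z)$ is invertible, maps $\mathcal C^u(z)\setminus\{0\}$ into the interior of $\mathcal C^u(H(z))$ and expands its vectors uniformly (in the norm of the frame), and $DH(z)^{-1}$ does the same with $\mathcal C^s(H(z))$ and $\mathcal C^s(z)$. Let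 $W^{s}(P)$ be the connected component of $P$ in the set of points of $Q$ whose forward orbit under $F$ stays in $Q$ and converges to $P$, and $W^u(P)$ that of the points having such a backward orbit. A $cs$-strip ($cu$-strip) is a nonempty $d$-dimensional $C^1$ submanifold of $Q$ tangent to $\mathcal C^s$ ($\mathcal C^u$). The pair $(P,Q)$ is a symbolic $cs$-blender if for every $cs$-strip $\Delta\subset Q$ there is a composition $H$ of elements of $\mathcal W$ such that $H^{-1}(\Delta)$ and $W^u(P)$ have a point of transverse intersection, and a symbolic $cu$-blender if for every $cu$-strip $\Delta\subset Q$ there is such an $H$ for which $H(\Delta)$ and $W^s(P)$ have a point of transverse intersection. The IFS displays a symbolic double blender if there are a symbolic $cu$-blender $(P,Q)$ and a symbolic $cs$-blender $(P',Q')$ (with their own sets of compositions) such that $W^s(P)$ and $W^u(P')$ have a point of transverse intersection. -/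

import Mathlib

open Set Filter Topology

/-- The `d`-dimensional torus `𝕋^d = ℝ^d / ℤ^d`. -/
abbrev Torus (d : ℕ) : Type := Fin d → UnitAddCircle

/-- The model space `ℝ^d × ℝ^d`: universal cover of the phase space, and its tangent space at
every point. -/
abbrev Cover (d : ℕ) : Type := (Fin d → ℝ) × (Fin d → ℝ)

/-- The phase space `𝕋^d × ℝ^d`, with points `(φ, J)`. -/
abbrev Phase (d : ℕ) : Type := Torus d × (Fin d → ℝ)

/-- The projection `ℝ^d → 𝕋^d`. -/
def torusProj {d : ℕ} (φ : Fin d → ℝ) : Torus d := fun i => (φ i : UnitAddCircle)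

/-- The covering projection `ℝ^d × ℝ^d → 𝕋^d × ℝ^d`. -/
def phaseProj {d : ℕ} (v : Cover d) : Phase d := (torusProj v.1, v.2)

/-- The annulus `𝕋^d × [-r, r]^d`. -/
def annulus (d : ℕ) (r : ℝ) : Set (Phase d) := {z | ∀ i, |z.2 i| ≤ r}

/-! ### Parametric families of maps -/

/-- `(φ, J) ↦ (φ + β + A J + R_{ε,φ}(φ,J), J + R_{ε,J}(φ,J))`. -/
def twistMap {d : ℕ} (β : Fin d → ℝ) (A : Matrix (Fin d) (Fin d) ℝ)
    (Rφ RJ : ℝ → Torus d → (Fin d → ℝ) → (Fin d → ℝ)) (ε : ℝ) (z : Phase d) : Phase d :=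
  (z.1 + torusProj (β + A.mulVec z.2 + Rφ ε z.1 z.2), z.2 + RJ ε z.1 z.2)

/-- `(φ, J) ↦ (φ + ε P_{ε,φ}(φ,J), J + ε P_{ε,J}(φ,J))`. -/
def kickMap {d : ℕ} (Pφ PJ : ℝ → Torus d → (Fin d → ℝ) → (Fin d → ℝ)) (ε : ℝ)
    (z : Phase d) : Phase d :=
  (z.1 + torusProj (ε • Pφ ε z.1 z.2), z.2 + ε • PJ ε z.1 z.2)

/-- The vectors of constant type with constant `γ`: `|β·k - l| ≥ γ |k|^{-d}` for all
`k ∈ ℤ^d \ {0}` and `l ∈ ℤ` (`|k|` is the maximum norm). -/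
def IsConstantType {d : ℕ} (γ : ℝ) (β : Fin d → ℝ) : Prop :=
  ∀ k : Fin d → ℤ, k ≠ 0 → ∀ l : ℤ, γ / ‖k‖ ^ d ≤ |(∑ i, β i * (k i : ℝ)) - (l : ℝ)|

/-- The lift of a parametric family to `(ε, φ, J) ∈ ℝ × ℝ^d × ℝ^d`. -/
def familyLift {d : ℕ} (F : ℝ → Torus d → (Fin d → ℝ) → (Fin d → ℝ))
    (x : ℝ × Cover d) : Fin d → ℝ := F x.1 (torusProj x.2.1) x.2.2

/-- The set `[-1,1]^d` of actions. -/
def actionCube (d : ℕ) : Set (Fin d → ℝ) := {J | ∀ i, |J i| ≤ 1}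

/-- The set `|ε| ≤ e`, `φ ∈ ℝ^d`, `J ∈ [-1,1]^d`. -/
def familyDomain (d : ℕ) (e : ℝ) : Set (ℝ × Cover d) := Icc (-e) e ×ˢ (univ ×ˢ actionCube d)

/-- The family is `C²` in `(ε, φ, J)` for `|ε| ≤ e`, `J ∈ [-1,1]^d`, with `C²` norm at most `K`. -/
def IsC2Family {d : ℕ} (e K : ℝ) (F : ℝ → Torus d → (Fin d → ℝ) → (Fin d → ℝ)) : Prop :=
  ContDiffOn ℝ 2 (familyLift F) (familyDomain d e) ∧
    ∀ n : ℕ, n ≤ 2 → ∀ x ∈ familyDomain d e,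
      ‖iteratedFDerivWithin ℝ n (familyLift F) (familyDomain d e) x‖ ≤ K

/-- Small nonlinearity of the twist map: for `|ε| ≤ e` the function `R_{ε,φ}` vanishes with its
first derivative in `J` at `J = 0`, the function `R_{ε,J}` vanishes with its derivatives in `J` of
order one and two at `J = 0`, and `|D_{(φ,J)} R_{ε,J}(φ,J)| ≤ K |J|²`. -/
def SmallNonlinearity {d : ℕ} (e K : ℝ) (Rφ RJ : ℝ → Torus d → (Fin d → ℝ) → (Fin d → ℝ)) :
    Prop :=
  ∀ ε ∈ Icc (-e) e,
    (∀ θ : Torus d, ∀ n : ℕ, n ≤ 1 → iteratedFDeriv ℝ n (fun J => Rφ ε θ J) 0 = 0) ∧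
    (∀ θ : Torus d, ∀ n : ℕ, n ≤ 2 → iteratedFDeriv ℝ n (fun J => RJ ε θ J) 0 = 0) ∧
    (∀ x ∈ (univ ×ˢ actionCube d : Set (Cover d)),
      ‖fderivWithin ℝ (fun y : Cover d => RJ ε (torusProj y.1) y.2) (univ ×ˢ actionCube d) x‖
        ≤ K * ‖x.2‖ ^ 2)

/-- The spectrum of `M` is simple, real and does not contain zero. -/
def SimpleRealNonzeroSpectrum {d : ℕ} (M : Matrix (Fin d) (Fin d) ℝ) : Prop :=
  M.charpoly.Splits ∧ M.charpoly.roots.Nodup ∧ (0 : ℝ) ∉ M.charpoly.roots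

/-- Transversality-torsion: `P_{0,J}(0,0) = 0`, `B = D_φ P_{0,J}(0,0)`, and the spectrum of `A B`
is simple, real and does not contain zero. -/
def TransversalityTorsion {d : ℕ} (A B : Matrix (Fin d) (Fin d) ℝ)
    (PJ : ℝ → Torus d → (Fin d → ℝ) → (Fin d → ℝ)) : Prop :=
  PJ 0 0 0 = 0 ∧
  HasFDerivAt (fun φ : Fin d → ℝ => PJ 0 (torusProj φ) 0)
    (LinearMap.toContinuousLinearMap (Matrix.toLin' B)) 0 ∧
  SimpleRealNonzeroSpectrum (A * B)

/-! ### Words of an iterated function system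

The maps `G i` are only considered on the set `D`: a word may be applied to a point if each of its
letters is applied to a point of `D`. The first letter of a word is applied first. -/

section Words

variable {ι X : Type*}

/-- The composition of the maps of a word. -/
def wordMap (G : ι → X → X) : List ι → X → X
  | [] => id
  | i :: w => wordMap G w ∘ G i

/-- The set of points to which a word may be applied. -/
def wordDom (D : Set X) (G : ι → X → X) : List ι → Set X
  | [] => univ
  | i :: w => {z | z ∈ D ∧ G i z ∈ wordDom D G w}

/-- Topological mixing on `Y` of the IFS generated by the maps `G i`; open subsets of `Y` are
written `U ∩ Y` with `U` open. -/
def IsTopMixingOn [TopologicalSpace X] (D : Set X) (G : ι → X → X) (Y : Set X) : Prop :=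
  ∀ U₀ U₁ : Set X, IsOpen U₀ → IsOpen U₁ → (U₀ ∩ Y).Nonempty → (U₁ ∩ Y).Nonempty →
    ∃ L₀ : ℕ, ∀ L : ℕ, L₀ ≤ L → ∃ w : List ι, w.length = L ∧
      (wordMap G w '' (U₀ ∩ Y ∩ wordDom D G w) ∩ (U₁ ∩ Y)).Nonempty

/-- The local stable set in `Q` of the fixed point `P` of the return map of a word: the connected
component of `P` in the set of points whose forward orbit stays in `Q` and converges to `P`. -/
def localStable [TopologicalSpace X] (D : Set X) (G : ι → X → X) (w : List ι) (Q : Set X) (P : X) :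
    Set X :=
  connectedComponentIn
    {z | (∀ k : ℕ, (wordMap G w)^[k] z ∈ Q ∩ wordDom D G w) ∧
      Tendsto (fun k : ℕ => (wordMap G w)^[k] z) atTop (𝓝 P)} P

/-- The local unstable set in `Q` of the fixed point `P` of the return map of a word: the connected
component of `P` in the set of points having a backward orbit that stays in `Q` and converges to
`P`. -/
def localUnstable [TopologicalSpace X] (D : Set X) (G : ι → X → X) (w : List ι) (Q : Set X)
    (P : X) : Set X :=
  connectedComponentIn
    {z | ∃ x : ℕ → X, x 0 = z ∧ (∀ k, x k ∈ Q) ∧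
      (∀ k, x (k + 1) ∈ wordDom D G w ∧ wordMap G w (x (k + 1)) = x k) ∧
      Tendsto x atTop (𝓝 P)} P

end Words

/-! ### Differential calculus on the phase space -/

/-- `L` is the differential of `F` at `z`, in the canonical coordinates of `𝕋^d × ℝ^d`. -/
def HasDiffAt {d : ℕ} (F : Phase d → Phase d) (L : Cover d →L[ℝ] Cover d) (z : Phase d) : Prop :=
  ∃ r : Cover d → Cover d, HasFDerivAt r L 0 ∧
    ∀ᶠ v in 𝓝 (0 : Cover d), F (z + phaseProj v) = F z + phaseProj (r v)

/-- Near its point `p`, the set `Δ` is a `d`-dimensional `C¹` submanifold of the `2d`-dimensional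
phase space (the zero set of a `C¹` submersion to `ℝ^d`), and its tangent space at `p` is `V`. -/
def IsTangentAt {d : ℕ} (Δ : Set (Phase d)) (p : Phase d) (V : Submodule ℝ (Cover d)) : Prop :=
  p ∈ Δ ∧ ∃ f : Cover d → (Fin d → ℝ), ContDiffAt ℝ 1 f 0 ∧
    Function.Surjective (fderiv ℝ f 0) ∧ V = LinearMap.ker (fderiv ℝ f 0).toLinearMap ∧
    ∀ᶠ v in 𝓝 (0 : Cover d), (p + phaseProj v ∈ Δ ↔ f v = 0)

/-- An open ball in the phase space: the image of the unit ball of `ℝ^{2d}` (here: of the maximum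
norm) under a smooth diffeomorphism onto an open set. -/
def IsOpenBall {d : ℕ} (Q : Set (Phase d)) : Prop :=
  ∃ Ψ : Cover d → Cover d, ContDiffOn ℝ (⊤ : ℕ∞) Ψ (Metric.ball 0 1) ∧
    (∀ x ∈ Metric.ball (0 : Cover d) 1, Function.Bijective (fderiv ℝ Ψ x)) ∧
    InjOn (fun x => phaseProj (Ψ x)) (Metric.ball 0 1) ∧
    Q = (fun x => phaseProj (Ψ x)) '' Metric.ball 0 1

/-- The cone `{v : |η| ≤ |ξ|}`, where `(ξ, η) ∈ ℝ^d × ℝ^d` are the coordinates of `v` in the given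
linear frame. -/
def cone {d : ℕ} (Φ : Cover d ≃L[ℝ] Cover d) : Set (Cover d) := {v | ‖(Φ v).2‖ ≤ ‖(Φ v).1‖}

/-- The continuous cone fields `z ↦ cone (Φs z)` and `z ↦ cone (Φu z)` on `Q` are complementary,
and are stable and unstable cone fields for the return maps to `Q` of all the words in `W`:
the differential maps nonzero vectors of the unstable cone into the interior of the unstable cone
and expands them uniformly, and its inverse does the same with the stable cone. -/
def AreCommonCones {d : ℕ} {ι : Type*} (D : Set (Phase d)) (G : ι → Phase d → Phase d)
    (W : Finset (List ι)) (Q : Set (Phase d)) (Φs Φu : Phase d → (Cover d ≃L[ℝ] Cover d)) : Prop :=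
  ContinuousOn (fun z => (Φs z : Cover d →L[ℝ] Cover d)) Q ∧
  ContinuousOn (fun z => (Φu z : Cover d →L[ℝ] Cover d)) Q ∧
  (∀ z ∈ Q, cone (Φs z) ∩ cone (Φu z) ⊆ {0}) ∧
  ∃ rate : ℝ, 1 < rate ∧ ∀ w ∈ W, ∀ z ∈ Q ∩ wordDom D G w, wordMap G w z ∈ Q →
    ∃ L : Cover d →L[ℝ] Cover d, HasDiffAt (wordMap G w) L z ∧ Function.Bijective L ∧
      (∀ v, v ≠ 0 → v ∈ cone (Φu z) →
        L v ∈ interior (cone (Φu (wordMap G w z))) ∧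
          rate * ‖Φu z v‖ ≤ ‖Φu (wordMap G w z) (L v)‖) ∧
      (∀ v, v ≠ 0 → L v ∈ cone (Φs (wordMap G w z)) →
        v ∈ interior (cone (Φs z)) ∧ rate * ‖Φs (wordMap G w z) (L v)‖ ≤ ‖Φs z v‖)

/-- A strip in `Q`: a nonempty `d`-dimensional `C¹` submanifold contained in `Q` which is tangent
to the given cone field. -/
def IsStrip {d : ℕ} (Q : Set (Phase d)) (Φ : Phase d → (Cover d ≃L[ℝ] Cover d))
    (Δ : Set (Phase d)) : Prop :=
  Δ.Nonempty ∧ Δ ⊆ Q ∧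
    ∀ p ∈ Δ, ∃ V : Submodule ℝ (Cover d), IsTangentAt Δ p V ∧ (V : Set (Cover d)) ⊆ cone (Φ p)

/-- `P` is a hyperbolic fixed point of the composition of the word `w`. -/
def IsHyperbolicFixedPoint {d : ℕ} {ι : Type*} (D : Set (Phase d)) (G : ι → Phase d → Phase d)
    (w : List ι) (P : Phase d) : Prop :=
  P ∈ wordDom D G w ∧ wordMap G w P = P ∧
    ∃ L : Cover d →L[ℝ] Cover d, HasDiffAt (wordMap G w) L P ∧ Function.Bijective L ∧
      ∀ μ : ℂ, Polynomial.aeval μ (LinearMap.charpoly L.toLinearMap) = 0 → ‖μ‖ ≠ 1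

/-- The data shared by both types of symbolic blenders: an open ball `Q`, a finite set `W` of words
(their compositions induce the return maps to `Q`), a hyperbolic fixed point `P ∈ Q` of one of them,
and cone fields common to all of them. -/
structure BlenderFrame {d : ℕ} {ι : Type*} (D : Set (Phase d)) (G : ι → Phase d → Phase d)
    (W : Finset (List ι)) (w : List ι) (Q : Set (Phase d)) (P : Phase d)
    (Φs Φu : Phase d → (Cover d ≃L[ℝ] Cover d)) : Prop where
  ball : IsOpenBall Q
  subset : Q ⊆ D
  word_mem : w ∈ W
  point_mem : P ∈ Q
  hyperbolic : IsHyperbolicFixedPoint D G w P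
  cones : AreCommonCones D G W Q Φs Φu

/-- `(P, Q)` is a symbolic `cs`-blender: for every `cs`-strip `Δ ⊆ Q` there is a composition
`G_u` of the maps of the words in `W` such that `G_u⁻¹(Δ)` has a point `q` of transverse
intersection with `W^u(P)`. -/
def IsSymbolicCsBlender {d : ℕ} {ι : Type*} (D : Set (Phase d)) (G : ι → Phase d → Phase d)
    (W : Finset (List ι)) (w : List ι) (Q : Set (Phase d)) (P : Phase d) : Prop :=
  ∃ Φs Φu : Phase d → (Cover d ≃L[ℝ] Cover d), BlenderFrame D G W w Q P Φs Φu ∧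
    ∀ Δ, IsStrip Q Φs Δ →
      ∃ us : List (List ι), (∀ u ∈ us, u ∈ W) ∧
        ∃ q ∈ wordDom D G us.flatten, ∃ L : Cover d →L[ℝ] Cover d,
          ∃ V V' : Submodule ℝ (Cover d),
            HasDiffAt (wordMap G us.flatten) L q ∧ Function.Bijective L ∧
            IsTangentAt Δ (wordMap G us.flatten q) V ∧
            IsTangentAt (localUnstable D G w Q P) q V' ∧
            V.comap L.toLinearMap ⊔ V' = ⊤

/-- `(P, Q)` is a symbolic `cu`-blender: for every `cu`-strip `Δ ⊆ Q` there is a composition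
`G_u` of the maps of the words in `W` such that `G_u(Δ)` has a point `G_u(q)` of transverse
intersection with `W^s(P)`. -/
def IsSymbolicCuBlender {d : ℕ} {ι : Type*} (D : Set (Phase d)) (G : ι → Phase d → Phase d)
    (W : Finset (List ι)) (w : List ι) (Q : Set (Phase d)) (P : Phase d) : Prop :=
  ∃ Φs Φu : Phase d → (Cover d ≃L[ℝ] Cover d), BlenderFrame D G W w Q P Φs Φu ∧
    ∀ Δ, IsStrip Q Φu Δ →
      ∃ us : List (List ι), (∀ u ∈ us, u ∈ W) ∧
        ∃ q ∈ wordDom D G us.flatten, ∃ L : Cover d →L[ℝ] Cover d,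
          ∃ V V' : Submodule ℝ (Cover d),
            HasDiffAt (wordMap G us.flatten) L q ∧ Function.Bijective L ∧
            IsTangentAt Δ q V ∧
            IsTangentAt (localStable D G w Q P) (wordMap G us.flatten q) V' ∧
            V.map L.toLinearMap ⊔ V' = ⊤

/-- The IFS generated by the maps `G i` displays a symbolic double blender: a symbolic `cu`-blender
`(P, Q)` and a symbolic `cs`-blender `(P', Q')` such that `W^s(P)` and `W^u(P')` have a point of
transverse intersection. -/
def HasSymbolicDoubleBlender {d : ℕ} {ι : Type*} (D : Set (Phase d))
    (G : ι → Phase d → Phase d) : Prop :=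
  ∃ (W W' : Finset (List ι)) (w w' : List ι) (Q Q' : Set (Phase d)) (P P' : Phase d),
    IsSymbolicCuBlender D G W w Q P ∧ IsSymbolicCsBlender D G W' w' Q' P' ∧
    ∃ (q : Phase d) (V V' : Submodule ℝ (Cover d)),
      IsTangentAt (localStable D G w Q P) q V ∧
      IsTangentAt (localUnstable D G w' Q' P') q V' ∧ V ⊔ V' = ⊤

/-!
Near `J = 0` the actions are scaled as `J = ε j`. For a number of iterations of order `s / ε`, the
twist map is then close to the shear `(φ, j) ↦ (φ + s A j, j)` followed by a translation of `φ`,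
and the kick is close to `(φ, j) ↦ (φ, j + B φ)`. By Kronecker's theorem, which holds with bounds
uniform over all `β` of a given constant type (`exists_kronecker_bound`), the translation is
arbitrary up to a small error, after a bounded number of additional iterations.

Consider the words made of one kick between two long blocks of the twist map. In an eigenbasis of
`A B` with eigenvalues `λ`, let `x` be the angle and `w` the velocity of the angle under the twist.
In the coordinates `a = x - s w` and `y = 20 (x + s w)`, the word is close to an affine map with
linear part `(a, y) ↦ (y / 20, μ y - 20 a)`, where `μ = 2 + 2 s λ` (`exists_saddleChart`), and
arbitrary translation part. For large `s` this is a strong saddle on a ball `‖(a, y)‖ < ρ`. By the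
choice of the translation, every point of the ball can be sent close to its centre, and every point
can be reached from a point close to the centre; these are the defining properties of a return
system (`IsReturnSystem`). Moreover two words of consecutive lengths, with one and with two kicks,
nearly fix the centre (`PerturbedPair.exists_returnSystem`).

Orbits of saddle maps are treated as solutions of a two-sided boundary value problem, with `a`
prescribed at time zero and propagated forwards, and `y` propagated backwards
(`exists_bvp_solution`). The solutions give `C¹` graphs as local stable and unstable sets
(`SaddleProblem.exists_graph`), and shadowing orbits with a prescribed condition at the start, such
as to lie on a given strip (`exists_forward_orbit`, `exists_backward_orbit`). For a return system,
the pseudo-orbit which follows a point of a strip close to the centre, and continues with the word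
of the fixed point `P`, is shadowed by an orbit from the strip to the local stable set of `P`. Thus
the same ball and the same point `P` yield both a `cu`-blender and a `cs`-blender, and the local
stable and unstable sets of `P` are transverse at `P` (`IsReturnSystem.hasSymbolicDoubleBlender`).

Shadowing also connects neighbourhoods of any two points of the ball by words of every large
length, as the lengths of the two words that nearly fix the centre are coprime
(`IsReturnSystem.exists_connection`). Finally, points with `|J| ≤ √ε` are moved into the ball by
kicks applied at well chosen angles: a kick changes the action by about `ε δ` in a direction of
choice, whereas the drift of the actions during the bounded number of twists needed to adjust the
angle is of order `|J|³ ≤ ε √ε` (`exists_control`). The same applies to inverse maps, and all maps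
involved are local homeomorphisms, so that the connections carry mixing from the ball to the whole
annulus.
-/

/-! ### Two-sided boundary value problems on sequences -/

/-- A version of the Banach fixed point theorem on sequences, where the `k`-th term is confined to
a ball whose radius `r k` depends on `k`. -/
theorem exists_fixedPoint_seq {X : Type*} [NormedAddCommGroup X] [CompleteSpace X] {q : ℝ}
    (hq0 : 0 ≤ q) (hq : q < 1) (p : ℕ → X) (r : ℕ → ℝ) (hr : ∀ k, 0 ≤ r k)
    (Θ : (ℕ → X) → (ℕ → X))
    (hmaps : ∀ z, (∀ k, ‖z k - p k‖ ≤ r k) → ∀ k, ‖Θ z k - p k‖ ≤ r k)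
    (hcontr : ∀ z w, (∀ k, ‖z k - p k‖ ≤ r k) → (∀ k, ‖w k - p k‖ ≤ r k) → ∀ c, 0 ≤ c →
      (∀ k, ‖z k - w k‖ ≤ c * r k) → ∀ k, ‖Θ z k - Θ w k‖ ≤ q * c * r k) :
    ∃ z, (∀ k, ‖z k - p k‖ ≤ r k) ∧ Θ z = z := by
  -- The iterates of `Θ` converge in each coordinate, although not uniformly, as `r` may be
  -- unbounded.
  set u : ℕ → ℕ → X := fun n => Θ^[n] p with hu
  have hus : ∀ n, u (n + 1) = Θ (u n) := fun n => Function.iterate_succ_apply' Θ n p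
  have hS : ∀ n k, ‖u n k - p k‖ ≤ r k := by
    intro n
    induction n with
    | zero => intro k; simpa [hu] using hr k
    | succ n ih => rw [hus]; exact hmaps _ ih
  have hd : ∀ n k, ‖u n k - u (n + 1) k‖ ≤ q ^ n * r k := by
    intro n
    induction n with
    | zero => intro k; rw [norm_sub_rev]; simpa [hu] using hS 1 k
    | succ n ih =>
      intro k
      have := hcontr _ _ (hS n) (hS (n + 1)) (q ^ n) (by positivity) ih k
      simp only [hus] at this ⊢
      rwa [pow_succ']
  have hd' : ∀ k n, dist (u n k) (u (n + 1) k) ≤ r k * q ^ n := by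
    intro k n; rw [dist_eq_norm, mul_comm]; exact hd n k
  have hlim : ∀ k, ∃ a, Tendsto (fun n => u n k) atTop (𝓝 a) := fun k =>
    cauchySeq_tendsto_of_complete (cauchySeq_of_le_geometric q (r k) hq (hd' k))
  choose z hz using hlim
  have hzS : ∀ k, ‖z k - p k‖ ≤ r k := fun k =>
    le_of_tendsto ((hz k).sub_const (p k)).norm (Eventually.of_forall fun n => hS n k)
  have hzu : ∀ n k, ‖u n k - z k‖ ≤ q ^ n / (1 - q) * r k := by
    intro n k
    have := dist_le_of_le_geometric_of_tendsto q (r k) hq (hd' k) (hz k) n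
    rw [dist_eq_norm] at this
    calc _ ≤ _ := this
      _ = _ := by ring
  refine ⟨z, hzS, funext fun k => ?_⟩
  have h1 : Tendsto (fun n => u (n + 1) k) atTop (𝓝 (z k)) := (hz k).comp (tendsto_add_atTop_nat 1)
  have h2 : Tendsto (fun n => u (n + 1) k) atTop (𝓝 (Θ z k)) := by
    rw [tendsto_iff_norm_sub_tendsto_zero]
    have hb : ∀ n, ‖u (n + 1) k - Θ z k‖ ≤ q ^ n * (q / (1 - q) * r k) := by
      intro n
      rw [hus]
      have h1q : 0 < 1 - q := by linarith
      have := hcontr _ _ (hS n) hzS (q ^ n / (1 - q)) (by positivity) (hzu n) k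
      calc _ ≤ _ := this
        _ = _ := by ring
    have h0 : Tendsto (fun n : ℕ => q ^ n * (q / (1 - q) * r k)) atTop (𝓝 0) := by
      simpa using (tendsto_pow_atTop_nhds_zero_of_lt_one hq0 hq).mul_const (q / (1 - q) * r k)
    exact squeeze_zero (fun n => norm_nonneg _) hb h0
  exact tendsto_nhds_unique h2 h1

section BVP

variable {E : Type*} [NormedAddCommGroup E]

/-- Solvability of boundary value problems of saddle type: the first component is prescribed at
time `0` and propagated forwards, the second one is propagated backwards. -/
theorem exists_bvp_solution [CompleteSpace E] {θ : ℝ} (hθ0 : 0 ≤ θ) (hθ : θ < 1)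
    (p : ℕ → E × E) (r : ℕ → ℝ) (hr : ∀ k, 0 ≤ r k)
    (hr1 : ∀ k, r (k + 1) ≤ 2 * r k) (hr2 : ∀ k, r k ≤ 2 * r (k + 1))
    (g : E × E → E) (Γ : ℕ → (E × E) × (E × E) → E × E)
    (hg : ∀ z w, ‖z - p 0‖ ≤ r 0 → ‖w - p 0‖ ≤ r 0 → ‖g z - g w‖ ≤ θ * ‖z - w‖)
    (hgm : ∀ z, ‖z - p 0‖ ≤ r 0 → ‖g z - (p 0).1‖ ≤ r 0)
    (hΓ : ∀ k z z' w w', ‖z - p k‖ ≤ r k → ‖z' - p (k + 1)‖ ≤ r (k + 1) → ‖w - p k‖ ≤ r k →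
      ‖w' - p (k + 1)‖ ≤ r (k + 1) →
      ‖Γ k (z, z') - Γ k (w, w')‖ ≤ θ / 2 * max ‖z - w‖ ‖z' - w'‖)
    (hΓm : ∀ k z z', ‖z - p k‖ ≤ r k → ‖z' - p (k + 1)‖ ≤ r (k + 1) →
      ‖(Γ k (z, z')).1 - (p (k + 1)).1‖ ≤ r (k + 1) ∧ ‖(Γ k (z, z')).2 - (p k).2‖ ≤ r k) :
    ∃ z : ℕ → E × E, (∀ k, ‖z k - p k‖ ≤ r k) ∧ (z 0).1 = g (z 0) ∧
      ∀ k, Γ k (z k, z (k + 1)) = ((z (k + 1)).1, (z k).2) := by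
  set α : (ℕ → E × E) → ℕ → E := fun z k =>
    Nat.casesOn k (g (z 0)) (fun j => (Γ j (z j, z (j + 1))).1) with hα
  obtain ⟨z, hz, hfix⟩ := exists_fixedPoint_seq hθ0 hθ p r hr
    (fun z k => (α z k, (Γ k (z k, z (k + 1))).2)) (by
      intro z hz k
      refine max_le ?_ (hΓm k _ _ (hz k) (hz _)).2
      cases k with
      | zero => exact hgm _ (hz 0)
      | succ j => exact (hΓm j _ _ (hz j) (hz _)).1) (by
      intro z w hz hw c hc hzw k
      have key : ∀ k, max ‖z k - w k‖ ‖z (k + 1) - w (k + 1)‖ ≤ 2 * c * r k ∧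
          max ‖z k - w k‖ ‖z (k + 1) - w (k + 1)‖ ≤ 2 * c * r (k + 1) := by
        intro k
        have h1 := hzw k
        have h2 := hzw (k + 1)
        have h3 := mul_le_mul_of_nonneg_left (hr1 k) hc
        have h4 := mul_le_mul_of_nonneg_left (hr2 k) hc
        have h5 := mul_nonneg hc (hr k)
        have h6 := mul_nonneg hc (hr (k + 1))
        exact ⟨max_le (by linarith) (by linarith), max_le (by linarith) (by linarith)⟩
      have hG : ∀ k, ‖Γ k (z k, z (k + 1)) - Γ k (w k, w (k + 1))‖ ≤ θ * c * r k ∧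
          ‖Γ k (z k, z (k + 1)) - Γ k (w k, w (k + 1))‖ ≤ θ * c * r (k + 1) := by
        intro k
        have h := hΓ k _ _ _ _ (hz k) (hz _) (hw k) (hw _)
        have h1 := mul_le_mul_of_nonneg_left (key k).1 (by linarith : 0 ≤ θ / 2)
        have h2 := mul_le_mul_of_nonneg_left (key k).2 (by linarith : 0 ≤ θ / 2)
        exact ⟨by linarith, by linarith⟩
      refine max_le ?_ ((norm_snd_le (Γ k (z k, z (k + 1)) - Γ k (w k, w (k + 1)))).trans (hG k).1)
      cases k with
      | zero =>
        have h1 := hg _ _ (hz 0) (hw 0)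
        have h2 := mul_le_mul_of_nonneg_left (hzw 0) hθ0
        exact h1.trans (by linarith)
      | succ j => exact (norm_fst_le (Γ j (z j, z (j + 1)) - Γ j (w j, w (j + 1)))).trans (hG j).2)
  refine ⟨z, hz, ?_, fun k => ?_⟩
  · exact (congrArg Prod.fst (congrFun hfix 0)).symm
  · have h1 := congrArg Prod.fst (congrFun hfix (k + 1))
    have h2 := congrArg Prod.snd (congrFun hfix k)
    exact Prod.ext h1 h2

/-- A priori bound for bounded sequences satisfying the inequalities of a boundary value problem of
saddle type. -/
theorem bvp_bound {θ c₀ c₁ M : ℝ} (hθ0 : 0 ≤ θ) (hθ : θ < 1) {D : ℕ → E × E}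
    (hb : ∀ k, ‖D k‖ ≤ M) (h0 : ‖(D 0).1‖ ≤ c₀)
    (h1 : ∀ k, ‖(D (k + 1)).1‖ ≤ θ * max ‖D k‖ ‖D (k + 1)‖ + c₁)
    (h2 : ∀ k, ‖(D k).2‖ ≤ θ * max ‖D k‖ ‖D (k + 1)‖ + c₁) (k : ℕ) :
    ‖D k‖ ≤ max c₀ (c₁ / (1 - θ)) := by
  have hB : BddAbove (range fun k => ‖D k‖) := ⟨M, by rintro _ ⟨k, rfl⟩; exact hb k⟩
  -- The supremum `s` satisfies `s ≤ max c₀ (θ s + c₁)`.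
  set s := ⨆ k, ‖D k‖ with hs
  have hle : ∀ k, ‖D k‖ ≤ s := fun k => le_ciSup hB k
  have hm : ∀ k, θ * max ‖D k‖ ‖D (k + 1)‖ + c₁ ≤ θ * s + c₁ := fun k => by
    have := mul_le_mul_of_nonneg_left (max_le (hle k) (hle (k + 1))) hθ0
    linarith
  have hk : ∀ k, ‖D k‖ ≤ max c₀ (θ * s + c₁) := by
    intro k
    refine max_le ?_ (((h2 k).trans (hm k)).trans (le_max_right _ _))
    cases k with
    | zero => exact h0.trans (le_max_left _ _)
    | succ j => exact ((h1 j).trans (hm j)).trans (le_max_right _ _)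
  have hs' : s ≤ max c₀ (θ * s + c₁) := ciSup_le hk
  refine (hle k).trans ?_
  rcases le_max_iff.1 hs' with h | h
  · exact h.trans (le_max_left _ _)
  · refine le_trans ?_ (le_max_right _ _)
    rw [le_div_iff₀ (by linarith)]
    nlinarith

end BVP

/-! ### Initial points of bounded orbits form a graph -/

section StableGraph

variable {E : Type*} [NormedAddCommGroup E] [NormedSpace ℝ E]

/-- A boundary value problem of saddle type, not depending on time: `Γ` is a `C¹` contraction with
constant `θ < 1/2` on the ball of radius `R`, which maps the ball of radius `r` into itself. -/
structure SaddleProblem (θ r R : ℝ) (Γ : (E × E) × (E × E) → E × E) : Prop where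
  pos : 0 ≤ θ
  lt_half : θ < 1 / 2
  rpos : 0 < r
  rlt : r < R
  lip : ∀ z ∈ Metric.ball (0 : (E × E) × (E × E)) R, ∀ w ∈ Metric.ball 0 R,
    ‖Γ z - Γ w‖ ≤ θ * ‖z - w‖
  smooth : ContDiffOn ℝ 1 Γ (Metric.ball 0 R)
  small : ‖Γ 0‖ < (1 - θ) * r

variable {θ r R : ℝ} {Γ : (E × E) × (E × E) → E × E}

/-- The bounded solutions of a saddle problem. -/
def IsSaddleOrbit (r : ℝ) (Γ : (E × E) × (E × E) → E × E) (z : ℕ → E × E) : Prop :=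
  (∀ k, ‖z k‖ ≤ r) ∧ ∀ k, Γ (z k, z (k + 1)) = ((z (k + 1)).1, (z k).2)

theorem SaddleProblem.mem (h : SaddleProblem θ r R Γ) {z z' : E × E} (hz : ‖z‖ ≤ r)
    (hz' : ‖z'‖ ≤ r) : (z, z') ∈ Metric.ball (0 : (E × E) × (E × E)) R := by
  rw [mem_ball_zero_iff]
  exact (max_le hz hz').trans_lt h.rlt

theorem SaddleProblem.lip' (h : SaddleProblem θ r R Γ) {z z' w w' : E × E} (hz : ‖z‖ ≤ r)
    (hz' : ‖z'‖ ≤ r) (hw : ‖w‖ ≤ r) (hw' : ‖w'‖ ≤ r) :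
    ‖Γ (z, z') - Γ (w, w')‖ ≤ θ * max ‖z - w‖ ‖z' - w'‖ :=
  h.lip _ (h.mem hz hz') _ (h.mem hw hw')

theorem SaddleProblem.norm_lt (h : SaddleProblem θ r R Γ) {z z' : E × E} (hz : ‖z‖ ≤ r)
    (hz' : ‖z'‖ ≤ r) : ‖Γ (z, z')‖ < r := by
  have hr0 : ‖(0 : E × E)‖ ≤ r := by rw [norm_zero]; exact h.rpos.le
  have h0 := h.lip' hz hz' hr0 hr0
  have h1 : max ‖z - 0‖ ‖z' - 0‖ ≤ r := by simpa using ⟨hz, hz'⟩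
  have h2 := mul_le_mul_of_nonneg_left h1 h.pos
  have h3 := h.small
  have h4 : ‖Γ (z, z')‖ ≤ ‖Γ (z, z') - Γ 0‖ + ‖Γ 0‖ := by
    simpa using norm_add_le (Γ (z, z') - Γ 0) (Γ 0)
  have h5 : ‖Γ (z, z') - Γ 0‖ ≤ θ * max ‖z - 0‖ ‖z' - 0‖ := h0
  linarith

theorem SaddleProblem.exists_orbit [CompleteSpace E] (h : SaddleProblem θ r R Γ) {a : E}
    (ha : ‖a‖ ≤ r) : ∃ z, IsSaddleOrbit r Γ z ∧ (z 0).1 = a := by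
  have hr := h.rpos.le
  obtain ⟨z, hz, hz0, hzΓ⟩ := exists_bvp_solution (θ := 2 * θ) (by linarith [h.pos])
    (by linarith [h.lt_half]) (fun _ => (0 : E × E)) (fun _ => r) (fun _ => hr)
    (fun _ => by linarith) (fun _ => by linarith) (fun _ => a) (fun _ => Γ)
    (fun z w _ _ => by simpa using mul_nonneg (mul_nonneg zero_le_two h.pos) (norm_nonneg (z - w)))
    (fun z _ => by simpa using ha)
    (fun k z z' w w' hz hz' hw hw' => by
      simp only [sub_zero] at hz hz' hw hw'
      have := h.lip' hz hz' hw hw'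
      rwa [mul_div_cancel_left₀ _ (two_ne_zero' ℝ)])
    (fun k z z' hz hz' => by
      simp only [sub_zero, Prod.fst_zero, Prod.snd_zero] at hz hz' ⊢
      have := (h.norm_lt hz hz').le
      exact ⟨(norm_fst_le _).trans this, (norm_snd_le _).trans this⟩)
  exact ⟨z, ⟨fun k => by simpa using hz k, hzΓ⟩, hz0⟩

/-- Orbits of a saddle problem depend Lipschitz continuously on their initial first component. -/
theorem SaddleProblem.norm_orbit_sub_le (h : SaddleProblem θ r R Γ) {z w : ℕ → E × E}
    (hz : IsSaddleOrbit r Γ z) (hw : IsSaddleOrbit r Γ w) (k : ℕ) :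
    ‖z k - w k‖ ≤ ‖(z 0).1 - (w 0).1‖ := by
  have hl : ∀ k, ‖Γ (z k, z (k + 1)) - Γ (w k, w (k + 1))‖ ≤
      θ * max ‖z k - w k‖ ‖z (k + 1) - w (k + 1)‖ := fun k =>
    h.lip' (hz.1 k) (hz.1 _) (hw.1 k) (hw.1 _)
  have := bvp_bound (c₁ := 0) (M := 2 * r) h.pos (by linarith [h.lt_half])
    (D := fun k => z k - w k)
    (fun k => (norm_sub_le _ _).trans (by linarith [hz.1 k, hw.1 k])) le_rfl
    (fun k => by
      have := hl k
      rw [hz.2, hw.2] at this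
      simpa using (norm_fst_le _).trans this)
    (fun k => by
      have := hl k
      rw [hz.2, hw.2] at this
      simpa using (norm_snd_le _).trans this) k
  simpa using this

/-- The initial second component of an orbit is a `θ`-Lipschitz function of the first one; in
particular it is determined by it. -/
theorem SaddleProblem.norm_snd_sub_le (h : SaddleProblem θ r R Γ) {z w : ℕ → E × E}
    (hz : IsSaddleOrbit r Γ z) (hw : IsSaddleOrbit r Γ w) :
    ‖(z 0).2 - (w 0).2‖ ≤ θ * ‖(z 0).1 - (w 0).1‖ := by
  have hl := h.lip' (hz.1 0) (hz.1 1) (hw.1 0) (hw.1 1)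
  rw [hz.2, hw.2] at hl
  refine (norm_snd_le _).trans (hl.trans ?_)
  exact mul_le_mul_of_nonneg_left
    (max_le (h.norm_orbit_sub_le hz hw 0) (h.norm_orbit_sub_le hz hw 1)) h.pos

/-- Any two orbits of a saddle problem are asymptotic. -/
theorem SaddleProblem.tendsto_orbit_sub (h : SaddleProblem θ r R Γ) {z w : ℕ → E × E}
    (hz : IsSaddleOrbit r Γ z) (hw : IsSaddleOrbit r Γ w) :
    Tendsto (fun k => z k - w k) atTop (𝓝 0) := by
  have shift : ∀ {z : ℕ → E × E}, IsSaddleOrbit r Γ z → ∀ j,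
      IsSaddleOrbit r Γ (fun k => z (j + k)) := fun hz j => ⟨fun k => hz.1 _, fun k => hz.2 _⟩
  have hb : ∀ j k, ‖z (j + k) - w (j + k)‖ ≤ θ ^ j * (2 * r) := by
    intro j
    induction j with
    | zero =>
      intro k
      exact (norm_sub_le _ _).trans (by linarith [hz.1 (0 + k), hw.1 (0 + k)])
    | succ j ih =>
      intro k
      have h1 := h.norm_orbit_sub_le (shift hz (j + 1)) (shift hw (j + 1)) k
      refine h1.trans ?_
      have h2 := h.lip' (hz.1 j) (hz.1 (j + 1)) (hw.1 j) (hw.1 (j + 1))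
      rw [hz.2, hw.2] at h2
      refine ((norm_fst_le _).trans h2).trans ?_
      rw [pow_succ', mul_assoc]
      exact mul_le_mul_of_nonneg_left (max_le (ih 0) (ih 1)) h.pos
  refine squeeze_zero_norm (a := fun k => θ ^ k * (2 * r)) (fun k => hb k 0) ?_
  simpa using (tendsto_pow_atTop_nhds_zero_of_lt_one h.pos
    (by linarith [h.lt_half])).mul_const (2 * r)

theorem SaddleProblem.hasFDerivAt (h : SaddleProblem θ r R Γ) {ζ : (E × E) × (E × E)}
    (hζ : ζ ∈ Metric.ball (0 : (E × E) × (E × E)) R) : HasFDerivAt Γ (fderiv ℝ Γ ζ) ζ :=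
  ((h.smooth.differentiableOn one_ne_zero).differentiableAt
    (Metric.isOpen_ball.mem_nhds hζ)).hasFDerivAt

theorem SaddleProblem.norm_fderiv_le (h : SaddleProblem θ r R Γ) {ζ : (E × E) × (E × E)}
    (hζ : ζ ∈ Metric.ball (0 : (E × E) × (E × E)) R) : ‖fderiv ℝ Γ ζ‖ ≤ θ :=
  (h.hasFDerivAt hζ).le_of_lip' h.pos <| by
    filter_upwards [Metric.isOpen_ball.mem_nhds hζ] with w hw using h.lip _ hw _ hζ

/-- The differential of a saddle problem is uniformly continuous on the ball of radius `r`, because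
this ball is compact. -/
theorem SaddleProblem.fderiv_modulus [FiniteDimensional ℝ E] (h : SaddleProblem θ r R Γ) {ω : ℝ}
    (hω : 0 < ω) : ∃ δ > 0, ∀ ζ ζ' : (E × E) × (E × E), ‖ζ‖ ≤ r → ‖ζ'‖ ≤ r → ‖ζ' - ζ‖ < δ →
      ‖fderiv ℝ Γ ζ' - fderiv ℝ Γ ζ‖ ≤ ω ∧
      ‖Γ ζ' - Γ ζ - fderiv ℝ Γ ζ (ζ' - ζ)‖ ≤ ω * ‖ζ' - ζ‖ := by
  have hsub : Metric.closedBall (0 : (E × E) × (E × E)) r ⊆ Metric.ball 0 R :=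
    Metric.closedBall_subset_ball h.rlt
  have hc : ContinuousOn (fderiv ℝ Γ) (Metric.closedBall 0 r) :=
    (h.smooth.continuousOn_fderiv_of_isOpen Metric.isOpen_ball le_rfl).mono hsub
  have hu := (isCompact_closedBall (0 : (E × E) × (E × E)) r).uniformContinuousOn_of_continuous hc
  obtain ⟨δ, hδ, hδ'⟩ := Metric.uniformContinuousOn_iff.1 hu ω hω
  have key : ∀ ζ ζ' : (E × E) × (E × E), ‖ζ‖ ≤ r → ‖ζ'‖ ≤ r → ‖ζ' - ζ‖ < δ →
      ‖fderiv ℝ Γ ζ' - fderiv ℝ Γ ζ‖ ≤ ω := fun ζ ζ' hζ hζ' hd => by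
    rw [← dist_eq_norm] at hd ⊢
    exact (hδ' ζ' (by simpa using hζ') ζ (by simpa using hζ) hd).le
  refine ⟨δ, hδ, fun ζ ζ' hζ hζ' hd => ⟨key ζ ζ' hζ hζ' hd, ?_⟩⟩
  have hs : Convex ℝ (Metric.closedBall (0 : (E × E) × (E × E)) r ∩ Metric.ball ζ δ) :=
    (convex_closedBall _ _).inter (convex_ball _ _)
  refine hs.norm_image_sub_le_of_norm_hasFDerivWithin_le' (f := Γ) (f' := fderiv ℝ Γ)
    (φ := fderiv ℝ Γ ζ) (fun x hx => (h.hasFDerivAt (hsub hx.1)).hasFDerivWithinAt)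
    (fun x hx => key ζ x hζ (by simpa using hx.1) (by simpa [dist_eq_norm] using hx.2))
    ⟨by simpa using hζ, Metric.mem_ball_self hδ⟩
    ⟨by simpa using hζ', by simpa [dist_eq_norm] using hd⟩

/-- The linearised saddle problem along an orbit; the unknowns are the derivatives of the orbit
with respect to its initial first component. -/
def IsTangentOrbit (Γ : (E × E) × (E × E) → E × E) (z : ℕ → E × E)
    (V : ℕ → (E →L[ℝ] E) × (E →L[ℝ] E)) : Prop :=
  (∀ k, ‖V k‖ ≤ 1) ∧ (V 0).1 = ContinuousLinearMap.id ℝ E ∧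
    ∀ k, (fderiv ℝ Γ (z k, z (k + 1))).comp
      (((V k).1.prod (V k).2).prod ((V (k + 1)).1.prod (V (k + 1)).2)) = (V (k + 1)).1.prod (V k).2

/-- The linearised problem is itself a boundary value problem of saddle type, for sequences of
linear maps. -/
theorem SaddleProblem.exists_tangentOrbit [CompleteSpace E] (h : SaddleProblem θ r R Γ)
    {z : ℕ → E × E} (hz : IsSaddleOrbit r Γ z) : ∃ V, IsTangentOrbit Γ z V := by
  set 𝒟 : ℕ → ((E × E) × (E × E)) →L[ℝ] E × E := fun k => fderiv ℝ Γ (z k, z (k + 1)) with h𝒟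
  have h𝒟n : ∀ k, ‖𝒟 k‖ ≤ θ := fun k => h.norm_fderiv_le (h.mem (hz.1 k) (hz.1 _))
  set S : ℕ → ((E →L[ℝ] E) × (E →L[ℝ] E)) × ((E →L[ℝ] E) × (E →L[ℝ] E)) → (E →L[ℝ] E × E) :=
    fun k W => (𝒟 k).comp ((W.1.1.prod W.1.2).prod (W.2.1.prod W.2.2)) with hS
  have hSub : ∀ k W W', S k W - S k W' = S k (W - W') := by
    intro k W W'
    ext x <;> simp [hS, ← map_sub]
  have hSn : ∀ k W, ‖S k W‖ ≤ θ * ‖W‖ := by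
    intro k W
    refine (ContinuousLinearMap.opNorm_comp_le _ _).trans ?_
    refine mul_le_mul (h𝒟n k) (le_of_eq ?_) (norm_nonneg _) h.pos
    rw [ContinuousLinearMap.opNorm_prod, Prod.norm_def, ContinuousLinearMap.opNorm_prod,
      ContinuousLinearMap.opNorm_prod]
    rfl
  have hcomp : ∀ T : E →L[ℝ] E × E, ‖(((ContinuousLinearMap.fst ℝ E E).comp T,
      (ContinuousLinearMap.snd ℝ E E).comp T) : (E →L[ℝ] E) × (E →L[ℝ] E))‖ ≤ ‖T‖ := by
    intro T
    have : T = ((ContinuousLinearMap.fst ℝ E E).comp T).prod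
        ((ContinuousLinearMap.snd ℝ E E).comp T) := by ext x <;> rfl
    conv_rhs => rw [this, ContinuousLinearMap.opNorm_prod]
  obtain ⟨V, hV, hV0, hVΓ⟩ := exists_bvp_solution (θ := 2 * θ) (by linarith [h.pos])
    (by linarith [h.lt_half]) (fun _ => (0 : (E →L[ℝ] E) × (E →L[ℝ] E))) (fun _ => 1)
    (fun _ => zero_le_one)
    (fun _ => by norm_num) (fun _ => by norm_num) (fun _ => ContinuousLinearMap.id ℝ E)
    (fun k W => ((ContinuousLinearMap.fst ℝ E E).comp (S k W),
      (ContinuousLinearMap.snd ℝ E E).comp (S k W)))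
    (fun z w _ _ => by simpa using mul_nonneg (mul_nonneg zero_le_two h.pos) (norm_nonneg (z - w)))
    (fun z _ => by simpa using ContinuousLinearMap.norm_id_le)
    (fun k W W₁ W' W₁' _ _ _ _ => by
      rw [Prod.mk_sub_mk, ← ContinuousLinearMap.comp_sub _ (S k (W, W₁)) (S k (W', W₁')),
        ← ContinuousLinearMap.comp_sub _ (S k (W, W₁)) (S k (W', W₁')), hSub,
        mul_div_cancel_left₀ _ (two_ne_zero' ℝ)]
      exact (hcomp _).trans (hSn _ _))
    (fun k W W' hW hW' => by
      simp only [sub_zero] at hW hW'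
      have h1 := (hcomp (S k (W, W'))).trans (hSn _ _)
      have h2 := mul_le_mul_of_nonneg_left (max_le hW hW') h.pos
      have h3 : θ * ‖(W, W')‖ ≤ 1 := le_trans h2 (by linarith [h.lt_half])
      simp only [Prod.fst_zero, Prod.snd_zero, sub_zero]
      exact ⟨(norm_fst_le _).trans (h1.trans h3), (norm_snd_le _).trans (h1.trans h3)⟩)
  refine ⟨V, fun k => by simpa using hV k, hV0, fun k => ?_⟩
  have h1 := congrArg Prod.fst (hVΓ k)
  have h2 := congrArg Prod.snd (hVΓ k)
  have h3 : S k (V k, V (k + 1)) = ((ContinuousLinearMap.fst ℝ E E).comp (S k (V k, V (k + 1)))).prod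
      ((ContinuousLinearMap.snd ℝ E E).comp (S k (V k, V (k + 1)))) := by ext x <;> rfl
  exact h3.trans (congrArg₂ ContinuousLinearMap.prod h1 h2)

/-- The initial points of the orbits of a saddle problem form the graph of a `C¹` function. -/
theorem SaddleProblem.exists_graph [FiniteDimensional ℝ E] (h : SaddleProblem θ r R Γ) :
    ∃ η : E → E, (∀ a, ‖a‖ ≤ r → ∃ z, IsSaddleOrbit r Γ z ∧ z 0 = (a, η a)) ∧
      (∀ z, IsSaddleOrbit r Γ z → (z 0).2 = η (z 0).1) ∧
      ∀ a, ‖a‖ < r → ContDiffAt ℝ 1 η a ∧ ‖fderiv ℝ η a‖ ≤ θ := by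
  have : CompleteSpace E := FiniteDimensional.complete ℝ E
  have hex : ∀ a : E, ∃ z, ‖a‖ ≤ r → IsSaddleOrbit r Γ z ∧ (z 0).1 = a := by
    intro a
    by_cases ha : ‖a‖ ≤ r
    · obtain ⟨z, hz⟩ := h.exists_orbit ha
      exact ⟨z, fun _ => hz⟩
    · exact ⟨fun _ => 0, fun h => absurd h ha⟩
  choose Z hZ using hex
  have hVex : ∀ a : E, ∃ V, ‖a‖ ≤ r → IsTangentOrbit Γ (Z a) V := by
    intro a
    by_cases ha : ‖a‖ ≤ r
    · obtain ⟨V, hV⟩ := h.exists_tangentOrbit (hZ a ha).1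
      exact ⟨V, fun _ => hV⟩
    · exact ⟨fun _ => 0, fun h => absurd h ha⟩
  choose V hV using hVex
  have hθ1 : 0 < 1 - θ := by linarith [h.lt_half]
  have hZd : ∀ a a' : E, ‖a‖ ≤ r → ‖a'‖ ≤ r → ∀ k, ‖Z a' k - Z a k‖ ≤ ‖a' - a‖ := by
    intro a a' ha ha' k
    have := h.norm_orbit_sub_le (hZ a' ha').1 (hZ a ha).1 k
    rwa [(hZ a' ha').2, (hZ a ha).2] at this
  have hnb : ∀ a : E, ‖a‖ < r → ∀ δ > (0 : ℝ), ∀ᶠ a' in 𝓝 a, ‖a'‖ ≤ r ∧ ‖a' - a‖ < δ := by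
    intro a ha δ hδ
    have h1 : ∀ᶠ a' in 𝓝 a, ‖a'‖ < r :=
      (continuous_norm.tendsto a).eventually_lt_const ha
    filter_upwards [h1, Metric.ball_mem_nhds a hδ] with a' h1 h2
    exact ⟨h1.le, by simpa [dist_eq_norm] using h2⟩
  -- The error of the linear approximation of the whole orbit solves a boundary value problem
  -- with a small inhomogeneity, and `bvp_bound` applies; the continuity of the derivative is
  -- obtained in the same way.
  have hder : ∀ a : E, ‖a‖ < r → HasFDerivAt (fun a => (Z a 0).2) (V a 0).2 a := by
    intro a ha
    refine HasFDerivAt.of_isLittleO (Asymptotics.isLittleO_iff.2 fun c hc => ?_)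
    obtain ⟨δ, hδ, hmod⟩ := h.fderiv_modulus (mul_pos hc hθ1)
    filter_upwards [hnb a ha δ hδ] with a' ha'
    have hT := hV a ha.le
    have hO := hZ a ha.le
    have hO' := hZ a' ha'.1
    set D : ℕ → E × E := fun k => Z a' k - Z a k - ((V a k).1 (a' - a), (V a k).2 (a' - a)) with hD
    have hstep : ∀ k, ‖((D (k + 1)).1, (D k).2)‖ ≤
        θ * max ‖D k‖ ‖D (k + 1)‖ + c * (1 - θ) * ‖a' - a‖ := by
      intro k
      have hdist : ‖(Z a' k, Z a' (k + 1)) - (Z a k, Z a (k + 1))‖ ≤ ‖a' - a‖ :=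
        max_le (hZd a a' ha.le ha'.1 k) (hZd a a' ha.le ha'.1 _)
      have h1 := (hmod (Z a k, Z a (k + 1)) (Z a' k, Z a' (k + 1))
        (max_le (hO.1.1 k) (hO.1.1 _)) (max_le (hO'.1.1 k) (hO'.1.1 _))
        (hdist.trans_lt ha'.2)).2
      have h2 := (fderiv ℝ Γ (Z a k, Z a (k + 1))).le_opNorm (D k, D (k + 1))
      have h2' := mul_le_mul_of_nonneg_right
        (h.norm_fderiv_le (h.mem (hO.1.1 k) (hO.1.1 (k + 1)))) (norm_nonneg (D k, D (k + 1)))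
      have hlin := DFunLike.congr_fun (hT.2.2 k) (a' - a)
      have heq : ((D (k + 1)).1, (D k).2) =
          (Γ (Z a' k, Z a' (k + 1)) - Γ (Z a k, Z a (k + 1)) -
            fderiv ℝ Γ (Z a k, Z a (k + 1)) ((Z a' k, Z a' (k + 1)) - (Z a k, Z a (k + 1)))) +
          fderiv ℝ Γ (Z a k, Z a (k + 1)) (D k, D (k + 1)) := by
        have e1 : ((D k, D (k + 1)) : (E × E) × (E × E)) =
            ((Z a' k, Z a' (k + 1)) - (Z a k, Z a (k + 1))) -
            ((((V a k).1.prod (V a k).2).prod ((V a (k + 1)).1.prod (V a (k + 1)).2)) (a' - a)) :=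
          rfl
        rw [ContinuousLinearMap.comp_apply] at hlin
        rw [e1, map_sub (fderiv ℝ Γ (Z a k, Z a (k + 1)))
          ((Z a' k, Z a' (k + 1)) - (Z a k, Z a (k + 1))), hlin, hO.1.2, hO'.1.2]
        simp only [hD, ContinuousLinearMap.prod_apply]
        ext <;> simp
      rw [heq]
      refine (norm_add_le _ _).trans ?_
      have h3 : c * (1 - θ) * ‖(Z a' k, Z a' (k + 1)) - (Z a k, Z a (k + 1))‖ ≤
          c * (1 - θ) * ‖a' - a‖ := mul_le_mul_of_nonneg_left hdist (by positivity)
      have h4 : ‖(D k, D (k + 1))‖ = max ‖D k‖ ‖D (k + 1)‖ := rfl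
      rw [h4] at h2 h2'
      linarith
    have hDb : ∀ k, ‖D k‖ ≤ ‖a' - a‖ + ‖a' - a‖ := by
      intro k
      refine (norm_sub_le _ _).trans (add_le_add (hZd a a' ha.le ha'.1 k) ?_)
      have h1 := hT.1 k
      refine max_le ?_ ?_
      · refine ((V a k).1.le_opNorm _).trans ?_
        exact mul_le_of_le_one_left (norm_nonneg _) ((norm_fst_le (V a k)).trans h1)
      · refine ((V a k).2.le_opNorm _).trans ?_
        exact mul_le_of_le_one_left (norm_nonneg _) ((norm_snd_le (V a k)).trans h1)
    have hfin := bvp_bound (c₀ := 0) h.pos (by linarith [h.lt_half]) (D := D) hDb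
      (by simp [hD, hT.2.1, hO.2, hO'.2])
      (fun k => (norm_fst_le ((D (k + 1)).1, (D k).2)).trans (hstep k))
      (fun k => (norm_snd_le ((D (k + 1)).1, (D k).2)).trans (hstep k)) 0
    have hval : max 0 (c * (1 - θ) * ‖a' - a‖ / (1 - θ)) = c * ‖a' - a‖ := by
      rw [max_eq_right (by positivity)]
      field_simp
    rw [hval] at hfin
    exact (norm_snd_le (D 0)).trans hfin
  have hcont : ∀ a : E, ‖a‖ < r → ContinuousAt (fun a => (V a 0).2) a := by
    intro a ha
    rw [Metric.continuousAt_iff']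
    intro c hc
    obtain ⟨δ, hδ, hmod⟩ := h.fderiv_modulus (mul_pos (half_pos hc) hθ1)
    filter_upwards [hnb a ha δ hδ] with a' ha'
    have hT := hV a ha.le
    have hT' := hV a' ha'.1
    have hO := hZ a ha.le
    have hO' := hZ a' ha'.1
    set D : ℕ → (E →L[ℝ] E) × (E →L[ℝ] E) := fun k => V a' k - V a k with hD
    have hstep : ∀ k, ‖((D (k + 1)).1, (D k).2)‖ ≤
        θ * max ‖D k‖ ‖D (k + 1)‖ + c / 2 * (1 - θ) := by
      intro k
      have hdist : ‖(Z a' k, Z a' (k + 1)) - (Z a k, Z a (k + 1))‖ ≤ ‖a' - a‖ :=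
        max_le (hZd a a' ha.le ha'.1 k) (hZd a a' ha.le ha'.1 _)
      have h1 := (hmod (Z a k, Z a (k + 1)) (Z a' k, Z a' (k + 1))
        (max_le (hO.1.1 k) (hO.1.1 _)) (max_le (hO'.1.1 k) (hO'.1.1 _))
        (hdist.trans_lt ha'.2)).1
      have hn : ∀ P Q : (E →L[ℝ] E) × (E →L[ℝ] E),
          ‖(P.1.prod P.2).prod (Q.1.prod Q.2)‖ = max ‖P‖ ‖Q‖ := by
        intro P Q
        rw [ContinuousLinearMap.opNorm_prod, Prod.norm_def, ContinuousLinearMap.opNorm_prod,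
          ContinuousLinearMap.opNorm_prod]
      have heq : (D (k + 1)).1.prod (D k).2 =
          (fderiv ℝ Γ (Z a' k, Z a' (k + 1))).comp
            (((D k).1.prod (D k).2).prod ((D (k + 1)).1.prod (D (k + 1)).2)) +
          (fderiv ℝ Γ (Z a' k, Z a' (k + 1)) - fderiv ℝ Γ (Z a k, Z a (k + 1))).comp
            (((V a k).1.prod (V a k).2).prod ((V a (k + 1)).1.prod (V a (k + 1)).2)) := by
        rw [ContinuousLinearMap.sub_comp, hT.2.2 k]
        have e1 : ((D k).1.prod (D k).2).prod ((D (k + 1)).1.prod (D (k + 1)).2) =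
            ((V a' k).1.prod (V a' k).2).prod ((V a' (k + 1)).1.prod (V a' (k + 1)).2) -
            ((V a k).1.prod (V a k).2).prod ((V a (k + 1)).1.prod (V a (k + 1)).2) := by
          ext x <;> simp [hD]
        rw [e1, ContinuousLinearMap.comp_sub, hT'.2.2 k]
        ext x <;> simp [hD]
      have hnn : ‖((D (k + 1)).1, (D k).2)‖ = ‖(D (k + 1)).1.prod (D k).2‖ :=
        (ContinuousLinearMap.opNorm_prod _ _).symm
      rw [hnn, heq]
      refine (norm_add_le _ _).trans (add_le_add ?_ ?_)
      · refine (ContinuousLinearMap.opNorm_comp_le _ _).trans ?_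
        rw [hn]
        exact mul_le_mul_of_nonneg_right (h.norm_fderiv_le (h.mem (hO'.1.1 k) (hO'.1.1 _)))
          (le_max_of_le_left (norm_nonneg _))
      · refine (ContinuousLinearMap.opNorm_comp_le _ _).trans ?_
        rw [hn]
        exact (mul_le_mul h1 (max_le (hT.1 k) (hT.1 _)) (le_max_of_le_left (norm_nonneg _))
          (by positivity)).trans_eq (mul_one _)
    have hfin := bvp_bound (c₀ := 0) (M := 2) h.pos (by linarith [h.lt_half]) (D := D)
      (fun k => (norm_sub_le _ _).trans (by linarith [hT.1 k, hT'.1 k]))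
      (by simp [hD, hT.2.1, hT'.2.1])
      (fun k => (norm_fst_le ((D (k + 1)).1, (D k).2)).trans (hstep k))
      (fun k => (norm_snd_le ((D (k + 1)).1, (D k).2)).trans (hstep k)) 0
    have hval : max 0 (c / 2 * (1 - θ) / (1 - θ)) = c / 2 := by
      rw [max_eq_right (by positivity)]
      field_simp
    rw [hval] at hfin
    rw [dist_eq_norm]
    exact ((norm_snd_le (D 0)).trans hfin).trans_lt (half_lt_self hc)
  refine ⟨fun a => (Z a 0).2, fun a ha => ⟨Z a, (hZ a ha).1, Prod.ext (hZ a ha).2 rfl⟩, ?_, ?_⟩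
  · intro z hz
    have ha := (norm_fst_le _).trans (hz.1 0)
    have := h.norm_snd_sub_le hz (hZ _ ha).1
    rw [(hZ _ ha).2] at this
    exact sub_eq_zero.1 (norm_le_zero_iff.1 (this.trans (by simp)))
  · intro a ha
    constructor
    · rw [contDiffAt_one_iff]
      refine ⟨fun a => (V a 0).2, Metric.ball 0 r, Metric.isOpen_ball.mem_nhds (by simpa using ha),
        fun x hx => (hcont x (by simpa using hx)).continuousWithinAt,
        fun x hx => hder x (by simpa using hx)⟩
    · rw [(hder a ha).fderiv]
      refine (hder a ha).le_of_lip' h.pos ?_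
      filter_upwards [hnb a ha 1 one_pos] with a' ha'
      have := h.norm_snd_sub_le (hZ a' ha'.1).1 (hZ a ha.le).1
      rwa [(hZ a' ha'.1).2, (hZ a ha.le).2] at this

end StableGraph

theorem norm_swap' {E : Type*} [NormedAddCommGroup E] (z : E × E) : ‖z.swap‖ = ‖z‖ :=
  max_comm _ _

/-! ### Saddle maps and shadowing -/

section SaddleMaps

variable {E : Type*} [NormedAddCommGroup E] [NormedSpace ℝ E]

/-- A quantitative form of hyperbolicity for a map `H` of `E × E`: the first component of `H` is a
contraction, and so is the second component of the inverse branch, where `ν` approximates the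
inverse of the expansion. -/
structure IsSaddleMap (R : ℝ) (H : E × E → E × E) (ν : E →L[ℝ] E) : Prop where
  inj : Function.Injective ν
  norm_le : ‖ν‖ ≤ 1 / 10
  fst_lip : ∀ z w, ‖z‖ < R → ‖w‖ < R → ‖(H z).1 - (H w).1‖ ≤ 1 / 10 * ‖z - w‖
  snd_lip : ∀ z w, ‖z‖ < R → ‖w‖ < R →
    ‖z.2 - w.2 - ν ((H z).2 - (H w).2)‖ ≤ 1 / 10 * ‖z - w‖

/-- Forward orbits of `H` as solutions of a saddle problem. -/
def forwardProblem (H : E × E → E × E) (ν : E →L[ℝ] E) (ζ : (E × E) × (E × E)) : E × E :=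
  ((H ζ.1).1, ζ.1.2 - ν ((H ζ.1).2 - ζ.2.2))

/-- Backward orbits of `H`, with interchanged components, as solutions of a saddle problem. -/
def backwardProblem (H : E × E → E × E) (ν : E →L[ℝ] E) (ζ : (E × E) × (E × E)) : E × E :=
  (ζ.2.1 - ν ((H ζ.2.swap).2 - ζ.1.1), (H ζ.2.swap).1)

variable {R : ℝ} {H : E × E → E × E} {ν : E →L[ℝ] E}

theorem IsSaddleMap.norm_apply_le (h : IsSaddleMap R H ν) (v : E) : ‖ν v‖ ≤ 1 / 10 * ‖v‖ :=
  ν.le_of_opNorm_le h.norm_le v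

/-- The injectivity of `ν` makes the second equation of the saddle problem equivalent to the
equality of the second components. -/
theorem IsSaddleMap.forwardProblem_iff (h : IsSaddleMap R H ν) (z z' : E × E) :
    forwardProblem H ν (z, z') = (z'.1, z.2) ↔ H z = z' := by
  simp only [forwardProblem, Prod.mk.injEq, sub_eq_self]
  rw [map_eq_zero_iff ν h.inj, sub_eq_zero]
  exact Prod.ext_iff.symm

theorem IsSaddleMap.backwardProblem_iff (h : IsSaddleMap R H ν) (x x' : E × E) :
    backwardProblem H ν (x, x') = (x'.1, x.2) ↔ H x'.swap = x.swap := by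
  simp only [backwardProblem, Prod.mk.injEq, sub_eq_self]
  rw [map_eq_zero_iff ν h.inj, sub_eq_zero, and_comm]
  exact (Prod.ext_iff (y := x.swap)).symm

theorem IsSaddleMap.forwardProblem_lip (h : IsSaddleMap R H ν) {z z' w w' : E × E}
    (hz : ‖z‖ < R) (hw : ‖w‖ < R) :
    ‖forwardProblem H ν (z, z') - forwardProblem H ν (w, w')‖ ≤
      1 / 5 * max ‖z - w‖ ‖z' - w'‖ := by
  have h1 := h.fst_lip z w hz hw
  have h2 := h.snd_lip z w hz hw
  have h3 := (h.norm_apply_le (z'.2 - w'.2)).trans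
    (mul_le_mul_of_nonneg_left (norm_snd_le (z' - w')) (by norm_num))
  have h4 := le_max_left ‖z - w‖ ‖z' - w'‖
  have h5 := le_max_right ‖z - w‖ ‖z' - w'‖
  have h6 := norm_nonneg (z - w)
  refine max_le (h1.trans (by linarith)) ?_
  have e : (forwardProblem H ν (z, z') - forwardProblem H ν (w, w')).2 =
      (z.2 - w.2 - ν ((H z).2 - (H w).2)) + ν (z'.2 - w'.2) := by
    simp only [forwardProblem, Prod.snd_sub, map_sub]; abel
  rw [e]
  exact (norm_add_le _ _).trans (by linarith)

theorem IsSaddleMap.backwardProblem_lip (h : IsSaddleMap R H ν) {z z' w w' : E × E}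
    (hz : ‖z'‖ < R) (hw : ‖w'‖ < R) :
    ‖backwardProblem H ν (z, z') - backwardProblem H ν (w, w')‖ ≤
      1 / 5 * max ‖z - w‖ ‖z' - w'‖ := by
  have hsw : ‖z'.swap - w'.swap‖ = ‖z' - w'‖ := norm_swap' (z' - w')
  have h1 := h.fst_lip z'.swap w'.swap (by rwa [norm_swap']) (by rwa [norm_swap'])
  have h2 := h.snd_lip z'.swap w'.swap (by rwa [norm_swap']) (by rwa [norm_swap'])
  rw [hsw] at h1 h2
  simp only [Prod.snd_swap] at h2
  have h3 := (h.norm_apply_le (z.1 - w.1)).trans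
    (mul_le_mul_of_nonneg_left (norm_fst_le (z - w)) (by norm_num))
  have h4 := le_max_left ‖z - w‖ ‖z' - w'‖
  have h5 := le_max_right ‖z - w‖ ‖z' - w'‖
  have h6 := norm_nonneg (z - w)
  refine max_le ?_ (h1.trans (by linarith [norm_nonneg (z' - w')]))
  have e : (backwardProblem H ν (z, z') - backwardProblem H ν (w, w')).1 =
      (z'.1 - w'.1 - ν ((H z'.swap).2 - (H w'.swap).2)) + ν (z.1 - w.1) := by
    simp only [backwardProblem, Prod.fst_sub, map_sub]; abel
  rw [e]
  exact (norm_add_le _ _).trans (by linarith)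

/-- Shadowing: near a pseudo-orbit of hyperbolic maps there is an orbit with prescribed initial
condition. The distance at time `k` is bounded by `r k`, where `r` is any sequence varying at
most by the factor two in each step and dominating the jumps of the pseudo-orbit. -/
theorem exists_forward_orbit [CompleteSpace E] {H : ℕ → E × E → E × E} {ν : ℕ → E →L[ℝ] E}
    (hH : ∀ k, IsSaddleMap R (H k) (ν k)) {p : ℕ → E × E} {r : ℕ → ℝ} (hr : ∀ k, 0 ≤ r k)
    (hr1 : ∀ k, r (k + 1) ≤ 2 * r k) (hr2 : ∀ k, r k ≤ 2 * r (k + 1))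
    (hp : ∀ k, ‖p k‖ + r k < R)
    (hj1 : ∀ k, ‖H k (p k) - p (k + 1)‖ ≤ 3 / 5 * r k)
    (hj2 : ∀ k, ‖H k (p k) - p (k + 1)‖ ≤ 3 / 5 * r (k + 1)) {g : E × E → E}
    (hg : ∀ z w, ‖z - p 0‖ ≤ r 0 → ‖w - p 0‖ ≤ r 0 → ‖g z - g w‖ ≤ 3 / 4 * ‖z - w‖)
    (hg0 : g (p 0) = (p 0).1) :
    ∃ z : ℕ → E × E, (∀ k, ‖z k - p k‖ ≤ r k) ∧ (z 0).1 = g (z 0) ∧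
      ∀ k, H k (z k) = z (k + 1) := by
  have hball : ∀ k z, ‖z - p k‖ ≤ r k → ‖z‖ < R := fun k z hz => by
    have := norm_add_le (z - p k) (p k)
    rw [sub_add_cancel] at this
    linarith [hp k]
  have hpb : ∀ k, ‖p k‖ < R := fun k => by linarith [hp k, hr k]
  obtain ⟨z, hz, hz0, hzΓ⟩ := exists_bvp_solution (θ := 3 / 4) (by norm_num) (by norm_num) p r hr
    hr1 hr2 g (fun k => forwardProblem (H k) (ν k)) hg
    (fun z hz => by
      have := hg z (p 0) hz (by simpa using hr 0)
      rw [hg0] at this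
      linarith [norm_nonneg (z - p 0)])
    (fun k z z' w w' hz hz' hw hw' => by
      refine ((hH k).forwardProblem_lip (hball k z hz) (hball k w hw)).trans ?_
      exact mul_le_mul_of_nonneg_right (by norm_num) (le_max_of_le_left (norm_nonneg _)))
    (fun k z z' hz hz' => by
      have h1 := (hH k).fst_lip z (p k) (hball k z hz) (hpb k)
      have h2 := (hH k).snd_lip z (p k) (hball k z hz) (hpb k)
      have hj1 := hj1 k
      have hj2 := hj2 k
      have e1 : ((H k z).1 - (p (k + 1)).1) =
          ((H k z).1 - (H k (p k)).1) + (H k (p k) - p (k + 1)).1 := by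
        simp
      have e2 : (z.2 - ν k ((H k z).2 - z'.2) - (p k).2) =
          (z.2 - (p k).2 - ν k ((H k z).2 - (H k (p k)).2)) -
            ν k ((H k (p k) - p (k + 1)).2 - (z' - p (k + 1)).2) := by
        simp only [Prod.snd_sub, map_sub]; abel
      constructor
      · change ‖(H k z).1 - (p (k + 1)).1‖ ≤ _
        rw [e1]
        refine (norm_add_le _ _).trans ?_
        linarith [norm_fst_le (H k (p k) - p (k + 1)), hr2 k]
      · change ‖z.2 - ν k ((H k z).2 - z'.2) - (p k).2‖ ≤ _
        rw [e2]
        refine (norm_sub_le _ _).trans ?_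
        have h3 := (hH k).norm_apply_le ((H k (p k) - p (k + 1)).2 - (z' - p (k + 1)).2)
        have h4 := norm_sub_le (H k (p k) - p (k + 1)).2 (z' - p (k + 1)).2
        linarith [norm_snd_le (H k (p k) - p (k + 1)), norm_snd_le (z' - p (k + 1)), hr1 k, hr k])
  exact ⟨z, hz, hz0, fun k => ((hH k).forwardProblem_iff _ _).1 (hzΓ k)⟩

/-- Shadowing for backward orbits. -/
theorem exists_backward_orbit [CompleteSpace E] {H : ℕ → E × E → E × E} {ν : ℕ → E →L[ℝ] E}
    (hH : ∀ k, IsSaddleMap R (H k) (ν k)) {p : ℕ → E × E} {r : ℕ → ℝ} (hr : ∀ k, 0 ≤ r k)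
    (hr1 : ∀ k, r (k + 1) ≤ 2 * r k) (hr2 : ∀ k, r k ≤ 2 * r (k + 1))
    (hp : ∀ k, ‖p k‖ + r k < R)
    (hj1 : ∀ k, ‖H k (p (k + 1)) - p k‖ ≤ 3 / 5 * r k)
    (hj2 : ∀ k, ‖H k (p (k + 1)) - p k‖ ≤ 3 / 5 * r (k + 1)) {g : E × E → E}
    (hg : ∀ z w, ‖z - p 0‖ ≤ r 0 → ‖w - p 0‖ ≤ r 0 → ‖g z - g w‖ ≤ 3 / 4 * ‖z - w‖)
    (hg0 : g (p 0) = (p 0).2) :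
    ∃ z : ℕ → E × E, (∀ k, ‖z k - p k‖ ≤ r k) ∧ (z 0).2 = g (z 0) ∧
      ∀ k, H k (z (k + 1)) = z k := by
  have hsw : ∀ k (z : E × E), ‖z.swap - p k‖ = ‖z - (p k).swap‖ := fun k z =>
    norm_swap' (z - (p k).swap)
  have hball : ∀ k z, ‖z - p k‖ ≤ r k → ‖z‖ < R := fun k z hz => by
    have := norm_add_le (z - p k) (p k)
    rw [sub_add_cancel] at this
    linarith [hp k]
  have hball' : ∀ k z, ‖z - (p k).swap‖ ≤ r k → ‖z‖ < R := fun k z hz => by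
    rw [← norm_swap']
    exact hball k _ (by rwa [hsw])
  have hpb : ∀ k, ‖p k‖ < R := fun k => by linarith [hp k, hr k]
  obtain ⟨z, hz, hz0, hzΓ⟩ := exists_bvp_solution (θ := 3 / 4) (by norm_num) (by norm_num)
    (fun k => (p k).swap) r hr
    hr1 hr2 (fun z => g z.swap) (fun k => backwardProblem (H k) (ν k))
    (fun z w hz hw => by
      have := hg z.swap w.swap (by rwa [hsw]) (by rwa [hsw])
      rwa [show ‖z.swap - w.swap‖ = ‖z - w‖ from norm_swap' (z - w)] at this)
    (fun z hz => by
      have := hg z.swap (p 0) (by rwa [hsw]) (by simpa using hr 0)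
      rw [hg0, hsw] at this
      exact this.trans (by linarith [norm_nonneg (z - (p 0).swap)]))
    (fun k z z' w w' hz hz' hw hw' => by
      refine ((hH k).backwardProblem_lip (hball' _ z' hz') (hball' _ w' hw')).trans ?_
      exact mul_le_mul_of_nonneg_right (by norm_num) (le_max_of_le_left (norm_nonneg _)))
    (fun k z z' hz hz' => by
      have h0 := hball (k + 1) z'.swap (by rwa [hsw])
      have h1 := (hH k).fst_lip z'.swap (p (k + 1)) h0 (hpb _)
      have h2 := (hH k).snd_lip z'.swap (p (k + 1)) h0 (hpb _)
      rw [hsw] at h1 h2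
      have hj1 := hj1 k
      have hj2 := hj2 k
      have e1 : ((H k z'.swap).1 - (p k).1) =
          ((H k z'.swap).1 - (H k (p (k + 1))).1) + (H k (p (k + 1)) - p k).1 := by
        simp
      have e2 : (z'.1 - ν k ((H k z'.swap).2 - z.1) - (p (k + 1)).2) =
          (z'.1 - (p (k + 1)).2 - ν k ((H k z'.swap).2 - (H k (p (k + 1))).2)) -
            ν k ((H k (p (k + 1)) - p k).2 - (z - (p k).swap).1) := by
        simp only [Prod.snd_sub, Prod.fst_sub, Prod.fst_swap, map_sub]; abel
      constructor
      · change ‖z'.1 - ν k ((H k z'.swap).2 - z.1) - (p (k + 1)).2‖ ≤ _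
        rw [e2]
        refine (norm_sub_le _ _).trans ?_
        have h3 := (hH k).norm_apply_le ((H k (p (k + 1)) - p k).2 - (z - (p k).swap).1)
        have h4 := norm_sub_le (H k (p (k + 1)) - p k).2 (z - (p k).swap).1
        simp only [Prod.snd_swap] at h2
        linarith [norm_snd_le (H k (p (k + 1)) - p k), norm_fst_le (z - (p k).swap), hr2 k,
          hr (k + 1)]
      · change ‖(H k z'.swap).1 - (p k).1‖ ≤ _
        rw [e1]
        refine (norm_add_le _ _).trans ?_
        linarith [norm_fst_le (H k (p (k + 1)) - p k), hr1 k])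
  refine ⟨fun k => (z k).swap, fun k => by rw [hsw]; exact hz k, hz0, fun k =>
    ((hH k).backwardProblem_iff _ _).1 (hzΓ k)⟩

/-- Together with `SaddleProblem.exists_graph`, this makes the local stable set of a saddle map a
graph over the first factor. -/
theorem IsSaddleMap.forward_saddleProblem (h : IsSaddleMap R H ν)
    (hs : ContDiffOn ℝ 1 H (Metric.ball 0 R)) {r : ℝ} (hr : 0 < r) (hrR : r < R)
    (h0 : ‖H 0‖ < 4 / 5 * r) : SaddleProblem (1 / 5) r R (forwardProblem H ν) where
  pos := by norm_num
  lt_half := by norm_num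
  rpos := hr
  rlt := hrR
  lip := fun ⟨z, z'⟩ hz ⟨w, w'⟩ hw => by
    rw [mem_ball_zero_iff] at hz hw
    exact h.forwardProblem_lip ((norm_fst_le (z, z')).trans_lt hz)
      ((norm_fst_le (w, w')).trans_lt hw)
  smooth := by
    have h1 : ContDiffOn ℝ 1 (fun ζ : (E × E) × (E × E) => H ζ.1) (Metric.ball 0 R) :=
      hs.comp contDiff_fst.contDiffOn fun ζ hζ => by
        rw [mem_ball_zero_iff] at hζ ⊢
        exact (norm_fst_le ζ).trans_lt hζ
    refine h1.fst.prodMk ?_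
    exact contDiff_fst.snd.contDiffOn.sub (ν.contDiff.comp_contDiffOn
      (h1.snd.sub contDiff_snd.snd.contDiffOn))
  small := by
    have h2 := h.norm_apply_le (H 0).2
    refine max_lt ?_ ?_
    · change ‖(H 0).1‖ < _
      linarith [norm_fst_le (H 0)]
    · change ‖0 - ν ((H 0).2 - 0)‖ < _
      rw [zero_sub, norm_neg, sub_zero]
      linarith [norm_snd_le (H 0), norm_nonneg (H 0)]

/-- Together with `SaddleProblem.exists_graph`, this makes the local unstable set of a saddle map a
graph over the second factor. -/
theorem IsSaddleMap.backward_saddleProblem (h : IsSaddleMap R H ν)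
    (hs : ContDiffOn ℝ 1 H (Metric.ball 0 R)) {r : ℝ} (hr : 0 < r) (hrR : r < R)
    (h0 : ‖H 0‖ < 4 / 5 * r) : SaddleProblem (1 / 5) r R (backwardProblem H ν) where
  pos := by norm_num
  lt_half := by norm_num
  rpos := hr
  rlt := hrR
  lip := fun ⟨z, z'⟩ hz ⟨w, w'⟩ hw => by
    rw [mem_ball_zero_iff] at hz hw
    exact h.backwardProblem_lip ((norm_snd_le (z, z')).trans_lt hz)
      ((norm_snd_le (w, w')).trans_lt hw)
  smooth := by
    have h1 : ContDiffOn ℝ 1 (fun ζ : (E × E) × (E × E) => H ζ.2.swap) (Metric.ball 0 R) :=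
      hs.comp (contDiff_snd.snd.prodMk contDiff_snd.fst).contDiffOn fun ζ hζ => by
        rw [mem_ball_zero_iff] at hζ ⊢
        have := (norm_snd_le ζ).trans_lt hζ
        rwa [← norm_swap'] at this
    refine ContDiffOn.prodMk ?_ h1.fst
    exact contDiff_snd.fst.contDiffOn.sub (ν.contDiff.comp_contDiffOn
      (h1.snd.sub contDiff_fst.fst.contDiffOn))
  small := by
    have h2 := h.norm_apply_le (H 0).2
    refine max_lt ?_ ?_
    · change ‖0 - ν ((H 0).2 - 0)‖ < _
      rw [zero_sub, norm_neg, sub_zero]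
      linarith [norm_snd_le (H 0), norm_nonneg (H 0)]
    · change ‖(H 0).1‖ < _
      linarith [norm_fst_le (H 0)]

theorem SaddleProblem.orbit_norm_lt {θ r R : ℝ} {Γ : (E × E) × (E × E) → E × E}
    (h : SaddleProblem θ r R Γ) {z : ℕ → E × E} (hz : IsSaddleOrbit r Γ z) (h0 : ‖(z 0).1‖ < r)
    (k : ℕ) : ‖z k‖ < r := by
  have hk : ∀ k, ‖((z (k + 1)).1, (z k).2)‖ < r := fun k => by
    rw [← hz.2 k]; exact h.norm_lt (hz.1 k) (hz.1 _)
  refine max_lt ?_ ((norm_snd_le ((z (k + 1)).1, (z k).2)).trans_lt (hk k))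
  cases k with
  | zero => exact h0
  | succ k => exact (norm_fst_le ((z (k + 1)).1, (z k).2)).trans_lt (hk k)

/-- A saddle problem has a constant orbit. -/
theorem SaddleProblem.exists_constant_orbit [CompleteSpace E] {θ r R : ℝ}
    {Γ : (E × E) × (E × E) → E × E} (h : SaddleProblem θ r R Γ) :
    ∃ P : E × E, ‖P‖ < r ∧ Γ (P, P) = P := by
  obtain ⟨z, hz, hfix⟩ := exists_fixedPoint_seq h.pos (by linarith [h.lt_half])
    (fun _ => (0 : E × E)) (fun _ => r) (fun _ => h.rpos.le) (fun z k => Γ (z k, z k))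
    (fun z hz k => by
      simp only [sub_zero] at hz ⊢
      exact (h.norm_lt (hz k) (hz k)).le)
    (fun z w hz hw c hc hzw k => by
      simp only [sub_zero] at hz hw
      have := h.lip' (hz k) (hz k) (hw k) (hw k)
      rw [max_self] at this
      refine this.trans ?_
      rw [mul_assoc]
      exact mul_le_mul_of_nonneg_left (hzw k) h.pos)
  simp only [sub_zero] at hz
  have h0 := congrFun hfix 0
  refine ⟨z 0, ?_, h0⟩
  have := h.norm_lt (hz 0) (hz 0)
  rwa [h0] at this

end SaddleMaps

/-! ### Linear maps of saddle type -/

section Linear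

variable {E : Type*} [NormedAddCommGroup E] [NormedSpace ℝ E]

/-- The linear counterpart of `IsSaddleMap`. -/
structure IsLinearSaddle (L : E × E →L[ℝ] E × E) (ν : E →L[ℝ] E) : Prop where
  norm_le : ‖ν‖ ≤ 1 / 10
  fst_le : ∀ v, ‖(L v).1‖ ≤ 1 / 10 * ‖v‖
  snd_le : ∀ v, ‖v.2 - ν (L v).2‖ ≤ 1 / 10 * ‖v‖

theorem IsSaddleMap.isLinearSaddle {R : ℝ} {H : E × E → E × E} {ν : E →L[ℝ] E}
    (h : IsSaddleMap R H ν) {L : E × E →L[ℝ] E × E} {z : E × E} (hz : ‖z‖ < R)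
    (hL : HasFDerivAt H L z) : IsLinearSaddle L ν := by
  have hnb : ∀ᶠ w in 𝓝 z, ‖w‖ < R := (continuous_norm.tendsto z).eventually_lt_const hz
  refine ⟨h.norm_le, fun v => ?_, fun v => ?_⟩
  · have h1 : HasFDerivAt (fun w => (H w).1) ((ContinuousLinearMap.fst ℝ E E).comp L) z := hL.fst
    have h2 := h1.le_of_lip' (C := 1 / 10) (by norm_num) (by
      filter_upwards [hnb] with w hw using h.fst_lip _ _ hw hz)
    exact ((ContinuousLinearMap.fst ℝ E E).comp L).le_of_opNorm_le h2 v
  · have h1 : HasFDerivAt (fun w : E × E => w.2 - ν (H w).2)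
        (ContinuousLinearMap.snd ℝ E E - ν.comp ((ContinuousLinearMap.snd ℝ E E).comp L)) z :=
      hasFDerivAt_snd.sub (ν.hasFDerivAt.comp z hL.snd)
    have h2 := h1.le_of_lip' (C := 1 / 10) (by norm_num) (by
      filter_upwards [hnb] with w hw
      have := h.snd_lip _ _ hw hz
      rwa [map_sub, sub_sub_sub_comm] at this)
    exact (ContinuousLinearMap.snd ℝ E E - ν.comp ((ContinuousLinearMap.snd ℝ E E).comp L)
      ).le_of_opNorm_le h2 v

variable {L : E × E →L[ℝ] E × E} {ν : E →L[ℝ] E}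

/-- The cone `2 |a| ≤ |y|` is mapped well into its interior, and its vectors are expanded. -/
theorem IsLinearSaddle.expands (h : IsLinearSaddle L ν) {v : E × E} (hv : 2 * ‖v.1‖ ≤ ‖v.2‖) :
    9 * ‖v.2‖ ≤ ‖(L v).2‖ ∧ ‖(L v).1‖ ≤ 1 / 10 * ‖v.2‖ := by
  have hn : ‖v‖ = ‖v.2‖ := max_eq_right (by linarith [norm_nonneg v.1])
  have h1 := h.fst_le v
  have h2 := h.snd_le v
  have h3 := ν.le_of_opNorm_le h.norm_le (L v).2
  have h4 := norm_sub_norm_le v.2 (ν (L v).2)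
  rw [hn] at h1 h2
  exact ⟨by linarith, h1⟩

/-- The preimage of the cone `2 |y| ≤ |a|` lies well in its interior, and its vectors are expanded
by the inverse. -/
theorem IsLinearSaddle.contracts (h : IsLinearSaddle L ν) {v : E × E}
    (hv : 2 * ‖(L v).2‖ ≤ ‖(L v).1‖) :
    9 * ‖(L v).1‖ ≤ ‖v.1‖ ∧ ‖v.2‖ ≤ 1 / 5 * ‖v.1‖ := by
  have h1 := h.fst_le v
  have h2 := h.snd_le v
  have h3 := ν.le_of_opNorm_le h.norm_le (L v).2
  have h4 := norm_sub_norm_le v.2 (ν (L v).2)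
  have h5 : ‖v‖ = max ‖v.1‖ ‖v.2‖ := rfl
  have h0 := norm_nonneg v
  rcases max_cases ‖v.1‖ ‖v.2‖ with ⟨h6, h7⟩ | ⟨h6, h7⟩
  · rw [h6] at h5
    rw [h5] at h1 h2 h0
    exact ⟨by linarith, by linarith⟩
  · rw [h6] at h5
    rw [h5] at h1 h2 h0
    exfalso
    have := norm_nonneg v.1
    linarith

/-- A linear map of saddle type has no eigenvalue on the unit circle: otherwise it would have a
nonzero orbit that is bounded in both time directions. -/
theorem IsLinearSaddle.hyperbolic [FiniteDimensional ℝ E] (h : IsLinearSaddle L ν) (μ : ℂ)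
    (hμ : Polynomial.aeval μ (LinearMap.charpoly L.toLinearMap) = 0) : ‖μ‖ ≠ 1 := by
  intro hμ1
  set b := Module.finBasis ℝ (E × E) with hb
  set M := LinearMap.toMatrix b b L.toLinearMap with hM
  obtain ⟨u, hu0, hu⟩ : ∃ u : Fin (Module.finrank ℝ (E × E)) → ℂ, u ≠ 0 ∧
      (M.map (algebraMap ℝ ℂ)).mulVec u = μ • u := by
    have h1 : (M.map (algebraMap ℝ ℂ)).charpoly.eval μ = 0 := by
      rw [Matrix.charpoly_map, Polynomial.eval_map_algebraMap, hM, LinearMap.charpoly_toMatrix]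
      exact hμ
    rw [Matrix.eval_charpoly] at h1
    obtain ⟨u, hu0, hu⟩ := Matrix.exists_mulVec_eq_zero_iff.2 h1
    refine ⟨u, hu0, ?_⟩
    rw [Matrix.sub_mulVec, sub_eq_zero] at hu
    rw [← hu]
    ext i
    simp [Matrix.scalar_apply, Matrix.mulVec_diagonal]
  -- the real orbits `k ↦ Re (c μ ^ k u)`
  set x : ℂ → E × E := fun c => ∑ i, (c * u i).re • b i with hx
  have hLx : ∀ c, L (x c) = x (μ * c) := by
    intro c
    have h2 := LinearMap.toMatrix_mulVec_repr b b L.toLinearMap (x c)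
    have h3 : ⇑(b.repr (x c)) = fun i => (c * u i).re := by
      rw [hx]; exact b.repr_sum_self _
    apply b.repr.injective
    ext i
    have h4 : (b.repr (x (μ * c))) i = (μ * c * u i).re := by
      have : ⇑(b.repr (x (μ * c))) = fun i => (μ * c * u i).re := by
        rw [hx]; exact b.repr_sum_self _
      rw [this]
    rw [h4]
    have h5 := congrFun h2 i
    rw [h3] at h5
    refine h5.symm.trans ?_
    have h6 := congrFun hu i
    have h7 : μ * c * u i = ∑ j, (M i j : ℂ) * (c * u j) := by
      rw [mul_comm μ c, mul_assoc]
      have : μ * u i = ∑ j, (M i j : ℂ) * u j := by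
        rw [← smul_eq_mul]; exact h6.symm
      rw [this, Finset.mul_sum]
      exact Finset.sum_congr rfl fun j _ => by ring
    rw [h7, Complex.re_sum]
    change ∑ j, M i j * (c * u j).re = _
    refine Finset.sum_congr rfl fun j _ => ?_
    rw [Complex.re_ofReal_mul]
  have hμ0 : μ ≠ 0 := by rintro rfl; simp at hμ1
  have hbound : ∀ n : ℕ, ∀ c : ℂ, ‖c‖ = 1 → ‖x c‖ ≤ (1 / 5) ^ n * ∑ i, ‖u i‖ * ‖b i‖ := by
    intro n
    induction n with
    | zero =>
      intro c hc
      rw [pow_zero, one_mul]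
      refine (norm_sum_le _ _).trans (Finset.sum_le_sum fun i _ => ?_)
      rw [norm_smul]
      refine mul_le_mul_of_nonneg_right ?_ (norm_nonneg _)
      refine (Complex.abs_re_le_norm _).trans ?_
      rw [norm_mul, hc, one_mul]
    | succ n ih =>
      intro c hc
      set B := (1 / 5 : ℝ) ^ n * ∑ i, ‖u i‖ * ‖b i‖ with hB
      have e1 : L (x (μ⁻¹ * c)) = x c := by rw [hLx, mul_inv_cancel_left₀ hμ0]
      have i1 := ih c hc
      have i2 := ih (μ * c) (by rw [norm_mul, hμ1, hc, one_mul])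
      have i3 := ih (μ⁻¹ * c) (by rw [norm_mul, norm_inv, hμ1, hc, inv_one, one_mul])
      have h1 := h.fst_le (x (μ⁻¹ * c))
      rw [e1] at h1
      have h2 := h.snd_le (x c)
      rw [hLx] at h2
      have h3 := ν.le_of_opNorm_le h.norm_le (x (μ * c)).2
      have h4 := norm_sub_norm_le (x c).2 (ν (x (μ * c)).2)
      have h5 := norm_snd_le (x (μ * c))
      have h6 := (norm_nonneg (x c)).trans i1
      have : (1 / 5 : ℝ) ^ (n + 1) * ∑ i, ‖u i‖ * ‖b i‖ = 1 / 5 * B := by rw [hB, pow_succ]; ring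
      rw [this]
      exact max_le (by linarith) (by linarith)
  have hzero : ∀ c : ℂ, ‖c‖ = 1 → x c = 0 := by
    intro c hc
    have h0 : Tendsto (fun n : ℕ => (1 / 5 : ℝ) ^ n * ∑ i, ‖u i‖ * ‖b i‖) atTop (𝓝 0) := by
      simpa using (tendsto_pow_atTop_nhds_zero_of_lt_one (by norm_num : (0 : ℝ) ≤ 1 / 5)
        (by norm_num)).mul_const (∑ i, ‖u i‖ * ‖b i‖)
    exact norm_le_zero_iff.1 (ge_of_tendsto' h0 fun n => hbound n c hc)
  have hre : ∀ c : ℂ, ‖c‖ = 1 → ∀ i, (c * u i).re = 0 := fun c hc =>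
    Fintype.linearIndependent_iff.1 b.linearIndependent _ (hzero c hc)
  apply hu0
  ext i
  have h1 := hre 1 norm_one i
  have h2 := hre Complex.I Complex.norm_I i
  rw [one_mul] at h1
  apply Complex.ext
  · exact h1
  · simpa using h2

end Linear

/-! ### Calculus on the torus and words -/

section Torus

variable {d : ℕ}

theorem phaseProj_add (u v : Cover d) : phaseProj (u + v) = phaseProj u + phaseProj v := by
  ext i <;> simp [phaseProj, torusProj]

theorem phaseProj_zero : phaseProj (0 : Cover d) = 0 := by
  ext i <;> simp [phaseProj, torusProj]

theorem phaseProj_sub (u v : Cover d) : phaseProj (u - v) = phaseProj u - phaseProj v := by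
  rw [eq_sub_iff_add_eq, ← phaseProj_add, sub_add_cancel]

theorem continuous_torusProj : Continuous (torusProj : (Fin d → ℝ) → Torus d) :=
  continuous_pi fun i => (AddCircle.continuous_mk' (1 : ℝ)).comp (continuous_apply i)

theorem continuous_phaseProj : Continuous (phaseProj : Cover d → Phase d) :=
  (continuous_torusProj.comp continuous_fst).prodMk continuous_snd

theorem HasDiffAt.comp {F G : Phase d → Phase d} {L M : Cover d →L[ℝ] Cover d} {z : Phase d}
    (hG : HasDiffAt G M (F z)) (hF : HasDiffAt F L z) : HasDiffAt (G ∘ F) (M.comp L) z := by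
  obtain ⟨r₁, h₁, e₁⟩ := hF
  obtain ⟨r₂, h₂, e₂⟩ := hG
  have h0 : phaseProj (r₁ 0) = 0 := by
    have := e₁.self_of_nhds
    rwa [phaseProj_zero, add_zero, left_eq_add] at this
  have h₁' : HasFDerivAt (fun v => r₁ v - r₁ 0) L 0 := h₁.sub_const _
  refine ⟨fun v => r₂ (r₁ v - r₁ 0), ?_, ?_⟩
  · refine HasFDerivAt.comp (g := r₂) (f := fun v => r₁ v - r₁ 0) 0 ?_ h₁'
    rwa [sub_self]
  · have ht : Tendsto (fun v => r₁ v - r₁ 0) (𝓝 0) (𝓝 0) := by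
      have := h₁'.continuousAt.tendsto
      rwa [sub_self] at this
    filter_upwards [e₁, ht.eventually e₂] with v hv1 hv2
    rw [Function.comp_apply, hv1, Function.comp_apply, ← hv2, phaseProj_sub, h0, sub_zero]

theorem hasDiffAt_id (z : Phase d) : HasDiffAt id (ContinuousLinearMap.id ℝ (Cover d)) z :=
  ⟨id, hasFDerivAt_id 0, Eventually.of_forall fun _ => rfl⟩

theorem IsTangentAt.finrank {Δ : Set (Phase d)} {p : Phase d} {V : Submodule ℝ (Cover d)}
    (h : IsTangentAt Δ p V) : Module.finrank ℝ V = d := by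
  obtain ⟨-, f, -, hs, rfl, -⟩ := h
  have h1 := LinearMap.finrank_range_add_finrank_ker (fderiv ℝ f 0).toLinearMap
  rw [LinearMap.range_eq_top.2 hs, finrank_top] at h1
  simp only [Module.finrank_prod, Module.finrank_fin_fun] at h1
  omega

theorem wordMap_append {ι X : Type*} (G : ι → X → X) (u v : List ι) (z : X) :
    wordMap G (u ++ v) z = wordMap G v (wordMap G u z) := by
  induction u generalizing z with
  | nil => rfl
  | cons i u ih => exact ih (G i z)

theorem wordDom_append {ι X : Type*} (D : Set X) (G : ι → X → X) (u v : List ι) (z : X) :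
    z ∈ wordDom D G (u ++ v) ↔ z ∈ wordDom D G u ∧ wordMap G u z ∈ wordDom D G v := by
  induction u generalizing z with
  | nil => simp [wordDom, wordMap]
  | cons i u ih =>
    change (z ∈ D ∧ G i z ∈ wordDom D G (u ++ v)) ↔
      (z ∈ D ∧ G i z ∈ wordDom D G u) ∧ wordMap G u (G i z) ∈ wordDom D G v
    rw [ih, and_assoc]

end Torus

/-! ### Return maps in a chart -/

section Returns

variable {d : ℕ} {ι : Type*}

/-- The point with coordinates `z`, for a linear chart `Λ` of the covering space. -/
def chart (Λ : Cover d ≃L[ℝ] Cover d) (z : Cover d) : Phase d := phaseProj (Λ z)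

theorem continuous_chart (Λ : Cover d ≃L[ℝ] Cover d) : Continuous (chart Λ) :=
  continuous_phaseProj.comp Λ.continuous

theorem chart_add (Λ : Cover d ≃L[ℝ] Cover d) (z : Cover d) (v : Cover d) :
    chart Λ z + phaseProj v = chart Λ (z + Λ.symm v) := by
  rw [chart, chart, map_add, Λ.apply_symm_apply, phaseProj_add]

/-- The map `H` is a saddle map on the ball of radius `2ρ`, and represents the composition of the
word `w` in the chart `Λ`. -/
structure IsReturnMap (D : Set (Phase d)) (G : ι → Phase d → Phase d) (Λ : Cover d ≃L[ℝ] Cover d)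
    (ρ : ℝ) (w : List ι) (H : Cover d → Cover d) : Prop where
  dom : ∀ z, ‖z‖ < 2 * ρ → chart Λ z ∈ wordDom D G w
  map : ∀ z, ‖z‖ < 2 * ρ → wordMap G w (chart Λ z) = chart Λ (H z)
  smooth : ContDiffOn ℝ 1 H (Metric.ball 0 (2 * ρ))
  saddle : ∃ ν, IsSaddleMap (2 * ρ) H ν
  bij : ∀ z, ‖z‖ < 2 * ρ → Function.Bijective (fderiv ℝ H z)
  inj : ∀ z z', ‖z‖ < 2 * ρ → ‖z'‖ < 2 * ρ → chart Λ (H z) = chart Λ z' → H z = z'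

variable {D : Set (Phase d)} {G : ι → Phase d → Phase d} {Λ : Cover d ≃L[ℝ] Cover d}
  {ρ : ℝ} {w : List ι} {H : Cover d → Cover d}

theorem IsReturnMap.hasFDerivAt (h : IsReturnMap D G Λ ρ w H) {z : Cover d} (hz : ‖z‖ < 2 * ρ) :
    HasFDerivAt H (fderiv ℝ H z) z :=
  ((h.smooth.differentiableOn one_ne_zero).differentiableAt
    (Metric.isOpen_ball.mem_nhds (by simpa using hz))).hasFDerivAt

/-- The linear map `L` of the chart, as a linear map of the tangent space. -/
def conjChart (Λ : Cover d ≃L[ℝ] Cover d) (L : Cover d →L[ℝ] Cover d) : Cover d →L[ℝ] Cover d :=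
  (Λ : Cover d →L[ℝ] Cover d).comp (L.comp (Λ.symm : Cover d →L[ℝ] Cover d))

theorem IsReturnMap.hasDiffAt (h : IsReturnMap D G Λ ρ w H) {z : Cover d} (hz : ‖z‖ < 2 * ρ) :
    HasDiffAt (wordMap G w) (conjChart Λ (fderiv ℝ H z)) (chart Λ z) := by
  refine ⟨fun v => Λ (H (z + Λ.symm v) - H z), ?_, ?_⟩
  · refine Λ.hasFDerivAt.comp 0 ?_
    refine HasFDerivAt.sub_const _ ?_
    have h1 : HasFDerivAt (fun v => z + Λ.symm v) (Λ.symm : Cover d →L[ℝ] Cover d) 0 :=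
      Λ.symm.hasFDerivAt.const_add z
    refine HasFDerivAt.comp (g := H) 0 ?_ h1
    rw [map_zero, add_zero]
    exact h.hasFDerivAt hz
  · have hc : Tendsto (fun v => ‖z + Λ.symm v‖) (𝓝 0) (𝓝 ‖z‖) := by
      have : Continuous fun v => ‖z + Λ.symm v‖ := by fun_prop
      simpa using this.tendsto 0
    filter_upwards [hc.eventually_lt_const hz] with v hv
    rw [chart_add, h.map _ hv, h.map _ hz, chart, chart, ← phaseProj_add, ← map_add,
      add_sub_cancel]

/-- The chart is injective on the ball of radius `r`. -/
def IsChartInj (Λ : Cover d ≃L[ℝ] Cover d) (r : ℝ) : Prop :=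
  ∀ z z', ‖z‖ < r → ‖z'‖ < r → chart Λ z = chart Λ z' → z = z'

/-- The graphs of `C¹` functions with small derivative, in a chart, are submanifolds whose tangent
spaces are close to the first factor. -/
theorem isTangentAt_graph {r : ℝ} (hinj : IsChartInj Λ r)
    {η : (Fin d → ℝ) → (Fin d → ℝ)} (hη : ∀ a, ‖a‖ < r → ‖η a‖ < r)
    (hC : ∀ a, ‖a‖ < r → ContDiffAt ℝ 1 η a ∧ ‖fderiv ℝ η a‖ ≤ 1 / 5)
    {a : Fin d → ℝ} (ha : ‖a‖ < r) :
    ∃ V, IsTangentAt ((fun a => chart Λ (a, η a)) '' Metric.ball 0 r) (chart Λ (a, η a)) V ∧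
      ∀ v ∈ V, 2 * ‖(Λ.symm v).2‖ ≤ ‖(Λ.symm v).1‖ := by
  set z : Cover d := (a, η a) with hz
  have hzr : ‖z‖ < r := max_lt ha (hη a ha)
  set f : Cover d → (Fin d → ℝ) := fun v => (z + Λ.symm v).2 - η (z + Λ.symm v).1 with hf
  have h1 : ContDiff ℝ 1 (fun v : Cover d => z + Λ.symm v) :=
    contDiff_const.add Λ.symm.contDiff
  have hη' := (hC a ha).1
  have hfd : HasFDerivAt f ((ContinuousLinearMap.snd ℝ _ _ -
      (fderiv ℝ η a).comp (ContinuousLinearMap.fst ℝ _ _)).comp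
        (Λ.symm : Cover d →L[ℝ] Cover d)) 0 := by
    have h2 : HasFDerivAt (fun v => z + Λ.symm v) (Λ.symm : Cover d →L[ℝ] Cover d) 0 :=
      Λ.symm.hasFDerivAt.const_add z
    have h3 : HasFDerivAt η (fderiv ℝ η a) (z + Λ.symm 0).1 := by
      rw [map_zero, add_zero]
      exact (hη'.differentiableAt one_ne_zero).hasFDerivAt
    have h4 := h3.comp (0 : Cover d) h2.fst
    exact h2.snd.sub h4
  refine ⟨LinearMap.ker (fderiv ℝ f 0).toLinearMap, ⟨⟨a, by simpa using ha, rfl⟩, f, ?_, ?_, rfl,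
    ?_⟩, ?_⟩
  · refine h1.snd.contDiffAt.sub ?_
    have h3 : ContDiffAt ℝ 1 η (z + Λ.symm 0).1 := by
      rw [map_zero, add_zero]; exact hη'
    exact h3.comp (0 : Cover d) h1.fst.contDiffAt
  · rw [hfd.fderiv]
    intro y
    refine ⟨Λ (0, y), ?_⟩
    simp
  · have hc : Tendsto (fun v => ‖z + Λ.symm v‖) (𝓝 0) (𝓝 ‖z‖) := by
      have : Continuous fun v => ‖z + Λ.symm v‖ := by fun_prop
      simpa using this.tendsto 0
    filter_upwards [hc.eventually_lt_const hzr] with v hv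
    rw [chart_add]
    constructor
    · rintro ⟨b, hb, hb'⟩
      have hb : ‖b‖ < r := by simpa using hb
      have := hinj (b, η b) _ (max_lt hb (hη b hb)) hv hb'
      simp only [hf, ← this, sub_self]
    · intro h0
      refine ⟨(z + Λ.symm v).1, ?_, ?_⟩
      · simpa using (norm_fst_le _).trans_lt hv
      · have : η (z + Λ.symm v).1 = (z + Λ.symm v).2 := (sub_eq_zero.1 h0).symm
        simp only [this]
  · intro v hv
    rw [LinearMap.mem_ker, hfd.fderiv] at hv
    have h2 : (Λ.symm v).2 = fderiv ℝ η a (Λ.symm v).1 := sub_eq_zero.1 hv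
    have h3 := (fderiv ℝ η a).le_of_opNorm_le (hC a ha).2 (Λ.symm v).1
    rw [h2]
    linarith [norm_nonneg (Λ.symm v).1]

theorem isPreconnected_graph {r : ℝ} {η : (Fin d → ℝ) → (Fin d → ℝ)}
    (hC : ∀ a, ‖a‖ < r → ContDiffAt ℝ 1 η a ∧ ‖fderiv ℝ η a‖ ≤ 1 / 5) :
    IsPreconnected ((fun a => chart Λ (a, η a)) '' Metric.ball 0 r) := by
  refine (convex_ball (0 : Fin d → ℝ) r).isPreconnected.image _ ?_
  refine (continuous_chart Λ).comp_continuousOn (continuousOn_id.prodMk ?_)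
  intro a ha
  exact (hC a (by simpa using ha)).1.continuousAt.continuousWithinAt

/-- The ball of radius `ρ` in a chart. -/
def chartBall (Λ : Cover d ≃L[ℝ] Cover d) (ρ : ℝ) : Set (Phase d) :=
  chart Λ '' Metric.ball 0 ρ

theorem mem_chartBall {z : Cover d} (hz : ‖z‖ < ρ) : chart Λ z ∈ chartBall Λ ρ :=
  ⟨z, by simpa using hz, rfl⟩

/-- The local stable set of a return map is the graph of a `C¹` function. -/
theorem IsReturnMap.localStable_eq (h : IsReturnMap D G Λ ρ w H) (hρ : 0 < ρ)
    (h0 : ‖H 0‖ ≤ ρ / 20) {P : Cover d} (hP : ‖P‖ < ρ) (hHP : H P = P) :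
    ∃ η : (Fin d → ℝ) → (Fin d → ℝ), (∀ a, ‖a‖ < ρ → ‖η a‖ < ρ) ∧
      (∀ a, ‖a‖ < ρ → ContDiffAt ℝ 1 η a ∧ ‖fderiv ℝ η a‖ ≤ 1 / 5) ∧
      (∀ z : ℕ → Cover d, (∀ k, ‖z k‖ < ρ) → (∀ k, H (z k) = z (k + 1)) →
        (z 0).2 = η (z 0).1) ∧
      localStable D G w (chartBall Λ ρ) (chart Λ P) =
        (fun a => chart Λ (a, η a)) '' Metric.ball 0 ρ := by
  obtain ⟨ν, hν⟩ := h.saddle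
  have hS := hν.forward_saddleProblem h.smooth hρ (by linarith) (by linarith)
  obtain ⟨η, hη1, hη2, hη3⟩ := hS.exists_graph
  have horb : ∀ z : ℕ → Cover d, (∀ k, ‖z k‖ < ρ) → (∀ k, H (z k) = z (k + 1)) →
      IsSaddleOrbit ρ (forwardProblem H ν) z := fun z hz hH =>
    ⟨fun k => (hz k).le, fun k => (hν.forwardProblem_iff _ _).2 (hH k)⟩
  have hex : ∀ a, ‖a‖ < ρ → ∃ z : ℕ → Cover d, (∀ k, ‖z k‖ < ρ) ∧ (∀ k, H (z k) = z (k + 1)) ∧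
      z 0 = (a, η a) := by
    intro a ha
    obtain ⟨z, hz, hz0⟩ := hη1 a ha.le
    exact ⟨z, hS.orbit_norm_lt hz (by rw [hz0]; exact ha),
      fun k => (hν.forwardProblem_iff _ _).1 (hz.2 k), hz0⟩
  have hbd : ∀ z : Cover d, ‖z‖ < ρ → ‖z‖ < 2 * ρ := fun z hz => by linarith
  have hset : {z | (∀ k : ℕ, (wordMap G w)^[k] z ∈ chartBall Λ ρ ∩ wordDom D G w) ∧
      Tendsto (fun k : ℕ => (wordMap G w)^[k] z) atTop (𝓝 (chart Λ P))} =
      (fun a => chart Λ (a, η a)) '' Metric.ball 0 ρ := by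
    ext x
    constructor
    · rintro ⟨hx, -⟩
      choose z hz hzx using fun k => (hx k).1
      replace hz : ∀ k, ‖z k‖ < ρ := fun k => by simpa using hz k
      have hHz : ∀ k, H (z k) = z (k + 1) := by
        intro k
        refine h.inj _ _ (hbd _ (hz k)) (hbd _ (hz _)) ?_
        rw [← h.map _ (hbd _ (hz k)), hzx, hzx, Function.iterate_succ_apply']
      refine ⟨(z 0).1, by simpa using (norm_fst_le _).trans_lt (hz 0), ?_⟩
      have := hη2 z (horb z hz hHz)
      simp only [← this]
      exact hzx 0
    · rintro ⟨a, ha, rfl⟩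
      obtain ⟨z, hz, hHz, hz0⟩ := hex a (by simpa using ha)
      have hit : ∀ k, (wordMap G w)^[k] (chart Λ (a, η a)) = chart Λ (z k) := by
        intro k
        induction k with
        | zero => rw [hz0]; rfl
        | succ k ih => rw [Function.iterate_succ_apply', ih, h.map _ (hbd _ (hz k)), hHz]
      simp only [mem_ofPred_eq, hit]
      refine ⟨fun k => ⟨mem_chartBall (hz k), h.dom _ (hbd _ (hz k))⟩, ?_⟩
      have hPo := horb (fun _ => P) (fun _ => hP) (fun _ => hHP)
      have := hS.tendsto_orbit_sub (horb z hz hHz) hPo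
      have h2 : Tendsto z atTop (𝓝 P) := by simpa using this.add_const P
      exact ((continuous_chart Λ).tendsto P).comp h2
  refine ⟨η, fun a ha => ?_, hη3, fun z hz hH => hη2 z (horb z hz hH), ?_⟩
  · obtain ⟨z, hz, -, hz0⟩ := hex a ha
    have := hz 0
    rw [hz0] at this
    exact (norm_snd_le (a, η a)).trans_lt this
  · rw [localStable, hset]
    refine IsPreconnected.connectedComponentIn (isPreconnected_graph hη3) ?_
    refine ⟨P.1, by simpa using (norm_fst_le P).trans_lt hP, ?_⟩
    have := hη2 _ (horb (fun _ => P) (fun _ => hP) (fun _ => hHP))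
    simp only [← this]

/-- The local unstable set of a return map is the graph of a `C¹` function of the second
coordinate. -/
theorem IsReturnMap.localUnstable_eq (h : IsReturnMap D G Λ ρ w H) (hρ : 0 < ρ)
    (h0 : ‖H 0‖ ≤ ρ / 20) {P : Cover d} (hP : ‖P‖ < ρ) (hHP : H P = P) :
    ∃ η : (Fin d → ℝ) → (Fin d → ℝ), (∀ a, ‖a‖ < ρ → ‖η a‖ < ρ) ∧
      (∀ a, ‖a‖ < ρ → ContDiffAt ℝ 1 η a ∧ ‖fderiv ℝ η a‖ ≤ 1 / 5) ∧
      (∀ z : ℕ → Cover d, (∀ k, ‖z k‖ < ρ) → (∀ k, H (z (k + 1)) = z k) →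
        (z 0).1 = η (z 0).2) ∧
      localUnstable D G w (chartBall Λ ρ) (chart Λ P) =
        (fun a => chart ((ContinuousLinearEquiv.prodComm ℝ _ _).trans Λ) (a, η a)) ''
          Metric.ball 0 ρ := by
  obtain ⟨ν, hν⟩ := h.saddle
  have hS := hν.backward_saddleProblem h.smooth hρ (by linarith) (by linarith)
  obtain ⟨η, hη1, hη2, hη3⟩ := hS.exists_graph
  have horb : ∀ z : ℕ → Cover d, (∀ k, ‖z k‖ < ρ) → (∀ k, H (z (k + 1)) = z k) →
      IsSaddleOrbit ρ (backwardProblem H ν) (fun k => (z k).swap) := fun z hz hH =>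
    ⟨fun k => (norm_swap' _).trans_le (hz k).le,
      fun k => (hν.backwardProblem_iff _ _).2 (by simpa using hH k)⟩
  have hex : ∀ a, ‖a‖ < ρ → ∃ z : ℕ → Cover d, (∀ k, ‖z k‖ < ρ) ∧ (∀ k, H (z (k + 1)) = z k) ∧
      z 0 = (η a, a) := by
    intro a ha
    obtain ⟨z, hz, hz0⟩ := hη1 a ha.le
    refine ⟨fun k => (z k).swap,
      fun k => (norm_swap' _).trans_lt (hS.orbit_norm_lt hz (by rw [hz0]; exact ha) k),
      fun k => (hν.backwardProblem_iff _ _).1 (hz.2 k), congrArg Prod.swap hz0⟩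
  have hbd : ∀ z : Cover d, ‖z‖ < ρ → ‖z‖ < 2 * ρ := fun z hz => by linarith
  have hch : ∀ a b : Fin d → ℝ, chart ((ContinuousLinearEquiv.prodComm ℝ _ _).trans Λ) (a, b) =
      chart Λ (b, a) := fun a b => rfl
  have hset : {z | ∃ x : ℕ → Phase d, x 0 = z ∧ (∀ k, x k ∈ chartBall Λ ρ) ∧
      (∀ k, x (k + 1) ∈ wordDom D G w ∧ wordMap G w (x (k + 1)) = x k) ∧
      Tendsto x atTop (𝓝 (chart Λ P))} =
      (fun a => chart ((ContinuousLinearEquiv.prodComm ℝ _ _).trans Λ) (a, η a)) ''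
        Metric.ball 0 ρ := by
    ext x
    constructor
    · rintro ⟨x, rfl, hx, hxw, -⟩
      choose z hz hzx using hx
      replace hz : ∀ k, ‖z k‖ < ρ := fun k => by simpa using hz k
      have hHz : ∀ k, H (z (k + 1)) = z k := by
        intro k
        refine h.inj _ _ (hbd _ (hz _)) (hbd _ (hz _)) ?_
        rw [← h.map _ (hbd _ (hz _)), hzx, hzx, (hxw k).2]
      refine ⟨(z 0).2, by simpa using (norm_snd_le _).trans_lt (hz 0), ?_⟩
      have := hη2 _ (horb z hz hHz)
      simp only [Prod.fst_swap, Prod.snd_swap] at this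
      simp only [← this, hch]
      exact hzx 0
    · rintro ⟨a, ha, rfl⟩
      obtain ⟨z, hz, hHz, hz0⟩ := hex a (by simpa using ha)
      refine ⟨fun k => chart Λ (z k), congrArg (chart Λ) hz0, fun k => mem_chartBall (hz k),
        fun k => ⟨h.dom _ (hbd _ (hz _)), by rw [h.map _ (hbd _ (hz _)), hHz]⟩, ?_⟩
      have hPo := horb (fun _ => P) (fun _ => hP) (fun _ => hHP)
      have := hS.tendsto_orbit_sub (horb z hz hHz) hPo
      have h2 : Tendsto (fun k => (z k).swap) atTop (𝓝 P.swap) := by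
        simpa using this.add_const P.swap
      have h3 : Tendsto z atTop (𝓝 P) := (continuous_swap.tendsto P.swap).comp h2
      exact ((continuous_chart Λ).tendsto P).comp h3
  refine ⟨η, fun a ha => ?_, hη3, fun z hz hH => hη2 _ (horb z hz hH), ?_⟩
  · obtain ⟨z, hz, -, hz0⟩ := hex a ha
    have := hz 0
    rw [hz0] at this
    exact (norm_fst_le (η a, a)).trans_lt this
  · rw [localUnstable, hset]
    refine IsPreconnected.connectedComponentIn (isPreconnected_graph hη3) ?_
    refine ⟨P.2, by simpa using (norm_snd_le P).trans_lt hP, ?_⟩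
    have := hη2 _ (horb (fun _ => P) (fun _ => hP) (fun _ => hHP))
    simp only [Prod.fst_swap, Prod.snd_swap] at this
    simp only [← this, hch]

end Returns

/-! ### Blenders from return maps -/

section Blender

variable {d : ℕ} {ι : Type*}

/-- A family `W` of words whose compositions are saddle maps in the chart `Λ`, such that every point
of the ball of radius `ρ` can be sent close to the centre by the composition of some word, and can
be reached from a point close to the centre. The word `w` is one for which the centre is almost
fixed. -/
structure IsReturnSystem (D : Set (Phase d)) (G : ι → Phase d → Phase d)
    (Λ : Cover d ≃L[ℝ] Cover d) (ρ : ℝ) (W : Finset (List ι)) (w : List ι)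
    (F : Cover d → Cover d) : Prop where
  pos : 0 < ρ
  chartInj : IsChartInj Λ (2 * ρ)
  subset : ∀ z, ‖z‖ < 2 * ρ → chart Λ z ∈ D
  ret : ∀ u ∈ W, ∃ H, IsReturnMap D G Λ ρ u H
  fwd : ∀ z, ‖z‖ < ρ → ∃ u ∈ W, ∃ H, IsReturnMap D G Λ ρ u H ∧ ‖H z‖ ≤ ρ / 20
  bwd : ∀ z, ‖z‖ < ρ → ∃ u ∈ W, ∃ H, IsReturnMap D G Λ ρ u H ∧ ∃ x, ‖x‖ ≤ ρ / 20 ∧ H x = z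
  mem : w ∈ W
  isRet : IsReturnMap D G Λ ρ w F
  small : ‖F 0‖ ≤ ρ / 20

variable {D : Set (Phase d)} {G : ι → Phase d → Phase d} {Λ : Cover d ≃L[ℝ] Cover d}
  {ρ : ℝ} {W : Finset (List ι)} {w : List ι} {F : Cover d → Cover d}

/-- Every point is the start of an exact orbit of return maps which is close to the centre after the
first step, because each point can be sent close to the centre. -/
theorem IsReturnSystem.exists_forward_itinerary (S : IsReturnSystem D G Λ ρ W w F)
    {z : Cover d} (hz : ‖z‖ < ρ) :
    ∃ (p : ℕ → Cover d) (ω : ℕ → List ι) (H : ℕ → Cover d → Cover d), p 0 = z ∧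
      (∀ k, ω k ∈ W ∧ IsReturnMap D G Λ ρ (ω k) (H k) ∧ H k (p k) = p (k + 1)) ∧
      ∀ k, ‖p (k + 1)‖ ≤ ρ / 20 := by
  have hρ := S.pos
  choose u hu H hH hHz using S.fwd
  let step : {z : Cover d // ‖z‖ < ρ} → {z : Cover d // ‖z‖ < ρ} := fun z =>
    ⟨H z.1 z.2 z.1, by linarith [hHz z.1 z.2]⟩
  let p : ℕ → {z : Cover d // ‖z‖ < ρ} := fun k => step^[k] ⟨z, hz⟩
  have hp : ∀ k, p (k + 1) = step (p k) := fun k => Function.iterate_succ_apply' _ _ _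
  exact ⟨fun k => (p k).1, fun k => u _ (p k).2, fun k => H _ (p k).2, rfl,
    fun k => ⟨hu _ _, hH _ _, (congrArg Subtype.val (hp k)).symm⟩,
    fun k => (congrArg (fun q => ‖q.1‖) (hp k)).trans_le (hHz _ _)⟩

/-- Every point is the end of an exact orbit of return maps which is close to the centre before the
last step. -/
theorem IsReturnSystem.exists_backward_itinerary (S : IsReturnSystem D G Λ ρ W w F)
    {z : Cover d} (hz : ‖z‖ < ρ) :
    ∃ (p : ℕ → Cover d) (ω : ℕ → List ι) (H : ℕ → Cover d → Cover d), p 0 = z ∧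
      (∀ k, ω k ∈ W ∧ IsReturnMap D G Λ ρ (ω k) (H k) ∧ H k (p (k + 1)) = p k) ∧
      ∀ k, ‖p (k + 1)‖ ≤ ρ / 20 := by
  have hρ := S.pos
  choose u hu H hH x hx hHx using S.bwd
  let step : {z : Cover d // ‖z‖ < ρ} → {z : Cover d // ‖z‖ < ρ} := fun z =>
    ⟨x z.1 z.2, by linarith [hx z.1 z.2]⟩
  let p : ℕ → {z : Cover d // ‖z‖ < ρ} := fun k => step^[k] ⟨z, hz⟩
  have hp : ∀ k, p (k + 1) = step (p k) := fun k => Function.iterate_succ_apply' _ _ _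
  exact ⟨fun k => (p k).1, fun k => u _ (p k).2, fun k => H _ (p k).2, rfl,
    fun k => ⟨hu _ _, hH _ _, (congrArg (H _ (p k).2) (congrArg Subtype.val (hp k))).trans (hHx _ _)⟩,
    fun k => (congrArg (fun q => ‖q.1‖) (hp k)).trans_le (hx _ _)⟩

/-- The composition of the words along an orbit of return maps, and the action of its differential
on the unstable and on the stable cones. -/
theorem orbit_comp {z : ℕ → Cover d} {ω : ℕ → List ι} {H : ℕ → Cover d → Cover d} (m : ℕ)
    (hH : ∀ k < m, IsReturnMap D G Λ ρ (ω k) (H k)) (hz : ∀ k < m, ‖z k‖ < 2 * ρ)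
    (hHz : ∀ k < m, H k (z k) = z (k + 1)) :
    chart Λ (z 0) ∈ wordDom D G ((List.range m).map ω).flatten ∧
    wordMap G ((List.range m).map ω).flatten (chart Λ (z 0)) = chart Λ (z m) ∧
    ∃ L : Cover d →L[ℝ] Cover d,
      HasDiffAt (wordMap G ((List.range m).map ω).flatten) (conjChart Λ L) (chart Λ (z 0)) ∧
      Function.Bijective L ∧
      (∀ v, 2 * ‖v.1‖ ≤ ‖v.2‖ → 2 * ‖(L v).1‖ ≤ ‖(L v).2‖) ∧
      ∀ v, 2 * ‖(L v).2‖ ≤ ‖(L v).1‖ → 2 * ‖v.2‖ ≤ ‖v.1‖ := by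
  induction m with
  | zero =>
    refine ⟨mem_univ _, rfl, ContinuousLinearMap.id ℝ _, ?_, Function.bijective_id, fun _ h => h,
      fun _ h => h⟩
    have : conjChart Λ (ContinuousLinearMap.id ℝ (Cover d)) = ContinuousLinearMap.id ℝ _ := by
      ext v <;> simp [conjChart]
    rw [this]
    exact hasDiffAt_id _
  | succ m ih =>
    obtain ⟨h1, h2, L, h3, h4, h5, h6⟩ := ih (fun k hk => hH k (by omega))
      (fun k hk => hz k (by omega)) (fun k hk => hHz k (by omega))
    have hm := hH m (by omega)
    have hzm := hz m (by omega)
    obtain ⟨ν, hν⟩ := hm.saddle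
    have hlin := hν.isLinearSaddle hzm (hm.hasFDerivAt hzm)
    have hfl : ((List.range (m + 1)).map ω).flatten = ((List.range m).map ω).flatten ++ ω m := by
      rw [List.range_succ, List.map_append, List.flatten_append]; simp
    rw [hfl]
    refine ⟨(wordDom_append _ _ _ _ _).2 ⟨h1, by rw [h2]; exact hm.dom _ hzm⟩,
      by rw [wordMap_append, h2, hm.map _ hzm, hHz m (by omega)],
      (fderiv ℝ (H m) (z m)).comp L, ?_, (hm.bij _ hzm).comp h4, fun v hv => ?_, fun v hv => ?_⟩
    · have e1 : wordMap G (((List.range m).map ω).flatten ++ ω m) =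
          wordMap G (ω m) ∘ wordMap G ((List.range m).map ω).flatten :=
        funext fun _ => wordMap_append _ _ _ _
      have e2 : conjChart Λ ((fderiv ℝ (H m) (z m)).comp L) =
          (conjChart Λ (fderiv ℝ (H m) (z m))).comp (conjChart Λ L) := by
        ext v <;> simp [conjChart]
      rw [e1, e2]
      refine HasDiffAt.comp ?_ h3
      rw [h2]
      exact hm.hasDiffAt hzm
    · have := hlin.expands (h5 v hv)
      have := norm_nonneg (L v).2
      change 2 * ‖(fderiv ℝ (H m) (z m) (L v)).1‖ ≤ ‖(fderiv ℝ (H m) (z m) (L v)).2‖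
      linarith
    · apply h6
      have := hlin.contracts (v := L v) hv
      linarith [norm_nonneg (L v).1]

/-- A `C¹` submersion whose kernel is close to the second factor can be solved for the first
component by a contraction. -/
theorem exists_strip_contraction {f : Cover d → (Fin d → ℝ)} (hf : ContDiffAt ℝ 1 f 0)
    (hker : ∀ v, fderiv ℝ f 0 v = 0 → 2 * ‖v.1‖ ≤ ‖v.2‖) :
    ∃ T : (Fin d → ℝ) →L[ℝ] (Fin d → ℝ), Function.Injective T ∧ ∃ r > 0,
      ∀ v v', ‖v‖ ≤ r → ‖v'‖ ≤ r →
        ‖(v.1 - T (f v)) - (v'.1 - T (f v'))‖ ≤ 3 / 4 * ‖v - v'‖ := by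
  set A : (Fin d → ℝ) →ₗ[ℝ] (Fin d → ℝ) :=
    ((fderiv ℝ f 0).comp (ContinuousLinearMap.inl ℝ _ _)).toLinearMap with hA
  have hAapp : ∀ a, A a = fderiv ℝ f 0 (a, 0) := fun a => rfl
  have hAinj : Function.Injective A := by
    rw [injective_iff_map_eq_zero]
    intro a ha
    have := hker (a, 0) ha
    simp only [norm_zero] at this
    exact norm_le_zero_iff.1 (by linarith)
  set e := (LinearEquiv.ofInjectiveEndo A hAinj).toContinuousLinearEquiv with he
  have heapp : ∀ a, e a = fderiv ℝ f 0 (a, 0) := fun a => rfl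
  set T : (Fin d → ℝ) →L[ℝ] (Fin d → ℝ) := (e.symm : (Fin d → ℝ) →L[ℝ] (Fin d → ℝ)) with hT
  refine ⟨T, e.symm.injective, ?_⟩
  have hs := hf.hasStrictFDerivAt one_ne_zero
  have hφ : HasStrictFDerivAt (fun v : Cover d => v.1 - T (f v))
      (ContinuousLinearMap.fst ℝ (Fin d → ℝ) (Fin d → ℝ) - T.comp (fderiv ℝ f 0)) 0 :=
    hasStrictFDerivAt_fst.sub (T.hasStrictFDerivAt.comp 0 hs)
  have hn : ‖ContinuousLinearMap.fst ℝ (Fin d → ℝ) (Fin d → ℝ) - T.comp (fderiv ℝ f 0)‖ ≤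
      1 / 2 := by
    refine ContinuousLinearMap.opNorm_le_bound _ (by norm_num) fun v => ?_
    have h1 : fderiv ℝ f 0 v = e v.1 + fderiv ℝ f 0 (0, v.2) := by
      rw [heapp, ← map_add]; simp
    set y : Fin d → ℝ := -T (fderiv ℝ f 0 (0, v.2)) with hy
    have h2 : (ContinuousLinearMap.fst ℝ (Fin d → ℝ) (Fin d → ℝ) - T.comp (fderiv ℝ f 0)) v =
        y := by
      simp [h1, hT, hy]
    have h3 : fderiv ℝ f 0 (y, v.2) = 0 := by
      have : ((y, v.2) : Cover d) = (y, 0) + (0, v.2) := by simp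
      rw [this, map_add, ← heapp, hy, map_neg, hT]
      simp
    have h4 := hker _ h3
    rw [h2]
    have := norm_snd_le v
    simp only at h4
    linarith
  obtain ⟨s, hs, hL⟩ := hφ.exists_lipschitzOnWith_of_nnnorm_lt (3 / 4) (by
    rw [← NNReal.coe_lt_coe, coe_nnnorm]
    refine hn.trans_lt ?_
    norm_num)
  obtain ⟨r, hr, hrs⟩ := Metric.nhds_basis_closedBall.mem_iff.1 hs
  refine ⟨r, hr, fun v v' hv hv' => ?_⟩
  have := hL.dist_le_mul v (hrs (by simpa using hv)) v' (hrs (by simpa using hv'))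
  rw [dist_eq_norm, dist_eq_norm] at this
  simpa using this

/-- The radii `min c (r 2 ^ k)` vary by at most the factor two, start small and become constant.
They allow shadowing with a precision `r` at time `0`, if the jumps occur only later. -/
theorem exists_radii {c r : ℝ} (hc : 0 < c) (hr : 0 < r) :
    (∀ k, 0 ≤ min c (r * 2 ^ k)) ∧ (∀ k, min c (r * 2 ^ (k + 1)) ≤ 2 * min c (r * 2 ^ k)) ∧
    (∀ k, min c (r * 2 ^ k) ≤ 2 * min c (r * 2 ^ (k + 1))) ∧
    ∃ m, m ≠ 0 ∧ ∀ k, m ≤ k → min c (r * 2 ^ k) = c := by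
  refine ⟨fun k => by positivity, fun k => ?_, fun k => ?_, ?_⟩
  · rw [mul_min_of_nonneg _ _ zero_le_two]
    refine min_le_min (by linarith) ?_
    rw [pow_succ]; linarith
  · rw [mul_min_of_nonneg _ _ zero_le_two]
    refine min_le_min (by linarith) ?_
    rw [pow_succ]
    have : 0 < r * 2 ^ k := by positivity
    linarith
  · obtain ⟨m, hm⟩ := pow_unbounded_of_one_lt (c / r) (one_lt_two : (1 : ℝ) < 2)
    refine ⟨m + 1, by omega, fun k hk => min_eq_left ?_⟩
    rw [div_lt_iff₀ hr] at hm
    have : (2 : ℝ) ^ m ≤ 2 ^ k := pow_le_pow_right₀ one_le_two (by omega)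
    nlinarith

/-- Submodules of complementary dimension, one in the unstable and one in the stable cone, are
transverse. -/
theorem sup_eq_top_of_cones {V V' : Submodule ℝ (Cover d)} (hV : Module.finrank ℝ V = d)
    (hV' : Module.finrank ℝ V' = d) (h : ∀ v ∈ V, 2 * ‖(Λ.symm v).1‖ ≤ ‖(Λ.symm v).2‖)
    (h' : ∀ v ∈ V', 2 * ‖(Λ.symm v).2‖ ≤ ‖(Λ.symm v).1‖) : V ⊔ V' = ⊤ := by
  refine Submodule.eq_top_of_disjoint _ _ ?_ ?_
  · rw [hV, hV']; simp
  · rw [Submodule.disjoint_def]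
    intro v hv hv'
    have h1 := h v hv
    have h2 := h' v hv'
    have h3 := norm_nonneg (Λ.symm v).1
    have h4 := norm_nonneg (Λ.symm v).2
    have h5 : (Λ.symm v).1 = 0 := norm_le_zero_iff.1 (by linarith)
    have h6 : (Λ.symm v).2 = 0 := norm_le_zero_iff.1 (by linarith)
    have h7 : Λ.symm v = 0 := Prod.ext h5 h6
    simpa using h7

/-- Multiplication of the second component by two. -/
noncomputable def scaleSnd (d : ℕ) : Cover d ≃L[ℝ] Cover d :=
  (ContinuousLinearEquiv.refl ℝ (Fin d → ℝ)).prodCongr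
    (ContinuousLinearEquiv.smulLeft (R₁ := ℝ) (Units.mk0 (2 : ℝ) two_ne_zero))

/-- The frame of the stable cone `2 |y| ≤ |a|` in the chart `Λ`. -/
noncomputable def stableFrame (Λ : Cover d ≃L[ℝ] Cover d) : Cover d ≃L[ℝ] Cover d :=
  Λ.symm.trans (scaleSnd d)

/-- The frame of the unstable cone `2 |a| ≤ |y|` in the chart `Λ`. -/
noncomputable def unstableFrame (Λ : Cover d ≃L[ℝ] Cover d) : Cover d ≃L[ℝ] Cover d :=
  Λ.symm.trans ((ContinuousLinearEquiv.prodComm ℝ _ _).trans (scaleSnd d))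

theorem stableFrame_apply (v : Cover d) :
    stableFrame Λ v = ((Λ.symm v).1, (2 : ℝ) • (Λ.symm v).2) := rfl

theorem unstableFrame_apply (v : Cover d) :
    unstableFrame Λ v = ((Λ.symm v).2, (2 : ℝ) • (Λ.symm v).1) := rfl

theorem norm_two_smul (x : Fin d → ℝ) : ‖(2 : ℝ) • x‖ = 2 * ‖x‖ := by
  rw [norm_smul]; norm_num

theorem mem_cone_stableFrame (v : Cover d) :
    v ∈ cone (stableFrame Λ) ↔ 2 * ‖(Λ.symm v).2‖ ≤ ‖(Λ.symm v).1‖ := by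
  rw [cone, mem_ofPred_eq, stableFrame_apply, norm_two_smul]

theorem mem_cone_unstableFrame (v : Cover d) :
    v ∈ cone (unstableFrame Λ) ↔ 2 * ‖(Λ.symm v).1‖ ≤ ‖(Λ.symm v).2‖ := by
  rw [cone, mem_ofPred_eq, unstableFrame_apply, norm_two_smul]

theorem mem_interior_cone {Φ : Cover d ≃L[ℝ] Cover d} {v : Cover d}
    (h : ‖(Φ v).2‖ < ‖(Φ v).1‖) : v ∈ interior (cone Φ) := by
  rw [mem_interior]
  refine ⟨{v | ‖(Φ v).2‖ < ‖(Φ v).1‖}, fun v hv => ?_, ?_, h⟩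
  · have hv' : ‖(Φ v).2‖ < ‖(Φ v).1‖ := hv
    exact hv'.le
  exact isOpen_lt (by fun_prop) (by fun_prop)

theorem IsReturnSystem.areCommonCones (S : IsReturnSystem D G Λ ρ W w F) :
    AreCommonCones D G W (chartBall Λ ρ) (fun _ => stableFrame Λ) (fun _ => unstableFrame Λ) := by
  have hρ := S.pos
  refine ⟨continuousOn_const, continuousOn_const, fun z _ v hv => ?_, 2, one_lt_two, ?_⟩
  · have h1 := (mem_cone_stableFrame v).1 hv.1
    have h2 := (mem_cone_unstableFrame v).1 hv.2
    have h3 := norm_nonneg (Λ.symm v).1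
    have h4 := norm_nonneg (Λ.symm v).2
    have h5 : (Λ.symm v).1 = 0 := norm_le_zero_iff.1 (by linarith)
    have h6 : (Λ.symm v).2 = 0 := norm_le_zero_iff.1 (by linarith)
    have h7 : Λ.symm v = 0 := Prod.ext h5 h6
    simpa using h7
  · rintro u hu _ ⟨⟨z, hz, rfl⟩, -⟩ -
    obtain ⟨H, hH⟩ := S.ret u hu
    have hz : ‖z‖ < 2 * ρ := by
      have : ‖z‖ < ρ := by simpa using hz
      linarith
    obtain ⟨ν, hν⟩ := hH.saddle
    have hlin := hν.isLinearSaddle hz (hH.hasFDerivAt hz)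
    set L := fderiv ℝ H z with hL
    have hLv : ∀ v, Λ.symm (conjChart Λ L v) = L (Λ.symm v) := fun v => by simp [conjChart]
    refine ⟨conjChart Λ L, hH.hasDiffAt hz,
      Λ.bijective.comp ((hH.bij z hz).comp Λ.symm.bijective), fun v hv0 hv => ?_,
      fun v hv0 hv => ?_⟩
    · rw [mem_cone_unstableFrame] at hv
      have h1 := hlin.expands hv
      have h2 : 0 < ‖(Λ.symm v).2‖ := by
        by_contra! h
        have h5 : (Λ.symm v).2 = 0 := norm_le_zero_iff.1 h
        have h6 : (Λ.symm v).1 = 0 := norm_le_zero_iff.1 (by linarith)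
        have h7 : Λ.symm v = 0 := Prod.ext h6 h5
        exact hv0 (by simpa using h7)
      constructor
      · apply mem_interior_cone
        rw [unstableFrame_apply, hLv, norm_two_smul]
        linarith
      · rw [unstableFrame_apply, unstableFrame_apply, hLv, Prod.norm_def, Prod.norm_def,
          norm_two_smul, max_eq_left hv]
        exact le_max_of_le_left (by linarith)
    · rw [mem_cone_stableFrame, hLv] at hv
      have h1 := hlin.contracts hv
      have h2 : 0 < ‖(L (Λ.symm v)).1‖ := by
        by_contra! h
        have h5 : (L (Λ.symm v)).1 = 0 := norm_le_zero_iff.1 h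
        have h6 : (L (Λ.symm v)).2 = 0 := norm_le_zero_iff.1 (by linarith)
        have h7 : L (Λ.symm v) = 0 := Prod.ext h5 h6
        have h8 : Λ.symm v = 0 := (hH.bij z hz).1 (by rw [h7, map_zero])
        exact hv0 (by simpa using h8)
      constructor
      · apply mem_interior_cone
        rw [stableFrame_apply, norm_two_smul]
        linarith
      · rw [stableFrame_apply, stableFrame_apply, hLv, Prod.norm_def, Prod.norm_def,
          norm_two_smul, norm_two_smul, max_eq_left hv]
        exact le_max_of_le_left (by linarith)

/-- A saddle map that nearly fixes the centre has a fixed point: a constant orbit of its saddle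
problem. -/
theorem IsReturnMap.exists_fixed_point {H : Cover d → Cover d} (h : IsReturnMap D G Λ ρ w H)
    (hρ : 0 < ρ) (h0 : ‖H 0‖ ≤ ρ / 20) : ∃ P, ‖P‖ < ρ ∧ H P = P := by
  obtain ⟨ν, hν⟩ := h.saddle
  obtain ⟨P, hP, hPP⟩ := (hν.forward_saddleProblem h.smooth hρ (by linarith)
    (by linarith)).exists_constant_orbit
  exact ⟨P, hP, (hν.forwardProblem_iff P P).1 hPP⟩

theorem isOpenBall_chartBall (hρ : 0 < ρ) (hinj : IsChartInj Λ (2 * ρ)) :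
    IsOpenBall (chartBall Λ ρ) := by
  have hsc : ∀ x : Cover d, x ∈ Metric.ball 0 1 → ‖ρ • x‖ < ρ := by
    intro x hx
    rw [norm_smul, Real.norm_of_nonneg hρ.le]
    have : ‖x‖ < 1 := by simpa using hx
    nlinarith
  have hfd : ∀ x, HasFDerivAt (fun x : Cover d => Λ (ρ • x))
      ((Λ : Cover d →L[ℝ] Cover d).comp (ρ • ContinuousLinearMap.id ℝ (Cover d))) x := fun x =>
    Λ.hasFDerivAt.comp x ((hasFDerivAt_id x).const_smul ρ)
  refine ⟨fun x => Λ (ρ • x), ?_, fun x _ => ?_, ?_, ?_⟩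
  · exact (Λ.contDiff.comp (contDiff_const_smul ρ)).contDiffOn
  · rw [(hfd x).fderiv]
    refine Λ.bijective.comp ⟨fun a b hab => smul_right_injective _ hρ.ne' hab, fun b =>
      ⟨ρ⁻¹ • b, ?_⟩⟩
    simp [hρ.ne']
  · intro x hx y hy hxy
    have := hinj _ _ ((hsc x hx).trans (by linarith)) ((hsc y hy).trans (by linarith)) hxy
    exact smul_right_injective _ hρ.ne' this
  · ext q
    constructor
    · rintro ⟨z, hz, rfl⟩
      have hz : ‖z‖ < ρ := by simpa using hz
      refine ⟨ρ⁻¹ • z, ?_, ?_⟩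
      · rw [mem_ball_zero_iff, norm_smul, norm_inv, Real.norm_of_nonneg hρ.le, inv_mul_lt_iff₀ hρ]
        linarith
      · simp [hρ.ne', chart]
    · rintro ⟨x, hx, rfl⟩
      exact mem_chartBall (hsc x hx)

theorem IsReturnSystem.blenderFrame (S : IsReturnSystem D G Λ ρ W w F) {P : Cover d}
    (hP : ‖P‖ < ρ) (hFP : F P = P) :
    BlenderFrame D G W w (chartBall Λ ρ) (chart Λ P) (fun _ => stableFrame Λ)
      (fun _ => unstableFrame Λ) where
  ball := isOpenBall_chartBall S.pos S.chartInj
  subset := by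
    rintro _ ⟨z, hz, rfl⟩
    have hz : ‖z‖ < ρ := by simpa using hz
    exact S.subset z (by linarith [S.pos])
  word_mem := S.mem
  point_mem := mem_chartBall hP
  hyperbolic := by
    have hP2 : ‖P‖ < 2 * ρ := by linarith [S.pos]
    refine ⟨S.isRet.dom P hP2, by rw [S.isRet.map P hP2, hFP], conjChart Λ (fderiv ℝ F P),
      S.isRet.hasDiffAt hP2, Λ.bijective.comp ((S.isRet.bij P hP2).comp Λ.symm.bijective), ?_⟩
    obtain ⟨ν, hν⟩ := S.isRet.saddle
    have hlin := hν.isLinearSaddle hP2 (S.isRet.hasFDerivAt hP2)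
    have hch : LinearMap.charpoly (conjChart Λ (fderiv ℝ F P)).toLinearMap =
        LinearMap.charpoly (fderiv ℝ F P).toLinearMap :=
      LinearEquiv.charpoly_conj Λ.toLinearEquiv (fderiv ℝ F P).toLinearMap
    rw [hch]
    exact hlin.hyperbolic
  cones := S.areCommonCones

/-- Near a point, a strip tangent to the cone `2 |a| ≤ |y|` is described by an equation
`a = g (a, y)` with a contraction `g`. -/
theorem exists_strip_equation {Δ : Set (Phase d)} {p₀ : Cover d} {V : Submodule ℝ (Cover d)}
    (hV : IsTangentAt Δ (chart Λ p₀) V)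
    (hVc : ∀ v ∈ V, 2 * ‖(Λ.symm v).1‖ ≤ ‖(Λ.symm v).2‖) :
    ∃ (g : Cover d → (Fin d → ℝ)) (r : ℝ), 0 < r ∧ g p₀ = p₀.1 ∧
      (∀ z w, ‖z - p₀‖ ≤ r → ‖w - p₀‖ ≤ r → ‖g z - g w‖ ≤ 3 / 4 * ‖z - w‖) ∧
      ∀ z, ‖z - p₀‖ ≤ r → z.1 = g z → chart Λ z ∈ Δ := by
  obtain ⟨hq₀, f, hf, -, rfl, hfΔ⟩ := hV
  set f' : Cover d → (Fin d → ℝ) := fun v => f (Λ v) with hf'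
  have hf'c : ContDiffAt ℝ 1 f' 0 := by
    have : ContDiffAt ℝ 1 f (Λ 0) := by rwa [map_zero]
    exact this.comp 0 Λ.contDiff.contDiffAt
  have hf'd : ∀ v, fderiv ℝ f' 0 v = fderiv ℝ f 0 (Λ v) := by
    intro v
    have h1 : HasFDerivAt f (fderiv ℝ f 0) (Λ 0) := by
      rw [map_zero]; exact (hf.differentiableAt one_ne_zero).hasFDerivAt
    have h2 : HasFDerivAt f' ((fderiv ℝ f 0).comp (Λ : Cover d →L[ℝ] Cover d)) 0 :=
      h1.comp 0 Λ.hasFDerivAt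
    rw [h2.fderiv]
    rfl
  obtain ⟨T, hT, r₁, hr₁, hLip⟩ := exists_strip_contraction hf'c (fun v hv => by
    rw [hf'd] at hv
    simpa using hVc (Λ v) hv)
  have hf0 : f' 0 = 0 := by
    have h1 := hfΔ.self_of_nhds
    rw [phaseProj_zero, add_zero] at h1
    simp only [hf', map_zero]
    exact h1.1 hq₀
  have h1 : ∀ᶠ v in 𝓝 (0 : Cover d), (chart Λ p₀ + phaseProj (Λ v) ∈ Δ ↔ f (Λ v) = 0) := by
    have : Tendsto Λ (𝓝 0) (𝓝 0) := by simpa using Λ.continuous.tendsto 0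
    exact this.eventually hfΔ
  obtain ⟨r₂, hr₂, h2⟩ := Metric.nhds_basis_closedBall.eventually_iff.1 h1
  refine ⟨fun z => p₀.1 + ((z - p₀).1 - T (f' (z - p₀))), min r₁ r₂, lt_min hr₁ hr₂,
    by simp [hf0], fun z w hz hw => ?_, fun z hz hz0 => ?_⟩
  · have := hLip (z - p₀) (w - p₀) (hz.trans (min_le_left _ _)) (hw.trans (min_le_left _ _))
    rw [sub_sub_sub_cancel_right] at this
    rwa [add_sub_add_left_eq_sub]
  · have h3 : f' (z - p₀) = 0 := by
      apply hT
      rw [map_zero]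
      beta_reduce at hz0
      rw [Prod.fst_sub, ← add_sub_assoc, add_sub_cancel, eq_comm, sub_eq_self] at hz0
      exact hz0
    have h4 := (h2 (show z - p₀ ∈ Metric.closedBall 0 r₂ by
      simpa using hz.trans (min_le_right _ _))).2 h3
    rwa [chart_add, Λ.symm_apply_apply, add_sub_cancel] at h4

/-- The exact itinerary of a point of the strip, which stays close to the centre after the first
step, is followed for some time, and the fixed word is repeated afterwards. The orbit shadowing this
pseudo-orbit, with the strip as initial condition, hits the local stable set of the fixed point. -/
theorem IsReturnSystem.isSymbolicCuBlender (S : IsReturnSystem D G Λ ρ W w F) {P : Cover d}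
    (hP : ‖P‖ < ρ) (hFP : F P = P) :
    IsSymbolicCuBlender D G W w (chartBall Λ ρ) (chart Λ P) := by
  have hρ := S.pos
  refine ⟨_, _, S.blenderFrame hP hFP, fun Δ hΔ => ?_⟩
  obtain ⟨⟨q₀, hq₀⟩, hΔQ, hΔT⟩ := hΔ
  obtain ⟨p₀, hp₀, rfl⟩ := hΔQ hq₀
  replace hp₀ : ‖p₀‖ < ρ := by simpa using hp₀
  obtain ⟨V₀, hV₀, hVc⟩ := hΔT _ hq₀
  obtain ⟨g, r₁, hr₁, hg0, hgL, hgΔ⟩ := exists_strip_equation hV₀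
    (fun v hv => (mem_cone_unstableFrame v).1 (hVc hv))
  set r₀ := min r₁ (ρ - ‖p₀‖) / 2 with hr₀
  have hr₀pos : 0 < r₀ := by
    have : 0 < ρ - ‖p₀‖ := by linarith
    positivity
  have hr₀1 : r₀ ≤ r₁ := by
    have h1 := min_le_left r₁ (ρ - ‖p₀‖)
    linarith
  have hr₀3 : r₀ < ρ - ‖p₀‖ := by
    have h1 := min_le_right r₁ (ρ - ‖p₀‖)
    linarith
  obtain ⟨hrn, hrl, hrg, m, hm0, hm⟩ := exists_radii (c := ρ / 4) (by linarith) hr₀pos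
  -- the exact itinerary of `p₀` is followed up to time `m`, and the fixed word afterwards
  obtain ⟨p, ω, H, hp0, hpH, hps⟩ := S.exists_forward_itinerary hp₀
  set p' : ℕ → Cover d := fun k => if k ≤ m then p k else 0 with hp'
  set H' : ℕ → Cover d → Cover d := fun k => if k ≤ m then H k else F with hH'
  have hH'S : ∀ k, ∃ ν, IsSaddleMap (2 * ρ) (H' k) ν := by
    intro k
    by_cases hk : k ≤ m
    · simp only [hH', if_pos hk]; exact (hpH k).2.1.saddle
    · simp only [hH', if_neg hk]; exact S.isRet.saddle
  choose ν hν using hH'S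
  have hp'0 : p' 0 = p₀ := by simp [hp', hp0]
  have hp's : ∀ k, ‖p' (k + 1)‖ ≤ ρ / 20 := by
    intro k
    by_cases hk : k + 1 ≤ m
    · simp only [hp', if_pos hk]; exact hps k
    · simp only [hp', if_neg hk, norm_zero]; linarith
  have hjump : ∀ k, ‖H' k (p' k) - p' (k + 1)‖ ≤
      if k < m then 0 else ρ / 20 := by
    intro k
    rcases lt_trichotomy k m with hk | hk | hk
    · have h1 : k ≤ m := hk.le
      have h2 : k + 1 ≤ m := hk
      simp only [hH', hp', if_pos h1, if_pos h2, if_pos hk, (hpH k).2.2]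
      simp
    · subst hk
      simp only [hH', hp', le_refl, if_true, lt_irrefl, if_false, (hpH k).2.2]
      rw [if_neg (by omega), sub_zero]
      exact hps k
    · have h1 : ¬ k ≤ m := by omega
      have h2 : ¬ k + 1 ≤ m := by omega
      have h3 : ¬ k < m := by omega
      simp only [hH', hp', if_neg h1, if_neg h2, if_neg h3, sub_zero]
      exact S.small
  obtain ⟨z, hz, hz0, hzH⟩ := exists_forward_orbit hν hrn hrl hrg (p := p')
    (fun k => by
      have h1 : min (ρ / 4) (r₀ * 2 ^ k) ≤ ρ / 4 := min_le_left _ _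
      rcases k with _ | k
      · rw [hp'0]; linarith
      · linarith [hp's k])
    (fun k => by
      refine (hjump k).trans ?_
      split_ifs with hk
      · exact mul_nonneg (by norm_num) (hrn k)
      · rw [hm k (by omega)]; linarith)
    (fun k => by
      refine (hjump k).trans ?_
      split_ifs with hk
      · exact mul_nonneg (by norm_num) (hrn _)
      · rw [hm (k + 1) (by omega)]; linarith)
    (g := g)
    (fun z w hz hw => by
      rw [hp'0] at hz hw
      have hb : min (ρ / 4) (r₀ * 2 ^ 0) ≤ r₁ := (min_le_right _ _).trans (by simpa using hr₀1)
      exact hgL z w (hz.trans hb) (hw.trans hb))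
    (by rw [hp'0, hg0])
  have hz0' := hz 0
  rw [hp'0, pow_zero, mul_one] at hz0'
  have hz0r : ‖z 0 - p₀‖ ≤ r₀ := hz0'.trans (min_le_right _ _)
  have hz0ρ : ‖z 0‖ < ρ := by
    have := norm_add_le (z 0 - p₀) p₀
    rw [sub_add_cancel] at this
    linarith
  have hzk : ∀ k, ‖z (k + 1)‖ < ρ := by
    intro k
    have h1 := norm_add_le (z (k + 1) - p' (k + 1)) (p' (k + 1))
    rw [sub_add_cancel] at h1
    linarith [hz (k + 1), hp's k, min_le_left (ρ / 4) (r₀ * 2 ^ (k + 1))]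
  have hzρ : ∀ k, ‖z k‖ < ρ := by
    intro k
    rcases k with _ | k
    · exact hz0ρ
    · exact hzk k
  have hqΔ : chart Λ (z 0) ∈ Δ := hgΔ _ (hz0r.trans hr₀1) hz0
  obtain ⟨V, hV, hVc'⟩ := hΔT _ hqΔ
  obtain ⟨hdom, hmap, L, hL1, hL2, hL3, -⟩ := orbit_comp (D := D) (G := G) (Λ := Λ) (ρ := ρ)
    (z := z) (ω := ω) (H := H) (m + 1) (fun k _ => (hpH k).2.1)
    (fun k _ => by linarith [hzρ k]) (fun k hk => by
      have h1 := hzH k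
      have h2 : k ≤ m := by omega
      simp only [hH', if_pos h2] at h1
      exact h1)
  obtain ⟨η, hη1, hη2, hη3, hη4⟩ := S.isRet.localStable_eq hρ S.small hP hFP
  have hfin : (z (m + 1)).2 = η (z (m + 1)).1 :=
    hη3 (fun k => z (m + 1 + k)) (fun k => hzρ _) (fun k => by
      have h1 := hzH (m + 1 + k)
      have h2 : ¬ m + 1 + k ≤ m := by omega
      simp only [hH', if_neg h2] at h1
      exact h1)
  have hzm : z (m + 1) = ((z (m + 1)).1, η (z (m + 1)).1) := Prod.ext rfl hfin
  obtain ⟨V', hV', hVc''⟩ := isTangentAt_graph (Λ := Λ) (r := ρ)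
    (fun z z' h h' => S.chartInj z z' (by linarith) (by linarith)) hη1 hη2
    ((norm_fst_le _).trans_lt (hzρ (m + 1)))
  refine ⟨(List.range (m + 1)).map ω, ?_, chart Λ (z 0), hdom, conjChart Λ L, V, V', hL1,
    Λ.bijective.comp (hL2.comp Λ.symm.bijective), hV, ?_, ?_⟩
  · intro u hu
    obtain ⟨k, -, rfl⟩ := List.mem_map.1 hu
    exact (hpH k).1
  · rw [hmap, hη4, hzm]
    exact hV'
  · have hinj : Function.Injective (conjChart Λ L).toLinearMap :=
      Λ.injective.comp (hL2.1.comp Λ.symm.injective)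
    refine sup_eq_top_of_cones (Λ := Λ) ?_ hV'.finrank ?_ hVc''
    · exact (Submodule.equivMapOfInjective _ hinj V).finrank_eq.symm.trans hV.finrank
    · rintro _ ⟨v, hv, rfl⟩
      have h1 := (mem_cone_unstableFrame v).1 (hVc' hv)
      have h2 := hL3 _ h1
      simpa [conjChart] using h2

/-- The time reversal of the argument for `cu`-strips: an exact backward itinerary of a point of the
strip is followed for some time, and the fixed word is used before. -/
theorem IsReturnSystem.isSymbolicCsBlender (S : IsReturnSystem D G Λ ρ W w F) {P : Cover d}
    (hP : ‖P‖ < ρ) (hFP : F P = P) :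
    IsSymbolicCsBlender D G W w (chartBall Λ ρ) (chart Λ P) := by
  have hρ := S.pos
  refine ⟨_, _, S.blenderFrame hP hFP, fun Δ hΔ => ?_⟩
  obtain ⟨⟨q₀, hq₀⟩, hΔQ, hΔT⟩ := hΔ
  obtain ⟨p₀, hp₀, rfl⟩ := hΔQ hq₀
  replace hp₀ : ‖p₀‖ < ρ := by simpa using hp₀
  set Λ' := (ContinuousLinearEquiv.prodComm ℝ (Fin d → ℝ) (Fin d → ℝ)).trans Λ with hΛ'
  have hΛ's : ∀ v, Λ'.symm v = (Λ.symm v).swap := fun v => rfl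
  have hΛ'c : ∀ z : Cover d, chart Λ' z.swap = chart Λ z := fun z => rfl
  obtain ⟨V₀, hV₀, hVc⟩ := hΔT _ hq₀
  -- In the chart `Λ'` with interchanged coordinates, the strip is tangent to the cone of
  -- `exists_strip_equation`.
  obtain ⟨g, r₁, hr₁, hg0, hgL, hgΔ⟩ := exists_strip_equation (Λ := Λ') (p₀ := p₀.swap) hV₀
    (fun v hv => (mem_cone_stableFrame v).1 (hVc hv))
  have hsw : ∀ z : Cover d, ‖z.swap - p₀.swap‖ = ‖z - p₀‖ := fun z => norm_swap' (z - p₀)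
  set r₀ := min r₁ (ρ - ‖p₀‖) / 2 with hr₀
  have hr₀pos : 0 < r₀ := by
    have : 0 < ρ - ‖p₀‖ := by linarith
    positivity
  have hr₀1 : r₀ ≤ r₁ := by
    have h1 := min_le_left r₁ (ρ - ‖p₀‖)
    linarith
  have hr₀3 : r₀ < ρ - ‖p₀‖ := by
    have h1 := min_le_right r₁ (ρ - ‖p₀‖)
    linarith
  obtain ⟨hrn, hrl, hrg, m, hm0, hm⟩ := exists_radii (c := ρ / 4) (by linarith) hr₀pos
  -- the exact backward itinerary of `p₀` is followed up to time `m`, the fixed word afterwards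
  obtain ⟨p, ω, H, hp0, hpH, hps⟩ := S.exists_backward_itinerary hp₀
  set p' : ℕ → Cover d := fun k => if k ≤ m then p k else 0 with hp'
  set H' : ℕ → Cover d → Cover d := fun k => if k < m then H k else F with hH'
  have hH'S : ∀ k, ∃ ν, IsSaddleMap (2 * ρ) (H' k) ν := by
    intro k
    by_cases hk : k < m
    · simp only [hH', if_pos hk]; exact (hpH k).2.1.saddle
    · simp only [hH', if_neg hk]; exact S.isRet.saddle
  choose ν hν using hH'S
  have hp'0 : p' 0 = p₀ := by simp [hp', hp0]
  have hp's : ∀ k, ‖p' (k + 1)‖ ≤ ρ / 20 := by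
    intro k
    by_cases hk : k + 1 ≤ m
    · simp only [hp', if_pos hk]; exact hps k
    · simp only [hp', if_neg hk, norm_zero]; linarith
  have hjump : ∀ k, ‖H' k (p' (k + 1)) - p' k‖ ≤
      if k < m then 0 else ρ / 10 := by
    intro k
    rcases lt_trichotomy k m with hk | hk | hk
    · have h1 : k ≤ m := hk.le
      have h2 : k + 1 ≤ m := hk
      simp only [hH', hp', if_pos h1, if_pos h2, if_pos hk, (hpH k).2.2]
      simp
    · subst hk
      obtain ⟨j, rfl⟩ := Nat.exists_eq_succ_of_ne_zero hm0
      simp only [hH', hp', le_refl, if_true, lt_irrefl, if_false]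
      rw [if_neg (by omega)]
      refine (norm_sub_le _ _).trans ?_
      linarith [hps j, S.small]
    · have h1 : ¬ k ≤ m := by omega
      have h2 : ¬ k + 1 ≤ m := by omega
      have h3 : ¬ k < m := by omega
      simp only [hH', hp', if_neg h1, if_neg h2, if_neg h3, sub_zero]
      linarith [S.small]
  obtain ⟨z, hz, hz0, hzH⟩ := exists_backward_orbit hν hrn hrl hrg (p := p')
    (fun k => by
      have h1 : min (ρ / 4) (r₀ * 2 ^ k) ≤ ρ / 4 := min_le_left _ _
      rcases k with _ | k
      · rw [hp'0]; linarith
      · linarith [hp's k])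
    (fun k => by
      refine (hjump k).trans ?_
      split_ifs with hk
      · exact mul_nonneg (by norm_num) (hrn k)
      · rw [hm k (by omega)]; linarith)
    (fun k => by
      refine (hjump k).trans ?_
      split_ifs with hk
      · exact mul_nonneg (by norm_num) (hrn _)
      · rw [hm (k + 1) (by omega)]; linarith)
    (g := fun z => g z.swap)
    (fun z w hz hw => by
      rw [hp'0] at hz hw
      have hb : min (ρ / 4) (r₀ * 2 ^ 0) ≤ r₁ := (min_le_right _ _).trans (by simpa using hr₀1)
      have := hgL z.swap w.swap (by rw [hsw]; exact hz.trans hb) (by rw [hsw]; exact hw.trans hb)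
      rwa [show ‖z.swap - w.swap‖ = ‖z - w‖ from norm_swap' (z - w)] at this)
    (by rw [hp'0]; exact hg0)
  have hz0' := hz 0
  rw [hp'0, pow_zero, mul_one] at hz0'
  have hz0r : ‖z 0 - p₀‖ ≤ r₀ := hz0'.trans (min_le_right _ _)
  have hz0ρ : ‖z 0‖ < ρ := by
    have := norm_add_le (z 0 - p₀) p₀
    rw [sub_add_cancel] at this
    linarith
  have hzk : ∀ k, ‖z (k + 1)‖ < ρ := by
    intro k
    have h1 := norm_add_le (z (k + 1) - p' (k + 1)) (p' (k + 1))
    rw [sub_add_cancel] at h1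
    linarith [hz (k + 1), hp's k, min_le_left (ρ / 4) (r₀ * 2 ^ (k + 1))]
  have hzρ : ∀ k, ‖z k‖ < ρ := by
    intro k
    rcases k with _ | k
    · exact hz0ρ
    · exact hzk k
  have hqΔ : chart Λ (z 0) ∈ Δ :=
    hgΔ (z 0).swap (by rw [hsw]; exact hz0r.trans hr₀1) hz0
  obtain ⟨V, hV, hVc'⟩ := hΔT _ hqΔ
  -- the orbit from `z m` to `z 0`, in forward time
  obtain ⟨hdom, hmap, L, hL1, hL2, -, hL3⟩ := orbit_comp (D := D) (G := G) (Λ := Λ) (ρ := ρ)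
    (z := fun k => z (m - k)) (ω := fun k => ω (m - 1 - k)) (H := fun k => H (m - 1 - k)) m
    (fun k _ => (hpH _).2.1)
    (fun k _ => by linarith [hzρ (m - k)]) (fun k hk => by
      have h1 := hzH (m - 1 - k)
      have h2 : m - 1 - k < m := by omega
      simp only [hH', if_pos h2] at h1
      have e1 : m - k = m - 1 - k + 1 := by omega
      have e2 : m - (k + 1) = m - 1 - k := by omega
      change H (m - 1 - k) (z (m - k)) = z (m - (k + 1))
      rw [e1, e2]
      exact h1)
  simp only [Nat.sub_zero, Nat.sub_self] at hdom hmap hL1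
  obtain ⟨η, hη1, hη2, hη3, hη4⟩ := S.isRet.localUnstable_eq hρ S.small hP hFP
  have hfin : (z m).1 = η (z m).2 :=
    hη3 (fun k => z (m + k)) (fun k => hzρ _) (fun k => by
      have h1 := hzH (m + k)
      have h2 : ¬ m + k < m := by omega
      simp only [hH', if_neg h2] at h1
      exact h1)
  have hzm : (z m).swap = ((z m).2, η (z m).2) := Prod.ext rfl hfin
  have hinj' : IsChartInj Λ' ρ := by
    intro z z' h h' hzz
    have := S.chartInj z.swap z'.swap (by rw [norm_swap']; linarith) (by rw [norm_swap']; linarith)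
      hzz
    exact Prod.swap_injective this
  obtain ⟨V', hV', hVc''⟩ := isTangentAt_graph hinj' hη1 hη2
    ((norm_snd_le _).trans_lt (hzρ m))
  refine ⟨(List.range m).map fun k => ω (m - 1 - k), ?_, chart Λ (z m), hdom, conjChart Λ L, V, V',
    hL1, Λ.bijective.comp (hL2.comp Λ.symm.bijective), ?_, ?_, ?_⟩
  · intro u hu
    obtain ⟨k, -, rfl⟩ := List.mem_map.1 hu
    exact (hpH _).1
  · rw [hmap]; exact hV
  · rw [hη4, ← hΛ'c, hzm]
    exact hV'
  · have hbij : Function.Bijective (conjChart Λ L).toLinearMap :=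
      Λ.bijective.comp (hL2.comp Λ.symm.bijective)
    rw [sup_comm]
    refine sup_eq_top_of_cones (Λ := Λ) hV'.finrank ?_ hVc'' ?_
    · have h1 := (Submodule.equivMapOfInjective _ hbij.1
        (V.comap (conjChart Λ L).toLinearMap)).finrank_eq
      rw [Submodule.map_comap_eq_of_surjective hbij.2] at h1
      exact h1.trans hV.finrank
    · intro v hv
      have h1 := (mem_cone_stableFrame _).1 (hVc' hv)
      apply hL3
      simpa [conjChart] using h1

/-- A return system produces a double blender: its two blenders share the fixed point `P`, at which
the local stable and unstable sets are transverse. -/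
theorem IsReturnSystem.hasSymbolicDoubleBlender (S : IsReturnSystem D G Λ ρ W w F) :
    HasSymbolicDoubleBlender D G := by
  have hρ := S.pos
  obtain ⟨P, hP, hFP⟩ := S.isRet.exists_fixed_point hρ S.small
  refine ⟨W, W, w, w, _, _, _, _, S.isSymbolicCuBlender hP hFP, S.isSymbolicCsBlender hP hFP,
    chart Λ P, ?_⟩
  obtain ⟨η, hη1, hη2, hη3, hη4⟩ := S.isRet.localStable_eq hρ S.small hP hFP
  obtain ⟨η', hη'1, hη'2, hη'3, hη'4⟩ := S.isRet.localUnstable_eq hρ S.small hP hFP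
  set Λ' := (ContinuousLinearEquiv.prodComm ℝ (Fin d → ℝ) (Fin d → ℝ)).trans Λ with hΛ'
  have hinj' : IsChartInj Λ' ρ := by
    intro z z' h h' hzz
    have := S.chartInj z.swap z'.swap (by rw [norm_swap']; linarith) (by rw [norm_swap']; linarith)
      hzz
    exact Prod.swap_injective this
  obtain ⟨V, hV, hVc⟩ := isTangentAt_graph (Λ := Λ) (r := ρ)
    (fun z z' h h' => S.chartInj z z' (by linarith) (by linarith)) hη1 hη2
    ((norm_fst_le _).trans_lt hP)
  obtain ⟨V', hV', hVc'⟩ := isTangentAt_graph hinj' hη'1 hη'2 ((norm_snd_le _).trans_lt hP)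
  have hP1 : P = (P.1, η P.1) := Prod.ext rfl (hη3 (fun _ => P) (fun _ => hP) fun _ => hFP)
  have hP2 : P.swap = (P.2, η' P.2) := Prod.ext rfl (hη'3 (fun _ => P) (fun _ => hP) fun _ => hFP)
  refine ⟨V, V', ?_, ?_, ?_⟩
  · rw [hη4]; rw [← hP1] at hV; exact hV
  · rw [hη'4]; rw [← hP2] at hV'; exact hV'
  · rw [sup_comm]
    exact sup_eq_top_of_cones (Λ := Λ) hV'.finrank hV.finrank hVc' hVc

end Blender

/-! ### Connecting orbits of any large length -/

section CoreMixing

variable {d : ℕ} {ι : Type*} {D : Set (Phase d)} {G : ι → Phase d → Phase d}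
  {Λ : Cover d ≃L[ℝ] Cover d} {ρ : ℝ} {W : Finset (List ι)} {w : List ι} {F : Cover d → Cover d}

theorem length_flatten_map_range {α : Type*} (ω : ℕ → List α) (N : ℕ) :
    ((List.range N).map ω).flatten.length = ∑ k ∈ Finset.range N, (ω k).length := by
  induction N with
  | zero => rfl
  | succ N ih =>
    rw [List.range_succ, List.map_append, List.flatten_append, List.length_append, ih,
      Finset.sum_range_succ]
    simp

/-- Every large number is a combination of two consecutive numbers. -/
theorem exists_combination (l M : ℕ) (hM : l ^ 2 ≤ M) : ∃ i j, i * l + j * (l + 1) = M := by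
  rcases Nat.eq_zero_or_pos l with rfl | hl
  · exact ⟨0, M, by simp⟩
  · have h1 := Nat.div_add_mod M l
    have h2 := Nat.mod_lt M hl
    have h3 : l ≤ M / l := (Nat.le_div_iff_mul_le hl).2 (by rwa [← pow_two])
    refine ⟨M / l - M % l, M % l, ?_⟩
    obtain ⟨t, ht⟩ := Nat.exists_eq_add_of_le (h2.le.trans h3)
    rw [ht, Nat.add_sub_cancel_left]
    rw [ht] at h1
    linarith

/-- Orbits connecting the neighbourhoods of two points of a return system, for words of any large
length: the forward itinerary of the first point, some loops close to the centre with one of the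
two words `w`, `w'`, and the backward itinerary of the second point form a pseudo-orbit whose jumps
are far from its ends. -/
theorem IsReturnSystem.exists_connection (S : IsReturnSystem D G Λ ρ W w F) {w' : List ι}
    {F' : Cover d → Cover d} (hF' : IsReturnMap D G Λ ρ w' F') (hF'0 : ‖F' 0‖ ≤ ρ / 20)
    (hlen : w'.length = w.length + 1) {u v : Cover d} (hu : ‖u‖ < ρ) (hv : ‖v‖ < ρ)
    {U V : Set (Phase d)} (hU : U ∈ 𝓝 (chart Λ u)) (hV : V ∈ 𝓝 (chart Λ v)) :
    ∃ L₀ : ℕ, ∀ L, L₀ ≤ L → ∃ x : List ι, x.length = L ∧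
      ∃ q ∈ U, q ∈ wordDom D G x ∧ wordMap G x q ∈ V := by
  have hρ := S.pos
  have hnear : ∀ {u : Cover d} {U : Set (Phase d)}, U ∈ 𝓝 (chart Λ u) →
      ∃ r > 0, ∀ z, ‖z - u‖ ≤ r → chart Λ z ∈ U := by
    intro u U hU
    obtain ⟨r, hr, h⟩ := Metric.nhds_basis_closedBall.mem_iff.1
      ((continuous_chart Λ).continuousAt.preimage_mem_nhds hU)
    exact ⟨r, hr, fun z hz => h (by simpa [dist_eq_norm] using hz)⟩
  obtain ⟨r₁, hr₁, hr₁U⟩ := hnear hU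
  obtain ⟨r₂, hr₂, hr₂V⟩ := hnear hV
  set r₀ := min r₁ r₂ with hr₀
  have hr₀pos : 0 < r₀ := lt_min hr₁ hr₂
  obtain ⟨-, -, -, m₀, -, hm₀⟩ := exists_radii (c := ρ / 4) (by linarith) hr₀pos
  set m := m₀ + 1 with hm
  obtain ⟨pu, ωu, Hu, hpu0, hpuH, hpus⟩ := S.exists_forward_itinerary hu
  obtain ⟨pv, ωv, Hv, hpv0, hpvH, hpvs⟩ := S.exists_backward_itinerary hv
  obtain ⟨pf, ωf, Hf, hpf0, hpfH, hpfs⟩ := S.exists_forward_itinerary hv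
  have hlt : ∀ {p : ℕ → Cover d}, ‖p 0‖ < ρ → (∀ k, ‖p (k + 1)‖ ≤ ρ / 20) → ∀ k, ‖p k‖ < ρ := by
    intro p h0 hs k
    rcases k with _ | k
    · exact h0
    · linarith [hs k]
  have hpuρ := hlt (by rwa [hpu0]) hpus
  have hpvρ := hlt (by rwa [hpv0]) hpvs
  have hpfρ := hlt (by rwa [hpf0]) hpfs
  refine ⟨(∑ k ∈ Finset.range m, (ωu k).length) +
    (∑ k ∈ Finset.range m, (ωv (m - 1 - k)).length) + w.length ^ 2, fun L hL => ?_⟩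
  obtain ⟨i, j, hij⟩ := exists_combination w.length
    (L - (∑ k ∈ Finset.range m, (ωu k).length) -
      (∑ k ∈ Finset.range m, (ωv (m - 1 - k)).length)) (by omega)
  -- The pseudo-orbit `p` has `m` exact steps from `u`, then `M = i + j` zeros (with `i` words
  -- `w` and `j` words `w'`), and `m` exact steps to `v` at time `N`. It is continued after `N`
  -- since the shadowing lemma concerns infinite orbits.
  set M := i + j with hM
  set N := m + M + m with hN
  set p : ℕ → Cover d := fun k => if k < m then pu k else if k < m + M then 0 else
    if k ≤ N then pv (N - k) else pf (k - N) with hp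
  set H : ℕ → Cover d → Cover d := fun k => if k < m then Hu k else if k < m + M then
    (if k - m < i then F else F') else if k < N then Hv (N - 1 - k) else Hf (k - N) with hH
  set ω : ℕ → List ι := fun k => if k < m then ωu k else if k < m + M then
    (if k - m < i then w else w') else if k < N then ωv (N - 1 - k) else ωf (k - N) with hω
  have hret : ∀ k, IsReturnMap D G Λ ρ (ω k) (H k) := by
    intro k
    simp only [hω, hH]
    split_ifs
    · exact (hpuH _).2.1
    · exact S.isRet
    · exact hF'
    · exact (hpvH _).2.1
    · exact (hpfH _).2.1
  choose ν hν using fun k => (hret k).saddle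
  have hpρ : ∀ k, ‖p k‖ < ρ := by
    intro k
    simp only [hp]
    split_ifs
    · exact hpuρ _
    · simpa using hρ
    · exact hpvρ _
    · exact hpfρ _
  -- the middle part of the pseudo-orbit is close to the centre
  have hpmid : ∀ k, m ≤ k → k ≤ m + M → ‖p k‖ ≤ ρ / 20 := by
    intro k h1 h2
    rcases h2.lt_or_eq with h2 | rfl
    · simp only [hp, if_neg (not_lt.2 h1), if_pos h2, norm_zero]; linarith
    · have h3 : m + M ≤ N := by omega
      have h4 : N - (m + M) = m₀ + 1 := by omega
      simp only [hp, if_neg (not_lt.2 h1), lt_irrefl, if_false, if_pos h3, h4]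
      exact hpvs _
  -- The distance of the time `k` from the times `0` and `N`: one of the two truncated
  -- differences is zero.
  set e : ℕ → ℕ := fun k => min k (max (N - k) (k - N)) with he
  have he1 : ∀ k, e (k + 1) ≤ e k + 1 := fun k => by simp only [he]; omega
  have he2 : ∀ k, e k ≤ e (k + 1) + 1 := fun k => by simp only [he]; omega
  set r : ℕ → ℝ := fun k => min (ρ / 4) (r₀ * 2 ^ e k) with hr
  have hrle : ∀ a b : ℕ, a ≤ b + 1 →
      min (ρ / 4) (r₀ * 2 ^ a) ≤ 2 * min (ρ / 4) (r₀ * 2 ^ b) := by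
    intro a b hab
    rw [mul_min_of_nonneg _ _ zero_le_two]
    refine min_le_min (by linarith) ?_
    have h1 : (2 : ℝ) ^ a ≤ 2 ^ (b + 1) := pow_le_pow_right₀ one_le_two hab
    rw [pow_succ] at h1
    nlinarith
  have hrn : ∀ k, 0 ≤ r k := fun k => by positivity
  have hjump : ∀ k, ‖H k (p k) - p (k + 1)‖ ≤ 3 / 5 * r k ∧
      ‖H k (p k) - p (k + 1)‖ ≤ 3 / 5 * r (k + 1) := by
    intro k
    -- Jumps occur only at times for which the radius is `ρ / 4`.
    by_cases hk : m₀ ≤ k ∧ k < m + M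
    · have h1 : ‖H k (p k)‖ ≤ ρ / 20 := by
        by_cases hk' : k < m
        · have : k = m₀ := by omega
          subst this
          simp only [hH, hp, if_pos hk', (hpuH _).2.2]
          exact hpus _
        · simp only [hH, hp, if_neg hk', if_pos hk.2]
          split_ifs
          · exact S.small
          · exact hF'0
      have h2 := hpmid (k + 1) (by omega) (by omega)
      have h3 : r k = ρ / 4 := hm₀ (e k) (by simp only [he]; omega)
      have h4 : r (k + 1) = ρ / 4 := hm₀ (e (k + 1)) (by simp only [he]; omega)
      have h5 := norm_sub_le (H k (p k)) (p (k + 1))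
      rw [h3, h4]
      exact ⟨by linarith, by linarith⟩
    · have h1 : H k (p k) = p (k + 1) := by
        rcases Nat.lt_or_ge k m₀ with h1 | h1
        · have h2 : k < m := by omega
          have h3 : k + 1 < m := by omega
          simp only [hH, hp, if_pos h2, if_pos h3, (hpuH _).2.2]
        · have h2 : ¬ k < m + M := fun h => hk ⟨h1, h⟩
          have h3 : ¬ k < m := by omega
          have h4 : ¬ k + 1 < m := by omega
          have h5 : ¬ k + 1 < m + M := by omega
          rcases Nat.lt_or_ge k N with h6 | h6
          · have h7 : k ≤ N := h6.le
            have h8 : k + 1 ≤ N := h6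
            have h9 : N - k = N - 1 - k + 1 := by omega
            have h10 : N - (k + 1) = N - 1 - k := by omega
            simp only [hH, hp, if_neg h2, if_neg h3, if_neg h4, if_neg h5, if_pos h6, if_pos h7,
              if_pos h8]
            rw [h9, h10]
            exact (hpvH _).2.2
          · have h7 : ¬ k < N := by omega
            have h8 : ¬ k + 1 ≤ N := by omega
            have h9 : k + 1 - N = k - N + 1 := by omega
            have h10 : (if k ≤ N then pv (N - k) else pf (k - N)) = pf (k - N) := by
              split_ifs with h
              · have : k = N := le_antisymm h h6
                subst this
                simp [hpv0, hpf0]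
              · rfl
            simp only [hH, hp, if_neg h2, if_neg h3, if_neg h4, if_neg h5, if_neg h7, if_neg h8,
              h10, h9]
            exact (hpfH _).2.2
      rw [h1, sub_self, norm_zero]
      exact ⟨mul_nonneg (by norm_num) (hrn k), mul_nonneg (by norm_num) (hrn _)⟩
  obtain ⟨z, hz, -, hzH⟩ := exists_forward_orbit hν hrn (fun k => hrle _ _ (he1 k))
    (fun k => hrle _ _ (he2 k)) (p := p)
    (fun k => by linarith [hpρ k, min_le_left (ρ / 4) (r₀ * 2 ^ e k)])
    (fun k => (hjump k).1) (fun k => (hjump k).2) (g := fun _ => (p 0).1)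
    (fun z w _ _ => by
      rw [sub_self, norm_zero]; exact mul_nonneg (by norm_num) (norm_nonneg _)) rfl
  have hz2 : ∀ k, ‖z k‖ < 2 * ρ := by
    intro k
    have h1 := norm_add_le (z k - p k) (p k)
    rw [sub_add_cancel] at h1
    linarith [hz k, hpρ k, min_le_left (ρ / 4) (r₀ * 2 ^ e k)]
  obtain ⟨hdom, hmap, -⟩ := orbit_comp (D := D) (G := G) (Λ := Λ) (ρ := ρ) (z := z) (ω := ω)
    (H := H) N (fun k _ => hret k) (fun k _ => hz2 k) (fun k _ => hzH k)
  refine ⟨_, ?_, chart Λ (z 0), ?_, hdom, ?_⟩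
  · rw [length_flatten_map_range, hN, Finset.sum_range_add, Finset.sum_range_add]
    have s1 : ∑ k ∈ Finset.range m, (ω k).length = ∑ k ∈ Finset.range m, (ωu k).length :=
      Finset.sum_congr rfl fun k hk => by
        simp only [hω, if_pos (Finset.mem_range.1 hk)]
    have s2 : ∑ k ∈ Finset.range M, (ω (m + k)).length = i * w.length + j * (w.length + 1) := by
      have h1 : ∀ k, k < M → ω (m + k) = if k < i then w else w' := by
        intro k hk
        have h2 : ¬ m + k < m := by omega
        have h3 : m + k < m + M := by omega
        simp only [hω, if_neg h2, if_pos h3, Nat.add_sub_cancel_left]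
      rw [hM, Finset.sum_range_add]
      congr 1
      · rw [Finset.sum_congr rfl (g := fun _ => w.length)]
        · simp
        · intro k hk
          have hk := Finset.mem_range.1 hk
          rw [h1 k (by omega), if_pos hk]
      · rw [Finset.sum_congr rfl (g := fun _ => w.length + 1)]
        · simp
        · intro k hk
          have hk := Finset.mem_range.1 hk
          rw [h1 (i + k) (by omega), if_neg (by omega), hlen]
    have s3 : ∑ k ∈ Finset.range m, (ω (m + M + k)).length =
        ∑ k ∈ Finset.range m, (ωv (m - 1 - k)).length :=
      Finset.sum_congr rfl fun k hk => by
        have hk := Finset.mem_range.1 hk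
        have h2 : ¬ m + M + k < m := by omega
        have h3 : ¬ m + M + k < m + M := by omega
        have h4 : m + M + k < N := by omega
        have h5 : N - 1 - (m + M + k) = m - 1 - k := by omega
        simp only [hω, if_neg h2, if_neg h3, if_pos h4, h5]
    rw [s1, s2, s3, hij]
    omega
  · refine hr₁U _ ?_
    have h0 : p 0 = u := by simp [hp, hpu0, hm]
    have h1 := hz 0
    rw [h0] at h1
    refine h1.trans ((min_le_right _ _).trans ?_)
    have h2 : e 0 = 0 := by simp [he]
    rw [h2, pow_zero, mul_one]
    exact min_le_left _ _
  · rw [hmap]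
    refine hr₂V _ ?_
    have h0 : p N = v := by
      have h2 : ¬ N < m := by omega
      have h3 : ¬ N < m + M := by omega
      simp only [hp, if_neg h2, if_neg h3, le_refl, if_true, Nat.sub_self, hpv0]
    have h1 := hz N
    rw [h0] at h1
    refine h1.trans ((min_le_right _ _).trans ?_)
    have h2 : e N = 0 := by simp [he]
    rw [h2, pow_zero, mul_one]
    exact min_le_right _ _

end CoreMixing

/-! ### Kronecker's theorem, uniformly over the vectors of constant type -/

section Kronecker

open UnitAddTorus

variable {d : ℕ}

theorem IsConstantType.neg {γ : ℝ} {β : Fin d → ℝ} (h : IsConstantType γ β) :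
    IsConstantType γ (-β) := by
  intro k hk l
  have := h k hk (-l)
  rw [← abs_neg] at this
  convert this using 2
  push_cast
  simp only [Pi.neg_apply, neg_mul, Finset.sum_neg_distrib]
  ring

theorem mFourier_add_apply (k : Fin d → ℤ) (x y : Torus d) :
    mFourier k (x + y) = mFourier k x * mFourier k y := by
  simp [mFourier, fourier_apply, smul_add, AddCircle.toCircle_add, Finset.prod_mul_distrib]

theorem mFourier_nsmul_apply (k : Fin d → ℤ) (x : Torus d) (n : ℕ) :
    mFourier k (n • x) = mFourier k x ^ n := by
  induction n with
  | zero => simp [mFourier, fourier_apply]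
  | succ n ih => rw [succ_nsmul, mFourier_add_apply, ih, pow_succ]

theorem norm_mFourier_apply (k : Fin d → ℤ) (x : Torus d) : ‖mFourier k x‖ = 1 := by
  simp only [mFourier, fourier_apply, ContinuousMap.coe_mk, norm_prod, Circle.norm_coe,
    Finset.prod_const_one]

theorem mFourier_torusProj (k : Fin d → ℤ) (β : Fin d → ℝ) :
    mFourier k (torusProj β) =
      (AddCircle.toCircle ((∑ i, β i * (k i : ℝ) : ℝ) : UnitAddCircle) : ℂ) := by
  have h : ∀ s : Finset (Fin d), ∏ i ∈ s, ((fourier (k i)) (torusProj β i) : ℂ) =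
      (AddCircle.toCircle ((∑ i ∈ s, β i * (k i : ℝ) : ℝ) : UnitAddCircle) : ℂ) := by
    intro s
    induction s using Finset.induction_on with
    | empty => simp
    | insert i s hi ih =>
      rw [Finset.prod_insert hi, Finset.sum_insert hi, ih, AddCircle.coe_add,
        AddCircle.toCircle_add, Circle.coe_mul, fourier_apply]
      congr 3
      rw [torusProj, ← AddCircle.coe_zsmul, zsmul_eq_mul, mul_comm]
  exact h Finset.univ

/-- The values at a vector of constant type of a nontrivial character of the torus are bounded away
from one, uniformly in the vector. -/
theorem exists_le_norm_mFourier_sub_one {γ : ℝ} (hγ : 0 < γ) {k : Fin d → ℤ} (hk : k ≠ 0) :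
    ∃ c > (0 : ℝ), ∀ β : Fin d → ℝ, IsConstantType γ β →
      c ≤ ‖mFourier k (torusProj β) - 1‖ := by
  set s : Set UnitAddCircle := {θ | γ / ‖k‖ ^ d ≤ ‖θ‖} with hs
  have hsc : IsCompact s := (isClosed_le continuous_const continuous_norm).isCompact
  have hpos : 0 < γ / ‖k‖ ^ d := div_pos hγ (pow_pos (norm_pos_iff.2 hk) _)
  have hmem : ∀ β : Fin d → ℝ, IsConstantType γ β →
      ((∑ i, β i * (k i : ℝ) : ℝ) : UnitAddCircle) ∈ s := by
    intro β hβ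
    change γ / ‖k‖ ^ d ≤ ‖((∑ i, β i * (k i : ℝ) : ℝ) : UnitAddCircle)‖
    rw [UnitAddCircle.norm_eq]
    exact hβ k hk _
  rcases s.eq_empty_or_nonempty with h | h
  · exact ⟨1, one_pos, fun β hβ => absurd (hmem β hβ) (by simp [h])⟩
  · obtain ⟨θ₀, hθ₀, hmin⟩ := hsc.exists_isMinOn h
      (f := fun θ : UnitAddCircle => ‖(AddCircle.toCircle θ : ℂ) - 1‖)
      (((continuous_subtype_val.comp AddCircle.continuous_toCircle).sub
        continuous_const).norm.continuousOn)
    refine ⟨‖(AddCircle.toCircle θ₀ : ℂ) - 1‖, ?_, fun β hβ => ?_⟩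
    · refine norm_pos_iff.2 (sub_ne_zero.2 fun h1 => ?_)
      have h2 : AddCircle.toCircle θ₀ = AddCircle.toCircle (0 : UnitAddCircle) := by
        rw [AddCircle.toCircle_zero]
        exact Circle.ext h1
      have h3 := AddCircle.injective_toCircle one_ne_zero h2
      have h4 : γ / ‖k‖ ^ d ≤ ‖θ₀‖ := hθ₀
      rw [h3, norm_zero] at h4
      linarith
    · rw [mFourier_torusProj]
      exact hmin (hmem β hβ)

/-- The Birkhoff averages of the function `f` along the translations of the torus by vectors of
constant type converge to a constant, uniformly in the vector and in the initial point. -/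
def HasUniformMean (γ : ℝ) (f : C(Torus d, ℂ)) : Prop :=
  ∃ c : ℂ, ∀ δ > (0 : ℝ), ∃ N : ℕ, ∀ n ≥ N, ∀ β : Fin d → ℝ, IsConstantType γ β → ∀ x : Torus d,
    ‖∑ k ∈ Finset.range n, f (x + k • torusProj β) - n * c‖ ≤ δ * n

/-- The Birkhoff sum of a nontrivial character is a geometric sum, bounded in terms of the distance
of its ratio from one. -/
theorem hasUniformMean_mFourier {γ : ℝ} (hγ : 0 < γ) (k : Fin d → ℤ) :
    HasUniformMean γ (mFourier k) := by
  by_cases hk : k = 0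
  · refine ⟨1, fun δ hδ => ⟨0, fun n _ β _ x => ?_⟩⟩
    subst hk
    simp only [mFourier_zero, ContinuousMap.one_apply, Finset.sum_const, Finset.card_range,
      nsmul_eq_mul, sub_self, norm_zero]
    positivity
  · obtain ⟨c, hc, hck⟩ := exists_le_norm_mFourier_sub_one hγ hk
    refine ⟨0, fun δ hδ => ?_⟩
    obtain ⟨N, hN⟩ := exists_nat_ge (2 / c / δ)
    refine ⟨N, fun n hn β hβ x => ?_⟩
    have h1 := hck β hβ
    have h2 : mFourier k (torusProj β) ≠ 1 := by
      intro h
      rw [h, sub_self, norm_zero] at h1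
      linarith
    simp only [mFourier_add_apply, mFourier_nsmul_apply, ← Finset.mul_sum, mul_zero, sub_zero,
      norm_mul, norm_mFourier_apply, one_mul]
    rw [geom_sum_eq h2, norm_div]
    have h3 : ‖mFourier k (torusProj β) ^ n - 1‖ ≤ 2 := by
      refine (norm_sub_le _ _).trans ?_
      rw [norm_pow, norm_mFourier_apply, one_pow, norm_one]
      norm_num
    have h4 : 2 / c / δ ≤ n := hN.trans (by exact_mod_cast hn)
    rw [div_le_iff₀ hδ] at h4
    calc _ ≤ 2 / c := by gcongr
      _ ≤ δ * n := by linarith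

theorem HasUniformMean.add {γ : ℝ} {f g : C(Torus d, ℂ)} (hf : HasUniformMean γ f)
    (hg : HasUniformMean γ g) : HasUniformMean γ (f + g) := by
  obtain ⟨c, hc⟩ := hf
  obtain ⟨c', hc'⟩ := hg
  refine ⟨c + c', fun δ hδ => ?_⟩
  obtain ⟨N, hN⟩ := hc (δ / 2) (by positivity)
  obtain ⟨N', hN'⟩ := hc' (δ / 2) (by positivity)
  refine ⟨max N N', fun n hn β hβ x => ?_⟩
  have h1 := hN n (le_of_max_le_left hn) β hβ x
  have h2 := hN' n (le_of_max_le_right hn) β hβ x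
  simp only [ContinuousMap.add_apply, Finset.sum_add_distrib, mul_add]
  rw [add_sub_add_comm]
  refine (norm_add_le _ _).trans ?_
  linarith

theorem HasUniformMean.smul {γ : ℝ} {f : C(Torus d, ℂ)} (hf : HasUniformMean γ f) (a : ℂ) :
    HasUniformMean γ (a • f) := by
  obtain ⟨c, hc⟩ := hf
  refine ⟨a * c, fun δ hδ => ?_⟩
  have ha : 0 < ‖a‖ + 1 := by positivity
  obtain ⟨N, hN⟩ := hc (δ / (‖a‖ + 1)) (by positivity)
  refine ⟨N, fun n hn β hβ x => ?_⟩
  have h1 := hN n hn β hβ x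
  simp only [ContinuousMap.smul_apply, smul_eq_mul, ← Finset.mul_sum]
  rw [mul_left_comm, ← mul_sub, norm_mul]
  calc ‖a‖ * _ ≤ (‖a‖ + 1) * (δ / (‖a‖ + 1) * n) := by gcongr; linarith
    _ = δ * n := by field_simp

theorem hasUniformMean_of_mem_span {γ : ℝ} (hγ : 0 < γ) {f : C(Torus d, ℂ)}
    (hf : f ∈ Submodule.span ℂ (range (mFourier (d := Fin d)))) : HasUniformMean γ f := by
  induction hf using Submodule.span_induction with
  | mem x h => obtain ⟨k, rfl⟩ := h; exact hasUniformMean_mFourier hγ k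
  | zero => rw [← zero_smul ℂ (mFourier (0 : Fin d → ℤ))]; exact (hasUniformMean_mFourier hγ _).smul 0
  | add x y _ _ hx hy => exact hx.add hy
  | smul a x _ hx => exact hx.smul a

theorem torusProj_add (x y : Fin d → ℝ) : torusProj (x + y) = torusProj x + torusProj y := rfl

theorem torusProj_natCast_smul (n : ℕ) (x : Fin d → ℝ) :
    torusProj ((n : ℝ) • x) = n • torusProj x := by
  induction n with
  | zero => ext i; simp [torusProj]
  | succ n ih => rw [succ_nsmul, ← ih, ← torusProj_add]; congr 1; push_cast; rw [add_smul, one_smul]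

/-- The norm of a point of the torus is the distance of its lifts from the integer vectors. -/
theorem exists_norm_sub_intCast_eq (x : Fin d → ℝ) :
    ∃ l : Fin d → ℤ, ‖x - fun i => (l i : ℝ)‖ ≤ ‖torusProj x‖ := by
  refine ⟨fun i => round (x i), (pi_norm_le_iff_of_nonneg (norm_nonneg _)).2 fun i => ?_⟩
  have h1 := norm_le_pi_norm (torusProj x) i
  rw [torusProj, UnitAddCircle.norm_eq] at h1
  exact h1

/-- Kronecker's theorem, uniform over the vectors of constant type: a trigonometric polynomial close
to a bump function has nearly the same Birkhoff average along all orbits, and the average of the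
bump function is positive along some orbit, hence along all of them. -/
theorem exists_kronecker_bound (d : ℕ) {γ : ℝ} (hγ : 0 < γ) {η : ℝ} (hη : 0 < η) :
    ∃ N : ℕ, ∀ β : Fin d → ℝ, IsConstantType γ β → ∀ x : Fin d → ℝ,
      ∃ k ≤ N, ∃ l : Fin d → ℤ, ‖(k : ℝ) • β - x - fun i => (l i : ℝ)‖ ≤ η := by
  set f : C(Torus d, ℂ) := ⟨fun θ => ((max 0 (η - ‖θ‖) : ℝ) : ℂ), by fun_prop⟩ with hf
  obtain ⟨T, -, hTf, hT⟩ := isCompact_univ.elim_finite_subcover_image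
    (b := (univ : Set (Torus d))) (c := fun t => Metric.ball t (η / 2))
    (fun t _ => Metric.isOpen_ball)
    (fun t _ => mem_iUnion₂.2 ⟨t, mem_univ _, Metric.mem_ball_self (by positivity)⟩)
  lift T to Finset (Torus d) using hTf
  set q : ℝ := (T.card : ℝ) with hq
  have hq0 : 0 < q + 1 := by positivity
  -- a precision which is small in comparison with the average of `∑ t ∈ T, f (θ - t) ≥ η / 2`
  set δ : ℝ := η / (16 * (q + 1)) with hδ
  have hδ0 : 0 < δ := by positivity
  have hcl : f ∈ (Submodule.span ℂ (range (mFourier (d := Fin d)))).topologicalClosure := by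
    rw [span_mFourier_closure_eq_top]; trivial
  obtain ⟨p, hp, hfp⟩ := Metric.mem_closure_iff.1 hcl δ hδ0
  have hfp' : ∀ θ, ‖f θ - p θ‖ ≤ δ := fun θ => by
    rw [← dist_eq_norm]
    exact (ContinuousMap.dist_apply_le_dist θ).trans hfp.le
  obtain ⟨c, hc⟩ := hasUniformMean_of_mem_span hγ hp
  obtain ⟨N, hN⟩ := hc δ hδ0
  refine ⟨N, fun β hβ x => ?_⟩
  -- If the orbit of `-x` misses the support of `f`, the average of `f` along it is zero, hence
  -- the average along every orbit is small; but the translates of `f` by `T` cannot all have a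
  -- small average.
  by_contra! hno
  set n := N + 1 with hn
  have hn0 : (0 : ℝ) < n := by positivity
  have key : ∀ y : Torus d, ‖∑ k ∈ Finset.range n, f (y + k • torusProj β) - n * c‖ ≤
      2 * δ * n := by
    intro y
    have h1 := hN n (by omega) β hβ y
    have h2 : ‖∑ k ∈ Finset.range n, (f (y + k • torusProj β) - p (y + k • torusProj β))‖ ≤
        n * δ := by
      refine (norm_sum_le_of_le _ fun k _ => hfp' _).trans ?_
      simp
    rw [Finset.sum_sub_distrib] at h2
    calc _ = ‖(∑ k ∈ Finset.range n, f (y + k • torusProj β) -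
          ∑ k ∈ Finset.range n, p (y + k • torusProj β)) +
          (∑ k ∈ Finset.range n, p (y + k • torusProj β) - n * c)‖ := by congr 1; ring
      _ ≤ _ := (norm_add_le _ _).trans (by linarith)
  have hzero : ∑ k ∈ Finset.range n, f (torusProj (-x) + k • torusProj β) = 0 := by
    refine Finset.sum_eq_zero fun k hk => ?_
    rw [← torusProj_natCast_smul, ← torusProj_add]
    obtain ⟨l, hl⟩ := exists_norm_sub_intCast_eq (-x + (k : ℝ) • β)
    have h1 := hno k (by have := Finset.mem_range.1 hk; omega) l
    rw [neg_add_eq_sub] at hl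
    have h2 : η - ‖torusProj (-x + (k : ℝ) • β)‖ ≤ 0 := by
      rw [neg_add_eq_sub]; linarith
    simp [hf, max_eq_left h2]
  have hc1 := key (torusProj (-x))
  rw [hzero, zero_sub, norm_neg] at hc1
  have hall : ∀ y : Torus d, ‖∑ k ∈ Finset.range n, f (y + k • torusProj β)‖ ≤ 4 * δ * n := by
    intro y
    have h1 := key y
    have h2 := norm_sub_norm_le (∑ k ∈ Finset.range n, f (y + k • torusProj β)) (n * c)
    linarith
  have hre : ∀ y : Torus d, ‖∑ k ∈ Finset.range n, f (y + k • torusProj β)‖ =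
      ∑ k ∈ Finset.range n, max 0 (η - ‖y + k • torusProj β‖) := by
    intro y
    have h1 : ∑ k ∈ Finset.range n, f (y + k • torusProj β) =
        ((∑ k ∈ Finset.range n, max 0 (η - ‖y + k • torusProj β‖) : ℝ) : ℂ) := by
      push_cast
      simp [hf]
    rw [h1, Complex.norm_real, Real.norm_of_nonneg]
    exact Finset.sum_nonneg fun _ _ => le_max_left _ _
  have hlow : ∀ θ : Torus d, η / 2 ≤ ∑ t ∈ T, max 0 (η - ‖-t + θ‖) := by
    intro θ
    obtain ⟨t, ht, hθ⟩ := mem_iUnion₂.1 (hT (mem_univ θ))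
    rw [Metric.mem_ball, dist_eq_norm] at hθ
    refine le_trans ?_ (Finset.single_le_sum (fun _ _ => le_max_left _ _) ht)
    rw [neg_add_eq_sub]
    exact le_max_of_le_right (by linarith)
  have h1 : (n : ℝ) * (η / 2) ≤ q * (4 * δ * n) := by
    calc (n : ℝ) * (η / 2) = ∑ k ∈ Finset.range n, η / 2 := by simp
      _ ≤ ∑ k ∈ Finset.range n, ∑ t ∈ T, max 0 (η - ‖-t + k • torusProj β‖) :=
        Finset.sum_le_sum fun k _ => hlow _
      _ = ∑ t ∈ T, ∑ k ∈ Finset.range n, max 0 (η - ‖-t + k • torusProj β‖) := Finset.sum_comm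
      _ ≤ ∑ t ∈ T, 4 * δ * n := Finset.sum_le_sum fun t _ => by rw [← hre]; exact hall _
      _ = _ := by simp [hq]
  have h2 : q * (4 * δ) ≤ η / 4 := by
    have : (q + 1) * (4 * δ) = η / 4 := by rw [hδ]; field_simp; ring
    nlinarith
  nlinarith

end Kronecker

/-! ### Estimates for `C²` families -/

section Estimates

variable {d : ℕ} {e K : ℝ} {F : ℝ → Torus d → (Fin d → ℝ) → (Fin d → ℝ)}

theorem mem_actionCube {J : Fin d → ℝ} : J ∈ actionCube d ↔ ‖J‖ ≤ 1 :=
  (pi_norm_le_iff_of_nonneg (x := J) zero_le_one).symm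

theorem actionCube_eq (d : ℕ) : actionCube d = Metric.closedBall (0 : Fin d → ℝ) 1 := by
  ext J
  rw [mem_actionCube, mem_closedBall_zero_iff]

theorem convex_familyDomain (d : ℕ) (e : ℝ) : Convex ℝ (familyDomain d e) :=
  (convex_Icc _ _).prod (convex_univ.prod (by rw [actionCube_eq]; exact convex_closedBall _ _))

theorem uniqueDiffOn_annulusDomain (d : ℕ) :
    UniqueDiffOn ℝ (univ ×ˢ actionCube d : Set (Cover d)) := by
  refine uniqueDiffOn_univ.prod ?_
  rw [actionCube_eq]
  exact uniqueDiffOn_convex (convex_closedBall _ _) ((Metric.nonempty_ball.2 one_pos).mono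
    Metric.ball_subset_interior_closedBall)

theorem uniqueDiffOn_familyDomain (d : ℕ) (he : 0 < e) : UniqueDiffOn ℝ (familyDomain d e) :=
  (uniqueDiffOn_Icc (by linarith)).prod (uniqueDiffOn_annulusDomain d)

theorem mem_familyDomain {x : ℝ × Cover d} :
    x ∈ familyDomain d e ↔ |x.1| ≤ e ∧ ‖x.2.2‖ ≤ 1 := by
  simp [familyDomain, mem_prod, mem_actionCube, abs_le]

theorem IsC2Family.norm_le (h : IsC2Family e K F) {x : ℝ × Cover d} (hx : x ∈ familyDomain d e) :
    ‖familyLift F x‖ ≤ K := by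
  simpa using h.2 0 (by norm_num) x hx

theorem IsC2Family.nonneg (h : IsC2Family e K F) (he : 0 < e) : 0 ≤ K :=
  (norm_nonneg _).trans (h.norm_le (x := 0) (mem_familyDomain.2 (by simp [he.le])))

theorem IsC2Family.norm_fderivWithin_le (h : IsC2Family e K F) (he : 0 < e) {x : ℝ × Cover d}
    (hx : x ∈ familyDomain d e) :
    ‖fderivWithin ℝ (familyLift F) (familyDomain d e) x‖ ≤ K := by
  have := h.2 1 (by norm_num) x hx
  rwa [norm_iteratedFDerivWithin_one _ (uniqueDiffOn_familyDomain d he x hx)] at this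

theorem IsC2Family.norm_fderivWithin_sub_le (h : IsC2Family e K F) (he : 0 < e)
    {x y : ℝ × Cover d} (hx : x ∈ familyDomain d e) (hy : y ∈ familyDomain d e) :
    ‖fderivWithin ℝ (familyLift F) (familyDomain d e) x -
      fderivWithin ℝ (familyLift F) (familyDomain d e) y‖ ≤ K * ‖x - y‖ := by
  have hu := uniqueDiffOn_familyDomain d he
  refine (convex_familyDomain d e).norm_image_sub_le_of_norm_fderivWithin_le
    ((h.1.fderivWithin hu (m := 1) (by norm_num)).differentiableOn one_ne_zero) (fun z hz => ?_)
    hy hx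
  have := h.2 2 le_rfl z hz
  rwa [← norm_iteratedFDerivWithin_fderivWithin hu hz (n := 1),
    norm_iteratedFDerivWithin_one _ (hu z hz)] at this

/-- The derivative in `(φ, J)` of the family `F`, at `(ε, φ, J)`. -/
noncomputable def spaceDeriv (e : ℝ) (F : ℝ → Torus d → (Fin d → ℝ) → (Fin d → ℝ)) (ε : ℝ)
    (y : Cover d) : Cover d →L[ℝ] (Fin d → ℝ) :=
  (fderivWithin ℝ (familyLift F) (familyDomain d e) (ε, y)).comp
    (ContinuousLinearMap.inr ℝ ℝ (Cover d))

/-- The function `(φ, J) ↦ F_ε(φ, J)` on the cover. -/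
def familySlice (F : ℝ → Torus d → (Fin d → ℝ) → (Fin d → ℝ)) (ε : ℝ) (y : Cover d) : Fin d → ℝ :=
  F ε (torusProj y.1) y.2

theorem IsC2Family.hasFDerivWithinAt (h : IsC2Family e K F) {ε : ℝ} (hε : |ε| ≤ e)
    {y : Cover d} (hy : ‖y.2‖ ≤ 1) :
    HasFDerivWithinAt (familySlice F ε) (spaceDeriv e F ε y) (univ ×ˢ actionCube d) y := by
  have h1 : HasFDerivWithinAt (familyLift F)
      (fderivWithin ℝ (familyLift F) (familyDomain d e) (ε, y)) (familyDomain d e) (ε, y) :=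
    (h.1.differentiableOn two_ne_zero _ (mem_familyDomain.2 ⟨hε, hy⟩)).hasFDerivWithinAt
  have h2 : HasFDerivWithinAt (fun y : Cover d => (ε, y)) (ContinuousLinearMap.inr ℝ ℝ (Cover d))
      (univ ×ˢ actionCube d) y := (hasFDerivAt_prodMk_right ε y).hasFDerivWithinAt
  exact h1.comp y h2 fun z hz => ⟨abs_le.1 hε, hz⟩

theorem norm_comp_inr_le {E₁ E₂ E₃ : Type*} [NormedAddCommGroup E₁] [NormedSpace ℝ E₁]
    [NormedAddCommGroup E₂] [NormedSpace ℝ E₂] [NormedAddCommGroup E₃] [NormedSpace ℝ E₃]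
    (L : E₁ × E₂ →L[ℝ] E₃) : ‖L.comp (ContinuousLinearMap.inr ℝ E₁ E₂)‖ ≤ ‖L‖ := by
  refine ContinuousLinearMap.opNorm_le_bound _ (norm_nonneg _) fun v => ?_
  refine (L.le_opNorm _).trans_eq ?_
  simp [Prod.norm_def]

theorem IsC2Family.norm_spaceDeriv_le (h : IsC2Family e K F) (he : 0 < e) {ε : ℝ} (hε : |ε| ≤ e)
    {y : Cover d} (hy : ‖y.2‖ ≤ 1) : ‖spaceDeriv e F ε y‖ ≤ K :=
  (norm_comp_inr_le _).trans (h.norm_fderivWithin_le he (mem_familyDomain.2 ⟨hε, hy⟩))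

theorem IsC2Family.norm_spaceDeriv_sub_le (h : IsC2Family e K F) (he : 0 < e) {ε ε' : ℝ}
    (hε : |ε| ≤ e) (hε' : |ε'| ≤ e) {y y' : Cover d} (hy : ‖y.2‖ ≤ 1) (hy' : ‖y'.2‖ ≤ 1) :
    ‖spaceDeriv e F ε y - spaceDeriv e F ε' y'‖ ≤ K * max |ε - ε'| ‖y - y'‖ := by
  have := h.norm_fderivWithin_sub_le he (mem_familyDomain.2 ⟨hε, hy⟩ : (ε, y) ∈ familyDomain d e)
    (mem_familyDomain.2 ⟨hε', hy'⟩ : (ε', y') ∈ familyDomain d e)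
  rw [spaceDeriv, spaceDeriv, ← ContinuousLinearMap.sub_comp]
  exact (norm_comp_inr_le _).trans this

/-- The mean value inequality for the slices of a family. -/
theorem IsC2Family.norm_slice_sub_le (h : IsC2Family e K F) {ε : ℝ} (hε : |ε| ≤ e)
    {s : Set (Cover d)} (hs : Convex ℝ s) (hs1 : ∀ y ∈ s, ‖y.2‖ ≤ 1)
    {L : Cover d →L[ℝ] (Fin d → ℝ)} {C : ℝ} (hC : ∀ y ∈ s, ‖spaceDeriv e F ε y - L‖ ≤ C)
    {y y' : Cover d} (hy : y ∈ s) (hy' : y' ∈ s) :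
    ‖familySlice F ε y - familySlice F ε y' - L (y - y')‖ ≤ C * ‖y - y'‖ :=
  hs.norm_image_sub_le_of_norm_hasFDerivWithin_le' (fun z hz =>
    (h.hasFDerivWithinAt hε (hs1 z hz)).mono fun w hw => ⟨trivial, mem_actionCube.2 (hs1 w hw)⟩)
    hC hy' hy

theorem convex_norm_snd_le (s : ℝ) : Convex ℝ {y : Cover d | ‖y.2‖ ≤ s} := by
  have : {y : Cover d | ‖y.2‖ ≤ s} = univ ×ˢ Metric.closedBall (0 : Fin d → ℝ) s := by
    ext y; simp [mem_prod]
  rw [this]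
  exact convex_univ.prod (convex_closedBall _ _)

variable {Rφ RJ : ℝ → Torus d → (Fin d → ℝ) → (Fin d → ℝ)}

theorem SmallNonlinearity.angle_eq_zero (hR : SmallNonlinearity e K Rφ RJ) {ε : ℝ} (hε : |ε| ≤ e)
    (θ : Torus d) : Rφ ε θ 0 = 0 := by
  have h1 := (hR ε (abs_le.1 hε)).1 θ 0 (by norm_num)
  have h2 := norm_iteratedFDeriv_zero (𝕜 := ℝ) (f := fun J => Rφ ε θ J) (x := 0)
  rw [h1, norm_zero] at h2
  exact norm_eq_zero.1 h2.symm

theorem SmallNonlinearity.action_eq_zero (hR : SmallNonlinearity e K Rφ RJ) {ε : ℝ}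
    (hε : |ε| ≤ e) (θ : Torus d) : RJ ε θ 0 = 0 := by
  have h1 := (hR ε (abs_le.1 hε)).2.1 θ 0 (by norm_num)
  have h2 := norm_iteratedFDeriv_zero (𝕜 := ℝ) (f := fun J => RJ ε θ J) (x := 0)
  rw [h1, norm_zero] at h2
  exact norm_eq_zero.1 h2.symm

theorem IsC2Family.hasFDerivAt (h : IsC2Family e K F) {ε : ℝ} (hε : |ε| ≤ e)
    {y : Cover d} (hy : ‖y.2‖ < 1) : HasFDerivAt (familySlice F ε) (spaceDeriv e F ε y) y := by
  refine (h.hasFDerivWithinAt hε hy.le).hasFDerivAt ?_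
  have : IsOpen {y : Cover d | ‖y.2‖ < 1} := isOpen_lt continuous_snd.norm continuous_const
  filter_upwards [this.mem_nhds hy] with z hz
  exact ⟨trivial, mem_actionCube.2 (le_of_lt hz)⟩

/-- The derivative of `R_{ε,φ}` vanishes on the zero section. -/
theorem SmallNonlinearity.spaceDeriv_angle_eq_zero (hR : SmallNonlinearity e K Rφ RJ)
    (h : IsC2Family e K Rφ) {ε : ℝ} (hε : |ε| ≤ e) (φ : Fin d → ℝ) :
    spaceDeriv e Rφ ε (φ, 0) = 0 := by
  have h0 : HasFDerivAt (familySlice Rφ ε) (spaceDeriv e Rφ ε (φ, 0)) (φ, 0) :=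
    h.hasFDerivAt hε (by simp)
  have hl : (spaceDeriv e Rφ ε (φ, 0)).comp (ContinuousLinearMap.inl ℝ _ _) = 0 := by
    have h1 := HasFDerivAt.comp (f := fun φ : Fin d → ℝ => (φ, (0 : Fin d → ℝ))) φ h0
      (hasFDerivAt_prodMk_left φ (0 : Fin d → ℝ))
    have h2 : (familySlice Rφ ε) ∘ (fun φ => (φ, 0)) = fun _ => 0 := by
      funext φ
      exact hR.angle_eq_zero hε _
    rw [h2] at h1
    exact h1.unique (hasFDerivAt_const _ _)
  have hr : (spaceDeriv e Rφ ε (φ, 0)).comp (ContinuousLinearMap.inr ℝ _ _) = 0 := by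
    have h1 : HasFDerivAt (fun J => Rφ ε (torusProj φ) J) _ 0 :=
      h0.comp 0 (hasFDerivAt_prodMk_right φ (0 : Fin d → ℝ))
    have h2 := norm_iteratedFDeriv_one (𝕜 := ℝ) (fun J => Rφ ε (torusProj φ) J) (x := 0)
    rw [(hR ε (abs_le.1 hε)).1 (torusProj φ) 1 le_rfl, norm_zero, h1.fderiv] at h2
    exact norm_eq_zero.1 h2.symm
  ext1
  · exact hl
  · exact hr

/-- The derivative of `R_{ε,φ}` is Lipschitz and vanishes on the zero section, hence of order `s`
for actions of size `s`. -/
theorem SmallNonlinearity.norm_angle_sub_le (hR : SmallNonlinearity e K Rφ RJ)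
    (h : IsC2Family e K Rφ) (he : 0 < e) {ε : ℝ} (hε : |ε| ≤ e) {s : ℝ} (hs : s ≤ 1)
    {y y' : Cover d} (hy : ‖y.2‖ ≤ s) (hy' : ‖y'.2‖ ≤ s) :
    ‖familySlice Rφ ε y - familySlice Rφ ε y'‖ ≤ K * s * ‖y - y'‖ := by
  have := h.norm_slice_sub_le hε (convex_norm_snd_le s) (fun z hz => le_trans hz hs)
    (L := 0) (C := K * s) (fun z hz => ?_) hy hy'
  · simpa using this
  · have h1 := h.norm_spaceDeriv_sub_le he hε hε (y := z) (y' := (z.1, 0)) (le_trans hz hs)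
      (by simp)
    rw [hR.spaceDeriv_angle_eq_zero h hε] at h1
    have h2 : ‖z - (z.1, 0)‖ = ‖z.2‖ := by simp [Prod.norm_def]
    rw [sub_self, abs_zero, h2, max_eq_right (norm_nonneg _)] at h1
    exact h1.trans (mul_le_mul_of_nonneg_left hz (h.nonneg he))

/-- The derivative of `R_{ε,J}` is of order `s ^ 2` for actions of size `s`. -/
theorem SmallNonlinearity.norm_action_sub_le (hR : SmallNonlinearity e K Rφ RJ)
    (h : IsC2Family e K RJ) (he : 0 < e) {ε : ℝ} (hε : |ε| ≤ e) {s : ℝ} (hs : s ≤ 1)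
    {y y' : Cover d} (hy : ‖y.2‖ ≤ s) (hy' : ‖y'.2‖ ≤ s) :
    ‖familySlice RJ ε y - familySlice RJ ε y'‖ ≤ K * s ^ 2 * ‖y - y'‖ := by
  have := h.norm_slice_sub_le hε (convex_norm_snd_le s) (fun z hz => le_trans hz hs)
    (L := 0) (C := K * s ^ 2) (fun z hz => ?_) hy hy'
  · simpa using this
  · have hz1 : ‖z.2‖ ≤ 1 := le_trans hz hs
    have hm : z ∈ (univ ×ˢ actionCube d : Set (Cover d)) := ⟨trivial, mem_actionCube.2 hz1⟩
    have h1 := (hR ε (abs_le.1 hε)).2.2 z hm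
    have h2 := (h.hasFDerivWithinAt hε hz1).fderivWithin (uniqueDiffOn_annulusDomain d z hm)
    have h3 : ‖spaceDeriv e RJ ε z‖ ≤ K * ‖z.2‖ ^ 2 := by rw [← h2]; exact h1
    rw [sub_zero]
    exact h3.trans (mul_le_mul_of_nonneg_left (pow_le_pow_left₀ (norm_nonneg _) hz 2)
      (h.nonneg he))

theorem TransversalityTorsion.spaceDeriv_eq {A B : Matrix (Fin d) (Fin d) ℝ}
    {PJ : ℝ → Torus d → (Fin d → ℝ) → (Fin d → ℝ)} (hP : TransversalityTorsion A B PJ)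
    (h : IsC2Family e K PJ) (he : 0 < e) (v : Fin d → ℝ) :
    spaceDeriv e PJ 0 0 (v, 0) = B.mulVec v := by
  have h0 : HasFDerivAt (familySlice PJ 0) (spaceDeriv e PJ 0 0) ((0, 0) : Cover d) :=
    h.hasFDerivAt (by simpa using he.le) (by simp)
  have h1 : HasFDerivAt (fun φ : Fin d → ℝ => PJ 0 (torusProj φ) 0) _ 0 :=
    HasFDerivAt.comp (f := fun φ : Fin d → ℝ => (φ, (0 : Fin d → ℝ))) (0 : Fin d → ℝ) h0
      (hasFDerivAt_prodMk_left (0 : Fin d → ℝ) (0 : Fin d → ℝ))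
  have := h1.unique hP.2.1
  simpa using congrArg (fun L : (Fin d → ℝ) →L[ℝ] (Fin d → ℝ) => L v) this

theorem IsC2Family.contDiffOn_slice (h : IsC2Family e K F) {ε : ℝ} (hε : |ε| ≤ e) :
    ContDiffOn ℝ 2 (familySlice F ε) (univ ×ˢ actionCube d) :=
  h.1.comp (contDiff_const.prodMk contDiff_id).contDiffOn fun _ hy => ⟨abs_le.1 hε, hy⟩

theorem IsC2Family.norm_param_sub_le (h : IsC2Family e K F) (he : 0 < e) {ε ε' : ℝ}
    (hε : |ε| ≤ e) (hε' : |ε'| ≤ e) {y y' : Cover d} (hy : ‖y.2‖ ≤ 1) (hy' : ‖y'.2‖ ≤ 1) :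
    ‖familySlice F ε y - familySlice F ε' y'‖ ≤ K * max |ε - ε'| ‖y - y'‖ :=
  (convex_familyDomain d e).norm_image_sub_le_of_norm_fderivWithin_le
    (h.1.differentiableOn two_ne_zero) (fun _ hx => h.norm_fderivWithin_le he hx)
    (mem_familyDomain.2 ⟨hε', hy'⟩ : (ε', y') ∈ familyDomain d e)
    (mem_familyDomain.2 ⟨hε, hy⟩ : (ε, y) ∈ familyDomain d e)

end Estimates

/-! ### The generators in scaled coordinates -/

section Lifts

variable {d : ℕ} {A B : Matrix (Fin d) (Fin d) ℝ} {γ e K : ℝ}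

/-- A pair of families of maps satisfying all the assumptions, for given constants. -/
structure PerturbedPair (A B : Matrix (Fin d) (Fin d) ℝ) (γ e K : ℝ) where
  /-- The frequency of the unperturbed twist map. -/
  β : Fin d → ℝ
  /-- The angular nonlinearity of the twist map. -/
  Rφ : ℝ → Torus d → (Fin d → ℝ) → (Fin d → ℝ)
  /-- The nonlinearity of the twist map in the actions. -/
  RJ : ℝ → Torus d → (Fin d → ℝ) → (Fin d → ℝ)
  /-- The angular part of the kick. -/
  Pφ : ℝ → Torus d → (Fin d → ℝ) → (Fin d → ℝ)
  /-- The kick in the actions. -/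
  PJ : ℝ → Torus d → (Fin d → ℝ) → (Fin d → ℝ)
  constantType : IsConstantType γ β
  c2_Rφ : IsC2Family e K Rφ
  c2_RJ : IsC2Family e K RJ
  c2_Pφ : IsC2Family e K Pφ
  c2_PJ : IsC2Family e K PJ
  small : SmallNonlinearity e K Rφ RJ
  torsion : TransversalityTorsion A B PJ

namespace PerturbedPair

/-- The generators of the iterated function system. -/
noncomputable def ifs (X : PerturbedPair A B γ e K) (ε : ℝ) : Fin 2 → Phase d → Phase d :=
  ![twistMap X.β A X.Rφ X.RJ ε, kickMap X.Pφ X.PJ ε]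

/-- The lift of the twist map to the coordinates `(φ, j)`, where `J = ε j`. -/
noncomputable def twistLift (X : PerturbedPair A B γ e K) (ε : ℝ) (z : Cover d) : Cover d :=
  (z.1 + X.β + ε • A.mulVec z.2 + familySlice X.Rφ ε (z.1, ε • z.2),
    z.2 + ε⁻¹ • familySlice X.RJ ε (z.1, ε • z.2))

/-- The lift of the kick to the coordinates `(φ, j)`, where `J = ε j`. -/
noncomputable def kickLift (X : PerturbedPair A B γ e K) (ε : ℝ) (z : Cover d) : Cover d :=
  (z.1 + ε • familySlice X.Pφ ε (z.1, ε • z.2), z.2 + familySlice X.PJ ε (z.1, ε • z.2))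

end PerturbedPair

/-- The covering projection in the coordinates `(φ, j)`, where `J = ε j`. -/
def scaleProj (ε : ℝ) (z : Cover d) : Phase d := phaseProj (z.1, ε • z.2)

theorem torusProj_intCast (l : Fin d → ℤ) : torusProj (fun i => (l i : ℝ)) = 0 := by
  funext i
  exact (AddCircle.coe_eq_zero_iff 1).2 ⟨l i, by simp⟩

theorem torusProj_sub_intCast (φ : Fin d → ℝ) (l : Fin d → ℤ) :
    torusProj (φ - fun i => (l i : ℝ)) = torusProj φ := by
  have := torusProj_add (φ - fun i => (l i : ℝ)) (fun i => (l i : ℝ))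
  rwa [sub_add_cancel, torusProj_intCast, add_zero, eq_comm] at this

/-- The map `F` of `s` represents the composition of the word `w` in the coordinates `(φ, j)`. -/
structure LiftsOn {ι : Type*} (D : Set (Phase d)) (G : ι → Phase d → Phase d) (ε : ℝ)
    (w : List ι) (F : Cover d → Cover d) (s : Set (Cover d)) : Prop where
  dom : ∀ z ∈ s, scaleProj ε z ∈ wordDom D G w
  map : ∀ z ∈ s, wordMap G w (scaleProj ε z) = scaleProj ε (F z)
  smooth : ContDiffOn ℝ 1 F s

section

variable {ι : Type*} {D : Set (Phase d)} {G : ι → Phase d → Phase d} {ε : ℝ}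

theorem LiftsOn.nil (s : Set (Cover d)) : LiftsOn D G ε [] id s :=
  ⟨fun _ _ => trivial, fun _ _ => rfl, contDiffOn_id⟩

theorem LiftsOn.mono {w : List ι} {F : Cover d → Cover d} {s t : Set (Cover d)}
    (h : LiftsOn D G ε w F s) (hts : t ⊆ s) : LiftsOn D G ε w F t :=
  ⟨fun z hz => h.dom z (hts hz), fun z hz => h.map z (hts hz), h.smooth.mono hts⟩

theorem LiftsOn.comp {w w' : List ι} {F F' : Cover d → Cover d} {s s' : Set (Cover d)}
    (h' : LiftsOn D G ε w' F' s') (h : LiftsOn D G ε w F s) (hs : MapsTo F s s') :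
    LiftsOn D G ε (w ++ w') (F' ∘ F) s where
  dom z hz := (wordDom_append D G w w' _).2 ⟨h.dom z hz, by
    rw [h.map z hz]; exact h'.dom _ (hs hz)⟩
  map z hz := by rw [wordMap_append, h.map z hz, h'.map _ (hs hz)]; rfl
  smooth := h'.smooth.comp h.smooth hs

theorem LiftsOn.sub_intCast {w : List ι} {F : Cover d → Cover d} {s : Set (Cover d)}
    (h : LiftsOn D G ε w F s) (l : Fin d → ℤ) :
    LiftsOn D G ε w (fun z => F z - ((fun i => (l i : ℝ)), 0)) s where
  dom := h.dom
  map z hz := by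
    rw [h.map z hz, scaleProj, scaleProj, phaseProj, phaseProj]
    simp only [Prod.fst_sub, Prod.snd_sub, sub_zero, torusProj_sub_intCast]
  smooth := h.smooth.sub contDiffOn_const

end

theorem contDiffOn_scaled_slice {F : ℝ → Torus d → (Fin d → ℝ) → (Fin d → ℝ)}
    (h : IsC2Family e K F) {ε : ℝ} (hε : 0 < ε) (hεe : ε ≤ e) :
    ContDiffOn ℝ 1 (fun z : Cover d => familySlice F ε (z.1, ε • z.2)) {z | ε * ‖z.2‖ < 1} := by
  refine ((h.contDiffOn_slice (ε := ε) (by rwa [abs_of_pos hε])).of_le (by norm_num)).comp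
    (f := fun z : Cover d => (z.1, ε • z.2)) (by fun_prop) fun z hz => ⟨trivial, ?_⟩
  rw [mem_actionCube, norm_smul, Real.norm_of_nonneg hε.le]
  exact le_of_lt hz

theorem mem_annulus {z : Phase d} {r : ℝ} (hr : 0 ≤ r) : z ∈ annulus d r ↔ ‖z.2‖ ≤ r :=
  (pi_norm_le_iff_of_nonneg (x := z.2) hr).symm

namespace PerturbedPair

variable (X : PerturbedPair A B γ e K) {ε : ℝ}

theorem liftsOn_twist (hε : 0 < ε) (hεe : ε ≤ e) :
    LiftsOn (annulus d 1) (X.ifs ε) ε [0] (X.twistLift ε) {z | ε * ‖z.2‖ < 1} where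
  dom z hz := ⟨(mem_annulus zero_le_one).2 (by
    change ‖ε • z.2‖ ≤ 1
    rw [norm_smul, Real.norm_of_nonneg hε.le]; exact le_of_lt hz), trivial⟩
  map z hz := by
    change twistMap X.β A X.Rφ X.RJ ε (scaleProj ε z) = _
    refine Prod.ext ?_ ?_
    · simp only [twistMap, scaleProj, phaseProj, twistLift, familySlice, ← torusProj_add,
        Matrix.mulVec_smul, add_assoc]
    · simp only [twistMap, scaleProj, phaseProj, twistLift, familySlice, smul_add,
        smul_inv_smul₀ hε.ne']
  smooth := by
    have h1 := contDiffOn_scaled_slice X.c2_Rφ hε hεe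
    have h2 := contDiffOn_scaled_slice X.c2_RJ hε hεe
    have h3 : ContDiff ℝ 1 fun z : Cover d => A.mulVec z.2 :=
      (LinearMap.toContinuousLinearMap (Matrix.toLin' A)).contDiff.comp contDiff_snd
    exact (((contDiff_fst.add contDiff_const).add (h3.const_smul ε)).contDiffOn.add h1).prodMk
      (contDiff_snd.contDiffOn.add (h2.const_smul _))

theorem liftsOn_kick (hε : 0 < ε) (hεe : ε ≤ e) :
    LiftsOn (annulus d 1) (X.ifs ε) ε [1] (X.kickLift ε) {z | ε * ‖z.2‖ < 1} where
  dom z hz := ⟨(mem_annulus zero_le_one).2 (by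
    change ‖ε • z.2‖ ≤ 1
    rw [norm_smul, Real.norm_of_nonneg hε.le]; exact le_of_lt hz), trivial⟩
  map z hz := by
    change kickMap X.Pφ X.PJ ε (scaleProj ε z) = _
    refine Prod.ext ?_ ?_
    · simp only [kickMap, scaleProj, phaseProj, kickLift, familySlice, ← torusProj_add]
    · simp only [kickMap, scaleProj, phaseProj, kickLift, familySlice, smul_add]
  smooth := by
    have h1 := contDiffOn_scaled_slice X.c2_Pφ hε hεe
    have h2 := contDiffOn_scaled_slice X.c2_PJ hε hεe
    exact (contDiff_fst.contDiffOn.add (h1.const_smul _)).prodMk (contDiff_snd.contDiffOn.add h2)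

theorem twistLift_zero_section (hε : 0 < ε) (hεe : ε ≤ e) (φ : Fin d → ℝ) :
    X.twistLift ε (φ, 0) = (φ + X.β, 0) := by
  have h : |ε| ≤ e := by rwa [abs_of_pos hε]
  simp [twistLift, familySlice, X.small.angle_eq_zero h, X.small.action_eq_zero h]

theorem iterate_twistLift_zero_section (hε : 0 < ε) (hεe : ε ≤ e) (φ : Fin d → ℝ) (k : ℕ) :
    (X.twistLift ε)^[k] (φ, 0) = (φ + (k : ℝ) • X.β, 0) := by
  induction k with
  | zero => simp
  | succ k ih =>
    rw [Function.iterate_succ_apply', ih, X.twistLift_zero_section hε hεe]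
    push_cast
    rw [add_smul, one_smul, add_assoc]

theorem norm_scale_le {ε : ℝ} (hε : 0 ≤ ε) (hε1 : ε ≤ 1) (z : Cover d) :
    ‖((z.1, ε • z.2) : Cover d)‖ ≤ ‖z‖ := by
  refine max_le (norm_fst_le z) ?_
  change ‖ε • z.2‖ ≤ ‖z‖
  rw [norm_smul, Real.norm_of_nonneg hε]
  exact (mul_le_of_le_one_left (norm_nonneg _) hε1).trans (norm_snd_le z)

/-- Up to an error of small Lipschitz constant, the twist map is a shear. -/
theorem norm_twistLift_sub_le (he : 0 < e) (hε : 0 < ε) (hεe : ε ≤ e) (hε1 : ε ≤ 1) {R : ℝ}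
    (hR : R ≤ 1) {z w : Cover d} (hz : ‖z.2‖ ≤ R) (hw : ‖w.2‖ ≤ R) :
    ‖X.twistLift ε z - X.twistLift ε w - (z - w) - (ε • A.mulVec (z.2 - w.2), 0)‖ ≤
      K * (ε * R) * ‖z - w‖ := by
  have hK := X.c2_Rφ.nonneg he
  have hεa : |ε| ≤ e := by rwa [abs_of_pos hε]
  have hR0 : 0 ≤ R := (norm_nonneg _).trans hz
  have hsc : ∀ {z : Cover d}, ‖z.2‖ ≤ R → ‖((z.1, ε • z.2) : Cover d).2‖ ≤ ε * R := by
    intro z hz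
    change ‖ε • z.2‖ ≤ _
    rw [norm_smul, Real.norm_of_nonneg hε.le]
    gcongr
  have hεR : ε * R ≤ 1 := mul_le_one₀ hε1 hR0 hR
  have hd : ‖((z.1, ε • z.2) : Cover d) - (w.1, ε • w.2)‖ ≤ ‖z - w‖ := by
    have := norm_scale_le hε.le hε1 (z - w)
    rwa [Prod.fst_sub, Prod.snd_sub, smul_sub] at this
  have h1 := X.small.norm_angle_sub_le X.c2_Rφ he hεa hεR (hsc hz) (hsc hw)
  have h2 := X.small.norm_action_sub_le X.c2_RJ he hεa hεR (hsc hz) (hsc hw)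
  have e1 : X.twistLift ε z - X.twistLift ε w - (z - w) - (ε • A.mulVec (z.2 - w.2), 0) =
      (familySlice X.Rφ ε (z.1, ε • z.2) - familySlice X.Rφ ε (w.1, ε • w.2),
        ε⁻¹ • (familySlice X.RJ ε (z.1, ε • z.2) - familySlice X.RJ ε (w.1, ε • w.2))) := by
    refine Prod.ext ?_ ?_
    · simp only [twistLift, Prod.fst_sub, Matrix.mulVec_sub, smul_sub]; abel
    · simp only [twistLift, Prod.snd_sub, smul_sub]; abel
  rw [e1]
  refine max_le (h1.trans (by gcongr)) ?_
  change ‖ε⁻¹ • _‖ ≤ _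
  rw [norm_smul, norm_inv, Real.norm_of_nonneg hε.le, inv_mul_le_iff₀ hε]
  calc _ ≤ K * (ε * R) ^ 2 * ‖((z.1, ε • z.2) : Cover d) - (w.1, ε • w.2)‖ := h2
    _ ≤ K * (ε * (ε * R)) * ‖z - w‖ := by
      have : (ε * R) ^ 2 ≤ ε * (ε * R) := by
        rw [pow_two]
        exact mul_le_mul_of_nonneg_right (mul_le_of_le_one_right hε.le hR) (by positivity)
      gcongr
    _ = _ := by ring

theorem norm_snd_twistLift_le (he : 0 < e) (hε : 0 < ε) (hεe : ε ≤ e) (hε1 : ε ≤ 1) {R : ℝ}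
    (hR : R ≤ 1) {z : Cover d} (hz : ‖z.2‖ ≤ R) :
    ‖(X.twistLift ε z).2‖ ≤ (1 + K * (ε * R)) * ‖z.2‖ := by
  have h := X.norm_twistLift_sub_le he hε hεe hε1 hR (w := (z.1, 0)) hz
    (by simpa using (norm_nonneg _).trans hz)
  have h2 := (norm_snd_le _).trans h
  rw [X.twistLift_zero_section hε hεe] at h2
  have h3 : ‖z - (z.1, 0)‖ = ‖z.2‖ := by simp [Prod.norm_def]
  rw [h3] at h2
  simp only [Prod.snd_sub, sub_zero] at h2
  have h4 := norm_add_le z.2 ((X.twistLift ε z).2 - z.2)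
  rw [add_sub_cancel] at h4
  linarith

/-- Along a number of iterations of order `1 / ε`, the actions grow at most by the factor two. -/
theorem norm_snd_iterate_twistLift_le (he : 0 < e) (hε : 0 < ε) (hεe : ε ≤ e) (hε1 : ε ≤ 1)
    {R t : ℝ} (hR0 : 0 ≤ R) (hR : R ≤ 1) (ht : K * R * t ≤ 1 / 2) {z : Cover d}
    (hz : ‖z.2‖ ≤ R / 2) (k : ℕ) (hk : k * ε ≤ t) :
    ‖((X.twistLift ε)^[k] z).2‖ ≤ 2 * ‖z.2‖ := by
  have hK := X.c2_Rφ.nonneg he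
  have hexp : ∀ k : ℕ, k * ε ≤ t → (1 + K * (ε * R)) ^ k ≤ 2 := by
    intro k hk
    have h1 : (1 + K * (ε * R)) ^ k ≤ Real.exp (K * R * (k * ε)) := by
      have := pow_le_pow_left₀ (by positivity) (Real.add_one_le_exp (K * (ε * R))) k
      have e1 : (k : ℝ) * (K * (ε * R)) = K * R * (k * ε) := by ring
      rwa [← Real.exp_nat_mul, add_comm (K * (ε * R)), e1] at this
    refine h1.trans ?_
    have h2 : K * R * (k * ε) ≤ 1 / 2 := (mul_le_mul_of_nonneg_left hk (by positivity)).trans ht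
    refine (Real.exp_le_exp.2 h2).trans ?_
    have h3 := Real.exp_bound_div_one_sub_of_interval (x := 1 / 2) (by norm_num) (by norm_num)
    norm_num at h3 ⊢
    linarith
  have key : ∀ k : ℕ, k * ε ≤ t →
      ‖((X.twistLift ε)^[k] z).2‖ ≤ (1 + K * (ε * R)) ^ k * ‖z.2‖ := by
    intro k
    induction k with
    | zero => intro _; simp
    | succ k ih =>
      intro hk
      have hk' : k * ε ≤ t := by
        refine le_trans ?_ hk
        push_cast
        nlinarith
      have h1 := ih hk'
      have h2 : ‖((X.twistLift ε)^[k] z).2‖ ≤ R := by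
        refine h1.trans ((mul_le_mul_of_nonneg_right (hexp k hk') (norm_nonneg _)).trans ?_)
        linarith
      rw [Function.iterate_succ_apply', pow_succ]
      calc _ ≤ (1 + K * (ε * R)) * ‖((X.twistLift ε)^[k] z).2‖ :=
            X.norm_snd_twistLift_le he hε hεe hε1 hR h2
        _ ≤ (1 + K * (ε * R)) * ((1 + K * (ε * R)) ^ k * ‖z.2‖) := by gcongr
        _ = _ := by ring
  exact (key k hk).trans (mul_le_mul_of_nonneg_right (hexp k hk) (norm_nonneg _))

/-- For a number of iterations of order `1 / ε`, the iterated twist map is a shear of order one, up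
to an error whose Lipschitz constant is of the order of the size `R` of the actions. -/
theorem norm_iterate_twistLift_sub_le (he : 0 < e) (hε : 0 < ε) (hεe : ε ≤ e) (hε1 : ε ≤ 1)
    {R t a : ℝ} (hR0 : 0 ≤ R) (hR : R ≤ 1) (ht : K * R * t ≤ 1 / 2) (ha0 : 0 ≤ a)
    (ha : ∀ v, ‖A.mulVec v‖ ≤ a * ‖v‖) {z w : Cover d} (hz : ‖z.2‖ ≤ R / 2) (hw : ‖w.2‖ ≤ R / 2)
    (k : ℕ) (hk : k * ε ≤ t) :
    ‖(X.twistLift ε)^[k] z - (X.twistLift ε)^[k] w - (z - w) -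
        ((k * ε) • A.mulVec (z.2 - w.2), 0)‖ ≤
      t * K * (1 + t * a) * Real.exp (t * (a + K)) * R * ‖z - w‖ := by
  have hK := X.c2_Rφ.nonneg he
  have ht0 : 0 ≤ t := le_trans (by positivity) hk
  set q : ℝ := 1 + ε * (a + K) with hq
  have hq1 : 1 ≤ q := by rw [hq]; linarith [mul_nonneg hε.le (add_nonneg ha0 hK)]
  set b : ℝ := ε * K * R * (1 + t * a) with hb
  have hb0 : 0 ≤ b := by positivity
  have key : ∀ k : ℕ, k * ε ≤ t →
      ‖(X.twistLift ε)^[k] z - (X.twistLift ε)^[k] w - (z - w) -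
        ((k * ε) • A.mulVec (z.2 - w.2), 0)‖ ≤ k * b * q ^ k * ‖z - w‖ := by
    intro k
    induction k with
    | zero => intro _; simp
    | succ k ih =>
      intro hk
      have hk' : k * ε ≤ t := by
        refine le_trans ?_ hk
        push_cast
        nlinarith
      have h0 := ih hk'
      have hzk := X.norm_snd_iterate_twistLift_le he hε hεe hε1 hR0 hR ht hz k hk'
      have hwk := X.norm_snd_iterate_twistLift_le he hε hεe hε1 hR0 hR ht hw k hk'
      have h1 := X.norm_twistLift_sub_le he hε hεe hε1 hR (hzk.trans (by linarith))
        (hwk.trans (by linarith))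
      rw [Function.iterate_succ_apply', Function.iterate_succ_apply']
      set z' := (X.twistLift ε)^[k] z
      set w' := (X.twistLift ε)^[k] w
      -- A discrete Grönwall argument for the error `E`.
      set E := z' - w' - (z - w) - ((k * ε) • A.mulVec (z.2 - w.2), 0) with hE
      have hE2 : (z'.2 - w'.2) - (z.2 - w.2) = E.2 := by simp [hE]
      have hsum : X.twistLift ε z' - X.twistLift ε w' - (z - w) -
          ((((k + 1 : ℕ) : ℝ) * ε) • A.mulVec (z.2 - w.2), 0) =
          E + (ε • A.mulVec E.2, 0) + (X.twistLift ε z' - X.twistLift ε w' - (z' - w') -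
            (ε • A.mulVec (z'.2 - w'.2), 0)) := by
        rw [← hE2, hE]
        refine Prod.ext ?_ ?_
        · simp only [Prod.fst_sub, Prod.fst_add, Matrix.mulVec_sub, smul_sub, Nat.cast_succ,
            add_mul, one_mul, add_smul]
          abel
        · simp only [Prod.snd_sub, Prod.snd_add]
          abel
      have hA : ∀ v : Fin d → ℝ, ‖((ε • A.mulVec v, 0) : Cover d)‖ ≤ ε * a * ‖v‖ := by
        intro v
        refine max_le ?_ (by simp; positivity)
        change ‖ε • A.mulVec v‖ ≤ _
        rw [norm_smul, Real.norm_of_nonneg hε.le, mul_assoc]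
        exact mul_le_mul_of_nonneg_left (ha v) hε.le
      have hd : ‖z' - w'‖ ≤ ‖E‖ + (1 + t * a) * ‖z - w‖ := by
        have e1 : z' - w' = E + (z - w) + ((k * ε) • A.mulVec (z.2 - w.2), 0) := by
          rw [hE]; abel
        have e2 : ‖(((k * ε) • A.mulVec (z.2 - w.2), 0) : Cover d)‖ ≤ t * a * ‖z - w‖ := by
          refine max_le ?_ (by simp; positivity)
          change ‖((k : ℝ) * ε) • A.mulVec (z.2 - w.2)‖ ≤ _
          rw [norm_smul, Real.norm_of_nonneg (by positivity), mul_assoc t a]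
          have h2 : ‖A.mulVec (z.2 - w.2)‖ ≤ a * ‖z - w‖ :=
            (ha _).trans (mul_le_mul_of_nonneg_left (norm_snd_le (z - w)) ha0)
          exact mul_le_mul hk' h2 (norm_nonneg _) ht0
        rw [e1]
        refine (norm_add₃_le).trans ?_
        linarith
      rw [hsum]
      calc _ ≤ ‖E‖ + ε * a * ‖E‖ + K * (ε * R) * ‖z' - w'‖ := by
            refine (norm_add₃_le).trans (add_le_add (add_le_add le_rfl ?_) h1)
            exact (hA _).trans (mul_le_mul_of_nonneg_left (norm_snd_le E) (by positivity))
        _ ≤ ‖E‖ + ε * a * ‖E‖ + K * (ε * R) * (‖E‖ + (1 + t * a) * ‖z - w‖) := by gcongr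
        _ = (1 + ε * a + ε * K * R) * ‖E‖ + b * ‖z - w‖ := by rw [hb]; ring
        _ ≤ q * ‖E‖ + b * ‖z - w‖ := by
          have : ε * K * R ≤ ε * K := mul_le_of_le_one_right (by positivity) hR
          gcongr
          rw [hq]; linarith
        _ ≤ q * (k * b * q ^ k * ‖z - w‖) + b * ‖z - w‖ * q ^ (k + 1) := by
          have h2 : b * ‖z - w‖ ≤ b * ‖z - w‖ * q ^ (k + 1) :=
            le_mul_of_one_le_right (by positivity) (one_le_pow₀ hq1)
          gcongr
        _ = _ := by push_cast; ring
  refine (key k hk).trans ?_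
  have h1 : q ^ k ≤ Real.exp (t * (a + K)) := by
    have := pow_le_pow_left₀ (by positivity) (Real.add_one_le_exp (ε * (a + K))) k
    rw [← Real.exp_nat_mul, add_comm (ε * (a + K))] at this
    refine this.trans (Real.exp_le_exp.2 ?_)
    rw [← mul_assoc]
    gcongr
  calc (k : ℝ) * b * q ^ k * ‖z - w‖ = (k * ε) * K * (1 + t * a) * q ^ k * R * ‖z - w‖ := by
        rw [hb]; ring
    _ ≤ _ := by gcongr

/-- Near the centre, the kick is close to the linear kick. -/
theorem norm_kickLift_sub_le (he : 0 < e) (hε : 0 < ε) (hεe : ε ≤ e) (hε1 : ε ≤ 1) {R : ℝ}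
    (hR : R ≤ 1) {z w : Cover d} (hz : ‖z‖ ≤ R) (hw : ‖w‖ ≤ R) :
    ‖X.kickLift ε z - X.kickLift ε w - (z - w) - (0, B.mulVec (z.1 - w.1))‖ ≤
      K * (R + 2 * ε) * ‖z - w‖ := by
  have hK := X.c2_Rφ.nonneg he
  have hεa : |ε| ≤ e := by rwa [abs_of_pos hε]
  have h0a : |(0 : ℝ)| ≤ e := by simpa using he.le
  have hR0 : 0 ≤ R := (norm_nonneg _).trans hz
  have hsc : ∀ {z : Cover d}, ‖z‖ ≤ R → ((z.1, ε • z.2) : Cover d) ∈ Metric.closedBall 0 R :=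
    fun h => mem_closedBall_zero_iff.2 ((norm_scale_le hε.le hε1 _).trans h)
  have hball : ∀ y ∈ Metric.closedBall (0 : Cover d) R, ‖y.2‖ ≤ 1 := fun y hy =>
    (norm_snd_le y).trans ((mem_closedBall_zero_iff.1 hy).trans hR)
  have hd : ‖((z.1, ε • z.2) : Cover d) - (w.1, ε • w.2)‖ ≤ ‖z - w‖ := by
    have := norm_scale_le hε.le hε1 (z - w)
    rwa [Prod.fst_sub, Prod.snd_sub, smul_sub] at this
  have h1 := X.c2_Pφ.norm_slice_sub_le hεa (convex_closedBall (0 : Cover d) R) hball (L := 0)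
    (C := K) (fun y hy => by rw [sub_zero]; exact X.c2_Pφ.norm_spaceDeriv_le he hεa (hball y hy))
    (hsc hz) (hsc hw)
  have h2 := X.c2_PJ.norm_slice_sub_le hεa (convex_closedBall (0 : Cover d) R) hball
    (L := spaceDeriv e X.PJ 0 0) (C := K * (R + ε)) (fun y hy => by
      refine (X.c2_PJ.norm_spaceDeriv_sub_le he hεa h0a (hball y hy) (by simp)).trans ?_
      gcongr
      have := mem_closedBall_zero_iff.1 hy
      rw [sub_zero, sub_zero, abs_of_pos hε]
      exact max_le (by linarith) (by linarith)) (hsc hz) (hsc hw)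
  set L := spaceDeriv e X.PJ 0 0 with hL
  have hLn : ‖L‖ ≤ K := X.c2_PJ.norm_spaceDeriv_le he h0a (by simp)
  have hLs : L ((z.1, ε • z.2) - (w.1, ε • w.2)) =
      B.mulVec (z.1 - w.1) + L (0, ε • (z.2 - w.2)) := by
    rw [← X.torsion.spaceDeriv_eq X.c2_PJ he, ← hL, ← map_add L]
    congr 1
    simp [smul_sub]
  have hL2 : ‖L (0, ε • (z.2 - w.2))‖ ≤ K * ε * ‖z - w‖ := by
    refine (L.le_of_opNorm_le hLn _).trans ?_
    have : ‖((0, ε • (z.2 - w.2)) : Cover d)‖ ≤ ε * ‖z - w‖ := by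
      refine max_le (by simp; positivity) ?_
      change ‖ε • (z.2 - w.2)‖ ≤ _
      rw [norm_smul, Real.norm_of_nonneg hε.le]
      exact mul_le_mul_of_nonneg_left (norm_snd_le (z - w)) hε.le
    rw [mul_assoc]
    gcongr
  have e1 : X.kickLift ε z - X.kickLift ε w - (z - w) - (0, B.mulVec (z.1 - w.1)) =
      (ε • (familySlice X.Pφ ε (z.1, ε • z.2) - familySlice X.Pφ ε (w.1, ε • w.2)),
        (familySlice X.PJ ε (z.1, ε • z.2) - familySlice X.PJ ε (w.1, ε • w.2) -
          L ((z.1, ε • z.2) - (w.1, ε • w.2))) + L (0, ε • (z.2 - w.2))) := by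
    rw [hLs]
    refine Prod.ext ?_ ?_
    · simp only [kickLift, Prod.fst_sub, smul_sub]; abel
    · simp only [kickLift, Prod.snd_sub]; abel
  rw [e1]
  refine max_le ?_ ?_
  · change ‖ε • _‖ ≤ _
    rw [_root_.zero_apply, sub_zero] at h1
    rw [norm_smul, Real.norm_of_nonneg hε.le]
    calc _ ≤ ε * (K * ‖z - w‖) := by gcongr; exact h1.trans (by gcongr)
      _ = K * ε * ‖z - w‖ := by ring
      _ ≤ _ := by gcongr; linarith
  · refine (norm_add_le _ _).trans ?_
    calc _ ≤ K * (R + ε) * ‖z - w‖ + K * ε * ‖z - w‖ := by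
          gcongr; exact h2.trans (by gcongr)
      _ = _ := by ring

theorem norm_kickLift_zero_le (he : 0 < e) (hε : 0 < ε) (hεe : ε ≤ e) :
    ‖X.kickLift ε 0‖ ≤ K * ε := by
  have hεa : |ε| ≤ e := by rwa [abs_of_pos hε]
  have h0a : |(0 : ℝ)| ≤ e := by simpa using he.le
  have h1 : ‖familySlice X.Pφ ε 0‖ ≤ K :=
    X.c2_Pφ.norm_le (x := (ε, 0)) (mem_familyDomain.2 ⟨hεa, by simp⟩)
  have h2 := X.c2_PJ.norm_param_sub_le he hεa h0a (y := 0) (y' := 0) (by simp) (by simp)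
  have h3 : familySlice X.PJ 0 0 = 0 := by
    have : torusProj (0 : Fin d → ℝ) = 0 := by funext i; simp [torusProj]
    change X.PJ 0 (torusProj 0) 0 = 0
    rw [this]
    exact X.torsion.1
  rw [h3, sub_zero, sub_zero, sub_zero, norm_zero, abs_of_pos hε, max_eq_left hε.le] at h2
  have e1 : X.kickLift ε 0 = (ε • familySlice X.Pφ ε 0, familySlice X.PJ ε 0) := by
    simp only [kickLift, Prod.fst_zero, Prod.snd_zero, smul_zero, zero_add, Prod.mk_zero_zero]
  rw [e1]
  refine max_le ?_ h2
  change ‖ε • _‖ ≤ _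
  rw [norm_smul, Real.norm_of_nonneg hε.le, mul_comm]
  gcongr

end PerturbedPair

end Lifts

/-! ### Affine models of long words -/

section AffineLifts

variable {d : ℕ} {A B : Matrix (Fin d) (Fin d) ℝ} {γ e K : ℝ}

/-- The shear `(φ, j) ↦ (φ + s A j, j)`. -/
noncomputable def shearMap (A : Matrix (Fin d) (Fin d) ℝ) (s : ℝ) : Cover d →L[ℝ] Cover d :=
  ContinuousLinearMap.id ℝ _ + (ContinuousLinearMap.inl ℝ _ _).comp
    ((s • LinearMap.toContinuousLinearMap (Matrix.toLin' A)).comp (ContinuousLinearMap.snd ℝ _ _))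

/-- The linear kick `(φ, j) ↦ (φ, j + s B φ)`. -/
noncomputable def linearKick (B : Matrix (Fin d) (Fin d) ℝ) (s : ℝ) : Cover d →L[ℝ] Cover d :=
  ContinuousLinearMap.id ℝ _ + (ContinuousLinearMap.inr ℝ _ _).comp
    ((s • LinearMap.toContinuousLinearMap (Matrix.toLin' B)).comp (ContinuousLinearMap.fst ℝ _ _))

theorem shearMap_apply (s : ℝ) (z : Cover d) :
    shearMap A s z = (z.1 + s • A.mulVec z.2, z.2) := by
  refine Prod.ext ?_ ?_ <;> simp [shearMap]

theorem linearKick_apply (s : ℝ) (z : Cover d) :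
    linearKick B s z = (z.1, z.2 + s • B.mulVec z.1) := by
  refine Prod.ext ?_ ?_ <;> simp [linearKick]

/-- The map `F` of the ball of radius `r` represents the composition of the word `w` in the
coordinates `(φ, j)`, and it is close to the affine map `z ↦ M z + v`: up to the constant `c`, the
vector `v` is of order `ρ`, the error at the centre of order `ρ²`, and the Lipschitz constant of the
error of order `ρ`. -/
structure IsAffineLift {ι : Type*} (D : Set (Phase d)) (G : ι → Phase d → Phase d) (ε : ℝ)
    (w : List ι) (F : Cover d → Cover d) (M : Cover d →L[ℝ] Cover d) (v : Cover d)
    (c ρ r : ℝ) : Prop where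
  lifts : LiftsOn D G ε w F (Metric.ball 0 r)
  norm_le : ‖M‖ ≤ c
  vec_le : ‖v‖ ≤ c * ρ
  lip : ∀ z z', ‖z‖ < r → ‖z'‖ < r → ‖F z - F z' - M (z - z')‖ ≤ c * ρ * ‖z - z'‖
  zero : ‖F 0 - v‖ ≤ c * ρ ^ 2

section

variable {ι : Type*} {D : Set (Phase d)} {G : ι → Phase d → Phase d} {ε : ℝ}
  {w w' : List ι} {F F' : Cover d → Cover d} {M M' : Cover d →L[ℝ] Cover d} {v v' : Cover d}
  {c c' ρ r r' : ℝ}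

theorem IsAffineLift.mono (h : IsAffineLift D G ε w F M v c ρ r) (hρ : 0 ≤ ρ) (hc : c ≤ c') :
    IsAffineLift D G ε w F M v c' ρ r where
  lifts := h.lifts
  norm_le := h.norm_le.trans hc
  vec_le := h.vec_le.trans (by gcongr)
  lip z z' hz hz' := (h.lip z z' hz hz').trans (by gcongr)
  zero := h.zero.trans (by gcongr)

theorem IsAffineLift.norm_apply_sub_le (h : IsAffineLift D G ε w F M v c ρ r) {z : Cover d}
    (hz : ‖z‖ < r) : ‖F z - (M z + v)‖ ≤ c * ρ * ‖z‖ + c * ρ ^ 2 := by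
  have h1 := h.lip z 0 hz (by simpa using (norm_nonneg _).trans_lt hz)
  rw [sub_zero] at h1
  calc ‖F z - (M z + v)‖ = ‖(F z - F 0 - M z) + (F 0 - v)‖ := by congr 1; abel
    _ ≤ _ := (norm_add_le _ _).trans (add_le_add h1 h.zero)

theorem IsAffineLift.norm_apply_le (h : IsAffineLift D G ε w F M v c ρ r) (hc : 0 ≤ c)
    (hρ : 0 ≤ ρ) (hρ1 : ρ ≤ 1) {z : Cover d} (hz : ‖z‖ < r) :
    ‖F z‖ ≤ 2 * c * ‖z‖ + 2 * c * ρ := by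
  have h1 := h.norm_apply_sub_le hz
  have h2 : ‖M z + v‖ ≤ c * ‖z‖ + c * ρ :=
    (norm_add_le _ _).trans (add_le_add (M.le_of_opNorm_le h.norm_le _) h.vec_le)
  have h3 := norm_add_le (F z - (M z + v)) (M z + v)
  rw [sub_add_cancel] at h3
  have h4 : c * ρ * ‖z‖ ≤ c * ‖z‖ := by
    rw [mul_assoc]
    exact mul_le_mul_of_nonneg_left (mul_le_of_le_one_left (norm_nonneg _) hρ1) hc
  have h5 : c * ρ ^ 2 ≤ c * ρ := by
    rw [pow_two]
    exact mul_le_mul_of_nonneg_left (mul_le_of_le_one_left hρ hρ1) hc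
  linarith

/-- Compositions of affine models are affine models with the composed linear part; the orders in `ρ`
of the errors are preserved. -/
theorem IsAffineLift.comp (h' : IsAffineLift D G ε w' F' M' v' c' ρ r')
    (h : IsAffineLift D G ε w F M v c ρ r) (hc : 1 ≤ c) (hc' : 1 ≤ c') (hρ : 0 < ρ) (hρ1 : ρ ≤ 1)
    (hr : 0 < r) (hr' : 2 * c * r + 2 * c * ρ ≤ r') :
    IsAffineLift D G ε (w ++ w') (F' ∘ F) (M'.comp M) (M' v + v') (4 * c * c') ρ r := by
  have hmaps : ∀ z, ‖z‖ < r → ‖F z‖ < r' := fun z hz => by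
    have := h.norm_apply_le (by linarith) hρ.le hρ1 hz
    have h2 : 2 * c * ‖z‖ < 2 * c * r := by gcongr
    linarith
  have hr0' : 0 < r' := lt_of_lt_of_le (by positivity) hr'
  have hcc : 0 ≤ c * c' := by positivity
  have hc1 : c' ≤ c * c' := by nlinarith
  refine ⟨h'.lifts.comp h.lifts fun z hz => ?_, ?_, ?_, fun z z' hz hz' => ?_, ?_⟩
  · simpa using hmaps z (by simpa using hz)
  · refine (ContinuousLinearMap.opNorm_comp_le _ _).trans ?_
    have := mul_le_mul h'.norm_le h.norm_le (norm_nonneg _) (by linarith)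
    linarith
  · refine (norm_add_le _ _).trans ?_
    have h1 : ‖M' v‖ ≤ c' * (c * ρ) :=
      (M'.le_of_opNorm_le h'.norm_le _).trans (mul_le_mul_of_nonneg_left h.vec_le (by linarith))
    have h2 : c' * ρ ≤ c * c' * ρ := by gcongr
    have h3 : 0 ≤ c * c' * ρ := by positivity
    linarith [h'.vec_le]
  · have h1 := h'.lip _ _ (hmaps z hz) (hmaps z' hz')
    have h2 := h.lip z z' hz hz'
    have h3 : ‖F z - F z'‖ ≤ 2 * c * ‖z - z'‖ := by
      have e1 := norm_add_le (F z - F z' - M (z - z')) (M (z - z'))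
      rw [sub_add_cancel] at e1
      have e2 := M.le_of_opNorm_le h.norm_le (z - z')
      have e3 : c * ρ * ‖z - z'‖ ≤ c * ‖z - z'‖ := by
        gcongr
        exact mul_le_of_le_one_right (by linarith) hρ1
      linarith
    have e1 : (F' ∘ F) z - (F' ∘ F) z' - (M'.comp M) (z - z') =
        (F' (F z) - F' (F z') - M' (F z - F z')) + M' (F z - F z' - M (z - z')) := by
      rw [map_sub M' (F z - F z')]
      simp only [Function.comp_apply, ContinuousLinearMap.comp_apply]
      abel
    rw [e1]
    refine (norm_add_le _ _).trans ?_
    calc _ ≤ c' * ρ * (2 * c * ‖z - z'‖) + c' * (c * ρ * ‖z - z'‖) := by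
          refine add_le_add (h1.trans (by gcongr)) ((M'.le_of_opNorm_le h'.norm_le _).trans ?_)
          gcongr
      _ = 3 * (c * c' * ρ * ‖z - z'‖) := by ring
      _ ≤ 4 * (c * c' * ρ * ‖z - z'‖) := by gcongr; norm_num
      _ = _ := by ring
  · have h0 : ‖(0 : Cover d)‖ < r := by simpa using hr
    have h1 := h'.lip (F 0) 0 (hmaps 0 h0) (by simpa using hr0')
    have h2 : ‖F 0‖ ≤ 2 * c * ρ := by
      simpa using h.norm_apply_le (by linarith) hρ.le hρ1 h0
    have e1 : (F' ∘ F) 0 - (M' v + v') =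
        (F' (F 0) - F' 0 - M' (F 0 - 0)) + M' (F 0 - v) + (F' 0 - v') := by
      rw [map_sub M' (F 0) v, sub_zero]
      simp only [Function.comp_apply]
      abel
    rw [sub_zero] at h1 e1
    rw [e1]
    refine (norm_add₃_le).trans ?_
    calc _ ≤ c' * ρ * (2 * c * ρ) + c' * (c * ρ ^ 2) + c * c' * ρ ^ 2 := by
          refine add_le_add (add_le_add (h1.trans (by gcongr))
            ((M'.le_of_opNorm_le h'.norm_le _).trans ?_)) (h'.zero.trans (by gcongr))
          have := h.zero
          gcongr
      _ = _ := by ring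

end

theorem eventually_pos_le {c : ℝ} (hc : 0 < c) : ∀ᶠ x in 𝓝[>] (0 : ℝ), 0 < x ∧ x ≤ c :=
  Ioc_mem_nhdsGT hc

namespace PerturbedPair

theorem liftsOn_iterate_twist (X : PerturbedPair A B γ e K) {ε : ℝ} (he : 0 < e) (hε : 0 < ε)
    (hεe : ε ≤ e) (hε1 : ε ≤ 1) {R t : ℝ} (hR0 : 0 ≤ R) (hR : R ≤ 1) (ht : K * R * t ≤ 1 / 2)
    (k : ℕ) (hk : k * ε ≤ t) :
    LiftsOn (annulus d 1) (X.ifs ε) ε (List.replicate k 0) (X.twistLift ε)^[k]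
      {z | ‖z.2‖ < R / 2} := by
  induction k with
  | zero => exact LiftsOn.nil _
  | succ k ih =>
    have hk' : k * ε ≤ t := by
      refine le_trans ?_ hk
      push_cast
      nlinarith
    rw [List.replicate_succ', Function.iterate_succ']
    refine (X.liftsOn_twist hε hεe).comp (ih hk') fun z hz => ?_
    have hz' : ‖z.2‖ < R / 2 := hz
    have := X.norm_snd_iterate_twistLift_le he hε hεe hε1 hR0 hR ht hz'.le k hk'
    change ε * ‖_‖ < 1
    refine lt_of_le_of_lt (mul_le_of_le_one_left (norm_nonneg _) hε1) ?_
    linarith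

/-- A number of order `1 / ε` of iterations of the twist map is close to a shear followed by a
translation. -/
theorem isAffineLift_twist (A B : Matrix (Fin d) (Fin d) ℝ) (γ : ℝ) {e : ℝ} (he : 0 < e) (K : ℝ)
    {s a b : ℝ} (hs : 0 ≤ s) (ha : 0 < a) (hb : 0 ≤ b) :
    ∃ c : ℝ, 1 ≤ c ∧ ∀ᶠ ρ in 𝓝[>] (0 : ℝ), ∀ N : ℕ, ∀ᶠ ε in 𝓝[>] (0 : ℝ),
      ∀ X : PerturbedPair A B γ e K, ∀ m : ℕ, s / ε ≤ m → m ≤ s / ε + N + 1 →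
      ∀ (l : Fin d → ℤ) (θ : Fin d → ℝ), ‖θ‖ ≤ b * ρ →
      ‖(m : ℝ) • X.β - (fun i => (l i : ℝ)) - θ‖ ≤ ρ ^ 2 →
      IsAffineLift (annulus d 1) (X.ifs ε) ε (List.replicate m 0)
        (fun z => (X.twistLift ε)^[m] z - ((fun i => (l i : ℝ)), 0)) (shearMap A s) (θ, 0) c ρ
        (a * ρ) := by
  set α := ‖LinearMap.toContinuousLinearMap (Matrix.toLin' A)‖ with hα
  have hα0 : 0 ≤ α := norm_nonneg _
  have hαA : ∀ v, ‖A.mulVec v‖ ≤ α * ‖v‖ := fun v =>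
    (LinearMap.toContinuousLinearMap (Matrix.toLin' A)).le_opNorm v
  set t := s + 1 with ht
  have ht0 : 0 ≤ t := by linarith
  set C := t * |K| * (1 + t * α) * Real.exp (t * (α + |K|)) with hC
  have hC0 : 0 ≤ C := by positivity
  refine ⟨1 + ‖shearMap A s‖ + b + C * (2 * a) + α, ?_, ?_⟩
  · have : 0 ≤ ‖shearMap A s‖ + b + C * (2 * a) + α := by positivity
    linarith
  have h1 : (0 : ℝ) < 1 / (2 * a) := by positivity
  have h2 : (0 : ℝ) < 1 / (4 * a * (|K| * t + 1)) := by positivity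
  filter_upwards [eventually_pos_le h1, eventually_pos_le h2] with ρ ⟨hρ, hρ1⟩ ⟨_, hρ2⟩ N
  rw [le_div_iff₀ (by positivity)] at hρ1 hρ2
  have h3 : (0 : ℝ) < min ρ 1 / (N + 1) := by positivity
  filter_upwards [eventually_pos_le he, eventually_pos_le one_pos, eventually_pos_le h3]
    with ε ⟨hε, hεe⟩ ⟨_, hε1⟩ ⟨_, hεN⟩ X m hm hm' l θ hθ hl
  rw [le_div_iff₀ (by positivity)] at hεN
  have hK := X.c2_Rφ.nonneg he
  have hmε : s ≤ m * ε := (div_le_iff₀ hε).1 hm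
  have hmε' : m * ε ≤ s + ε * (N + 1) := by
    have := mul_le_mul_of_nonneg_right hm' hε.le
    have e1 : (s / ε + N + 1) * ε = s + ε * (N + 1) := by field_simp; ring
    linarith
  have hmt : m * ε ≤ t := by linarith [min_le_right ρ 1]
  set R := 2 * a * ρ with hR
  have hR0 : 0 ≤ R := by positivity
  have hR1 : R ≤ 1 := by rw [hR]; linarith
  have hKR : K * R * t ≤ 1 / 2 := by
    rw [abs_of_nonneg hK] at hρ2
    rw [hR]
    nlinarith [mul_pos ha hρ]
  have hRa : R / 2 = a * ρ := by rw [hR]; ring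
  have hx : 0 ≤ ‖shearMap A s‖ := norm_nonneg _
  refine ⟨?_, ?_, ?_, fun z z' hz hz' => ?_, ?_⟩
  · refine LiftsOn.sub_intCast (LiftsOn.mono
      (X.liftsOn_iterate_twist he hε hεe hε1 hR0 hR1 hKR m hmt) fun z hz => ?_) l
    rw [mem_ball_zero_iff] at hz
    change ‖z.2‖ < R / 2
    rw [hRa]
    exact (norm_snd_le z).trans_lt hz
  · linarith [mul_nonneg hC0 ha.le]
  · refine max_le ?_ (by simp; positivity)
    refine hθ.trans ?_
    gcongr
    linarith [mul_nonneg hC0 ha.le]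
  · have hz2 : ‖z.2‖ ≤ R / 2 := by rw [hRa]; exact (norm_snd_le z).trans hz.le
    have hz2' : ‖z'.2‖ ≤ R / 2 := by rw [hRa]; exact (norm_snd_le z').trans hz'.le
    have h4 := X.norm_iterate_twistLift_sub_le he hε hεe hε1 hR0 hR1 hKR hα0 hαA hz2 hz2' m hmt
    have h5 : ‖(((m * ε - s) • A.mulVec (z.2 - z'.2), 0) : Cover d)‖ ≤ α * ρ * ‖z - z'‖ := by
      refine max_le ?_ (by simp; positivity)
      change ‖((m : ℝ) * ε - s) • A.mulVec (z.2 - z'.2)‖ ≤ _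
      rw [norm_smul, Real.norm_of_nonneg (by linarith)]
      have e1 : ‖A.mulVec (z.2 - z'.2)‖ ≤ α * ‖z - z'‖ :=
        (hαA _).trans (mul_le_mul_of_nonneg_left (norm_snd_le (z - z')) hα0)
      have e2 : m * ε - s ≤ ρ := by linarith [min_le_left ρ 1]
      calc _ ≤ ρ * (α * ‖z - z'‖) := mul_le_mul e2 e1 (norm_nonneg _) hρ.le
        _ = _ := by ring
    have e3 : ((X.twistLift ε)^[m] z - ((fun i => (l i : ℝ)), 0)) -
        ((X.twistLift ε)^[m] z' - ((fun i => (l i : ℝ)), 0)) - shearMap A s (z - z') =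
        ((X.twistLift ε)^[m] z - (X.twistLift ε)^[m] z' - (z - z') -
          ((m * ε) • A.mulVec (z.2 - z'.2), 0)) +
          ((m * ε - s) • A.mulVec (z.2 - z'.2), 0) := by
      rw [shearMap_apply]
      refine Prod.ext ?_ ?_
      · simp only [Prod.fst_sub, Prod.fst_add, Prod.snd_sub, sub_smul]; abel
      · simp only [Prod.snd_sub, Prod.snd_add]; abel
    rw [e3]
    refine (norm_add_le _ _).trans ((add_le_add h4 h5).trans ?_)
    rw [abs_of_nonneg hK] at hC
    rw [← hC, ← add_mul, hR]
    gcongr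
    have : 0 ≤ (1 + ‖shearMap A s‖ + b) * ρ := by positivity
    linarith
  · have h6 : (X.twistLift ε)^[m] 0 = ((m : ℝ) • X.β, 0) := by
      have := X.iterate_twistLift_zero_section hε hεe 0 m
      rwa [zero_add] at this
    rw [h6]
    have e1 : (((m : ℝ) • X.β, 0) - ((fun i => (l i : ℝ)), 0) - (θ, 0) : Cover d) =
        ((m : ℝ) • X.β - (fun i => (l i : ℝ)) - θ, 0) := by simp
    rw [e1]
    refine max_le (hl.trans ?_) (by simp; positivity)
    have : 0 ≤ (‖shearMap A s‖ + b + C * (2 * a) + α) * ρ ^ 2 := by positivity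
    linarith

/-- The centre is nearly fixed by the kick because `P_{0,J}(0, 0) = 0`. -/
theorem isAffineLift_kick (A B : Matrix (Fin d) (Fin d) ℝ) (γ : ℝ) {e : ℝ} (he : 0 < e) (K : ℝ)
    {a : ℝ} (ha : 0 < a) :
    ∃ c : ℝ, 1 ≤ c ∧ ∀ᶠ ρ in 𝓝[>] (0 : ℝ), ∀ᶠ ε in 𝓝[>] (0 : ℝ), ∀ X : PerturbedPair A B γ e K,
      IsAffineLift (annulus d 1) (X.ifs ε) ε [1] (X.kickLift ε) (linearKick B 1) 0 c ρ
        (a * ρ) := by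
  refine ⟨1 + ‖linearKick B 1‖ + |K| * (a + 2), ?_, ?_⟩
  · have : 0 ≤ ‖linearKick B 1‖ + |K| * (a + 2) := by positivity
    linarith
  filter_upwards [eventually_pos_le (inv_pos.2 ha)] with ρ ⟨hρ, hρ1⟩
  filter_upwards [eventually_pos_le he, eventually_pos_le one_pos, eventually_pos_le hρ,
    eventually_pos_le (pow_pos hρ 2)] with ε ⟨hε, hεe⟩ ⟨_, hε1⟩ ⟨_, hερ⟩ ⟨_, hερ2⟩ X
  have hK := X.c2_Rφ.nonneg he
  rw [le_inv_comm₀ hρ ha, ← one_div, le_div_iff₀ hρ] at hρ1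
  rw [abs_of_nonneg hK]
  have hx : 0 ≤ ‖linearKick B 1‖ := norm_nonneg _
  refine ⟨(X.liftsOn_kick hε hεe).mono fun z hz => ?_, ?_, ?_, fun z z' hz hz' => ?_, ?_⟩
  · rw [mem_ball_zero_iff] at hz
    change ε * ‖z.2‖ < 1
    have := norm_snd_le z
    exact lt_of_le_of_lt (mul_le_of_le_one_left (norm_nonneg _) hε1) (by linarith)
  · have : 0 ≤ K * (a + 2) := by positivity
    linarith
  · rw [norm_zero]; positivity
  · have h1 := X.norm_kickLift_sub_le he hε hεe hε1 hρ1 hz.le hz'.le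
    have e1 : z - z' + (0, B.mulVec (z.1 - z'.1)) = linearKick B 1 (z - z') := by
      rw [linearKick_apply, one_smul]
      refine Prod.ext ?_ ?_ <;> simp
    rw [sub_sub _ (z - z'), e1] at h1
    refine h1.trans (mul_le_mul_of_nonneg_right ?_ (norm_nonneg _))
    have h2 : K * (a * ρ + 2 * ε) ≤ K * (a * ρ + 2 * ρ) := by gcongr
    have h3 : 0 ≤ (1 + ‖linearKick B 1‖) * ρ := by positivity
    linarith
  · rw [sub_zero]
    refine (X.norm_kickLift_zero_le he hε hεe).trans ?_
    have h2 : K * ε ≤ K * ρ ^ 2 := by gcongr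
    have h3 : 0 ≤ (1 + ‖linearKick B 1‖ + K * (a + 1)) * ρ ^ 2 := by positivity
    linarith

theorem isAffineLift_kick_pow (A B : Matrix (Fin d) (Fin d) ℝ) (γ : ℝ) {e : ℝ} (he : 0 < e)
    (K : ℝ) {a : ℝ} (ha : 0 < a) (i : ℕ) :
    ∃ c : ℝ, 1 ≤ c ∧ ∀ᶠ ρ in 𝓝[>] (0 : ℝ), ∀ᶠ ε in 𝓝[>] (0 : ℝ), ∀ X : PerturbedPair A B γ e K,
      ∃ F, IsAffineLift (annulus d 1) (X.ifs ε) ε (List.replicate i 1) F (linearKick B i) 0 c ρ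
        (a * ρ) := by
  induction i with
  | zero =>
    refine ⟨1, le_rfl, ?_⟩
    filter_upwards [eventually_pos_le one_pos] with ρ ⟨hρ, _⟩
    refine Eventually.of_forall fun ε X => ⟨id, LiftsOn.nil _, ?_, ?_, fun z z' _ _ => ?_, ?_⟩
    · refine ContinuousLinearMap.opNorm_le_bound _ zero_le_one fun z => ?_
      simp [linearKick_apply]
    · rw [norm_zero]; positivity
    · simp only [linearKick_apply, id, Nat.cast_zero, zero_smul, add_zero, Prod.mk.eta, sub_self,
        norm_zero]
      positivity
    · simp only [id, sub_self, norm_zero]; positivity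
  | succ i ih =>
    obtain ⟨c, hc, h⟩ := ih
    have ha' : 0 < 2 * c * a + 2 * c := by positivity
    obtain ⟨c', hc', h'⟩ := isAffineLift_kick A B γ he K ha'
    refine ⟨4 * c * c', by nlinarith, ?_⟩
    filter_upwards [h, h', eventually_pos_le one_pos] with ρ h h' ⟨hρ, hρ1⟩
    filter_upwards [h, h'] with ε h h' X
    obtain ⟨F, hF⟩ := h X
    refine ⟨X.kickLift ε ∘ F, ?_⟩
    have := (h' X).comp hF hc hc' hρ hρ1 (by positivity) (by linarith)
    rw [map_zero, zero_add] at this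
    have e1 : (linearKick B 1).comp (linearKick B i) = linearKick B ((i + 1 : ℕ) : ℝ) := by
      refine ContinuousLinearMap.ext fun z => ?_
      simp only [ContinuousLinearMap.comp_apply, linearKick_apply]
      push_cast
      rw [add_smul, add_assoc]
    rwa [e1, ← List.replicate_succ'] at this

/-- The words used in the proof: long blocks of the twist map, with some kicks in between. -/
def kickWord (m i n : ℕ) : List (Fin 2) :=
  List.replicate m 0 ++ (List.replicate i 1 ++ List.replicate n 0)

theorem length_kickWord (m i n : ℕ) : (kickWord m i n).length = m + i + n := by
  simp [kickWord, add_assoc]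

/-- Two long blocks of the twist map, with `i` kicks in between, are close to an affine map whose
linear part is fixed and whose translation part is given by the rotation vectors `θ`, `θ'` of the
blocks. The order of the quantifiers matters: `N` bounds the time needed to realise `θ` and `θ'` up
to `ρ ^ 2`, and only then `ε` is chosen. -/
theorem isAffineLift_kickWord (A B : Matrix (Fin d) (Fin d) ℝ) (γ : ℝ) {e : ℝ} (he : 0 < e)
    (K : ℝ) {s a b : ℝ} (hs : 0 ≤ s) (ha : 0 < a) (hb : 0 ≤ b) (i : ℕ) :
    ∃ c : ℝ, 1 ≤ c ∧ ∀ᶠ ρ in 𝓝[>] (0 : ℝ), ∀ N : ℕ, ∀ᶠ ε in 𝓝[>] (0 : ℝ),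
      ∀ X : PerturbedPair A B γ e K, ∀ m : ℕ, s / ε ≤ m → m ≤ s / ε + N + 1 →
      ∀ n : ℕ, s / ε ≤ n → n ≤ s / ε + N + 1 →
      ∀ (l : Fin d → ℤ) (θ : Fin d → ℝ), ‖θ‖ ≤ b * ρ →
      ‖(m : ℝ) • X.β - (fun i => (l i : ℝ)) - θ‖ ≤ ρ ^ 2 →
      ∀ (l' : Fin d → ℤ) (θ' : Fin d → ℝ), ‖θ'‖ ≤ b * ρ →
      ‖(n : ℝ) • X.β - (fun i => (l' i : ℝ)) - θ'‖ ≤ ρ ^ 2 →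
      ∃ F, IsAffineLift (annulus d 1) (X.ifs ε) ε (kickWord m i n) F
        (((shearMap A s).comp (linearKick B i)).comp (shearMap A s))
        (shearMap A s (linearKick B i (θ, 0)) + (θ', 0)) c ρ (a * ρ) := by
  obtain ⟨c₁, hc₁, h₁⟩ := isAffineLift_twist A B γ he K hs ha hb
  obtain ⟨c₂, hc₂, h₂⟩ := isAffineLift_kick_pow A B γ he K
    (by positivity : 0 < 2 * c₁ * a + 2 * c₁) i
  obtain ⟨c₃, hc₃, h₃⟩ := isAffineLift_twist A B γ he K hs
    (by positivity : 0 < 2 * c₂ * (2 * c₁ * a + 2 * c₁) + 2 * c₂) hb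
  have hc₄ : 1 ≤ 4 * c₂ * c₃ := by nlinarith
  refine ⟨4 * c₁ * (4 * c₂ * c₃), by nlinarith, ?_⟩
  filter_upwards [h₁, h₂, h₃, eventually_pos_le one_pos] with ρ h₁ h₂ h₃ ⟨hρ, hρ1⟩ N
  filter_upwards [h₁ N, h₂, h₃ N] with ε h₁ h₂ h₃ X m hm hm' n hn hn' l θ hθ hl l' θ' hθ' hl'
  obtain ⟨F, hF⟩ := h₂ X
  have h4 := (h₃ X n hn hn' l' θ' hθ' hl').comp hF hc₂ hc₃ hρ hρ1 (by positivity) (by linarith)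
  have h5 := h4.comp (h₁ X m hm hm' l θ hθ hl) hc₁ hc₄ hρ hρ1 (by positivity) (by linarith)
  rw [map_zero, zero_add] at h5
  exact ⟨_, h5⟩

end PerturbedPair

end AffineLifts

/-! ### Diagonalisation of the affine model -/

section Diagonalisation

variable {d : ℕ}

/-- A matrix with simple real spectrum has a basis of eigenvectors. -/
theorem SimpleRealNonzeroSpectrum.exists_eigenbasis {M : Matrix (Fin d) (Fin d) ℝ}
    (h : SimpleRealNonzeroSpectrum M) :
    ∃ (U : (Fin d → ℝ) ≃L[ℝ] (Fin d → ℝ)) (lam : Fin d → ℝ), (∀ k, lam k ≠ 0) ∧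
      ∀ x, M.mulVec (U x) = U (lam * x) := by
  obtain ⟨hs, hn, h0⟩ := h
  have hcard : M.charpoly.roots.toFinset.card = d := by
    rw [Multiset.toFinset_card_of_nodup hn, ← hs.natDegree_eq_card_roots,
      Matrix.charpoly_natDegree_eq_dim, Fintype.card_fin]
  set E := Finset.equivFinOfCardEq hcard
  set lam : Fin d → ℝ := fun k => (E.symm k).1 with hlam
  have hlr : ∀ k, lam k ∈ M.charpoly.roots := fun k => Multiset.mem_toFinset.1 (E.symm k).2
  have hinj : Function.Injective lam := fun k k' hk => E.symm.injective (Subtype.ext hk)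
  have hev : ∀ k, ∃ v, Module.End.HasEigenvector (Matrix.toLin' M) (lam k) v := by
    intro k
    refine Module.End.HasEigenvalue.exists_hasEigenvector ?_
    rw [Module.End.hasEigenvalue_iff_isRoot_charpoly, Matrix.charpoly_toLin']
    exact (Polynomial.mem_roots'.1 (hlr k)).2
  choose v hv using hev
  have hli : LinearIndependent ℝ v :=
    Module.End.eigenvectors_linearIndependent' (Matrix.toLin' M) lam hinj v hv
  have hU : Function.Injective (Fintype.linearCombination ℝ v) :=
    linearIndependent_iff_injective_fintypeLinearCombination.1 hli
  set U := LinearEquiv.ofInjectiveEndo (Fintype.linearCombination ℝ v) hU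
  refine ⟨U.toContinuousLinearEquiv, lam, fun k hk => h0 (hk ▸ hlr k), fun x => ?_⟩
  change Matrix.toLin' M (Fintype.linearCombination ℝ v x) = Fintype.linearCombination ℝ v (lam * x)
  simp only [Fintype.linearCombination_apply, map_sum, map_smul, Pi.mul_apply]
  refine Finset.sum_congr rfl fun k _ => ?_
  rw [(hv k).apply_eq_smul, smul_smul, mul_comm]

theorem SimpleRealNonzeroSpectrum.det_ne_zero {M : Matrix (Fin d) (Fin d) ℝ}
    (h : SimpleRealNonzeroSpectrum M) : M.det ≠ 0 := by
  intro h0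
  refine h.2.2 (Polynomial.mem_roots'.2 ⟨(Matrix.charpoly_monic M).ne_zero, ?_⟩)
  rw [Polynomial.IsRoot, ← Polynomial.coeff_zero_eq_eval_zero]
  have := Matrix.det_eq_sign_charpoly_coeff M
  rw [h0] at this
  rcases mul_eq_zero.1 this.symm with h1 | h1
  · exact absurd h1 (pow_ne_zero _ (by norm_num))
  · exact h1

/-- The linear saddle `(a, y) ↦ (y / 20, μ y - 20 a)`. -/
noncomputable def saddleEquiv (μ : Fin d → ℝ) : Cover d ≃L[ℝ] Cover d :=
  LinearEquiv.toContinuousLinearEquiv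
    { toFun := fun z => ((1 / 20 : ℝ) • z.2, μ * z.2 - (20 : ℝ) • z.1)
      invFun := fun z => (μ * z.1 - (1 / 20 : ℝ) • z.2, (20 : ℝ) • z.1)
      map_add' := fun z w => by
        refine Prod.ext ?_ ?_
        · simp
        · simp only [Prod.snd_add, Prod.fst_add, mul_add, smul_add]; abel
      map_smul' := fun c z => by
        refine Prod.ext ?_ ?_
        · simp only [Prod.smul_snd, RingHom.id_apply, Prod.smul_fst]
          rw [smul_comm]
        · simp only [Prod.smul_snd, RingHom.id_apply, Prod.smul_fst, smul_sub, mul_smul_comm]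
          rw [smul_comm]
      left_inv := fun z => by
        refine Prod.ext ?_ ?_
        · simp only [smul_sub, smul_smul, mul_smul_comm]; norm_num
        · simp only [smul_smul]; norm_num
      right_inv := fun z => by
        refine Prod.ext ?_ ?_
        · simp only [smul_smul]; norm_num
        · simp only [smul_sub, smul_smul, mul_smul_comm]; norm_num }

theorem saddleEquiv_apply (μ : Fin d → ℝ) (z : Cover d) :
    saddleEquiv μ z = ((1 / 20 : ℝ) • z.2, μ * z.2 - (20 : ℝ) • z.1) := rfl

theorem saddleEquiv_symm_apply (μ : Fin d → ℝ) (z : Cover d) :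
    (saddleEquiv μ).symm z = (μ * z.1 - (1 / 20 : ℝ) • z.2, (20 : ℝ) • z.1) := rfl

theorem norm_saddleEquiv_symm_le (μ : Fin d → ℝ) :
    ‖((saddleEquiv μ).symm : Cover d →L[ℝ] Cover d)‖ ≤ 20 + ‖μ‖ := by
  refine ContinuousLinearMap.opNorm_le_bound _ (by positivity) fun z => ?_
  change ‖(saddleEquiv μ).symm z‖ ≤ _
  rw [saddleEquiv_symm_apply]
  have h1 := norm_fst_le z
  have h2 := norm_snd_le z
  refine max_le ?_ ?_
  · refine (norm_sub_le _ _).trans ?_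
    have h3 : ‖μ * z.1‖ ≤ ‖μ‖ * ‖z‖ := (norm_mul_le _ _).trans (by gcongr)
    have h4 : ‖(1 / 20 : ℝ) • z.2‖ ≤ 1 / 20 * ‖z‖ := by
      rw [norm_smul]; norm_num; linarith
    have := norm_nonneg z
    linarith
  · change ‖(20 : ℝ) • z.1‖ ≤ _
    rw [norm_smul]
    have := mul_nonneg (norm_nonneg μ) (norm_nonneg z)
    norm_num
    linarith

theorem exists_equiv_mulVec {A : Matrix (Fin d) (Fin d) ℝ} (hA : A.det ≠ 0) :
    ∃ L : (Fin d → ℝ) ≃L[ℝ] (Fin d → ℝ), ∀ v, L v = A.mulVec v := by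
  have hinj : Function.Injective (Matrix.toLin' A) := by
    intro x y hxy
    exact Matrix.mulVec_injective_of_isUnit ((Matrix.isUnit_iff_isUnit_det A).2 hA.isUnit) hxy
  exact ⟨(LinearEquiv.ofInjectiveEndo _ hinj).toContinuousLinearEquiv, fun v => rfl⟩

/-- The change of coordinates `(a, y) ↦ (x, w)`, where `a = x - s w` and `y = 20 (x + s w)`. -/
noncomputable def splitEquiv (d : ℕ) {s : ℝ} (hs : s ≠ 0) : Cover d ≃L[ℝ] Cover d :=
  LinearEquiv.toContinuousLinearEquiv
    { toFun := fun z => ((1 / 2 : ℝ) • z.1 + (1 / 40 : ℝ) • z.2,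
        s⁻¹ • ((1 / 40 : ℝ) • z.2 - (1 / 2 : ℝ) • z.1))
      invFun := fun z => (z.1 - s • z.2, (20 : ℝ) • (z.1 + s • z.2))
      map_add' := fun z w => by
        refine Prod.ext ?_ ?_
        · simp only [Prod.fst_add, Prod.snd_add, smul_add]; abel
        · simp only [Prod.fst_add, Prod.snd_add, smul_add, smul_sub]; abel
      map_smul' := fun c z => by
        refine Prod.ext ?_ ?_
        · simp only [Prod.smul_fst, Prod.smul_snd, RingHom.id_apply, smul_add, smul_comm c]
        · simp only [Prod.smul_fst, Prod.smul_snd, RingHom.id_apply, smul_sub, smul_comm c]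
      left_inv := fun z => by
        refine Prod.ext ?_ ?_
        · funext k
          simp [smul_inv_smul₀ hs]
          ring
        · funext k
          simp [smul_inv_smul₀ hs]
          ring
      right_inv := fun z => by
        refine Prod.ext ?_ ?_
        · funext k
          simp
          ring
        · funext k
          simp
          field_simp
          ring }

theorem splitEquiv_apply {s : ℝ} (hs : s ≠ 0) (z : Cover d) :
    splitEquiv d hs z = ((1 / 2 : ℝ) • z.1 + (1 / 40 : ℝ) • z.2,
        s⁻¹ • ((1 / 40 : ℝ) • z.2 - (1 / 2 : ℝ) • z.1)) := rfl

/-- Linear coordinates in which the twist, one or two kicks and the twist form a strong saddle: in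
an eigenbasis of `A B`, the coordinates are essentially `x - s w` and `x + s w`, where `x` is the
angle and `w` its velocity under the twist. -/
theorem exists_saddleChart {A B : Matrix (Fin d) (Fin d) ℝ}
    (h : SimpleRealNonzeroSpectrum (A * B)) :
    ∃ (s : ℝ) (Λ : Cover d ≃L[ℝ] Cover d) (μ : ℕ → Fin d → ℝ), 0 < s ∧
      (∀ i : ℕ, 1 ≤ i → ∀ k, 400 ≤ |μ i k|) ∧
      ∀ (i : ℕ) (z : Cover d),
        ((shearMap A s).comp (linearKick B i)).comp (shearMap A s) (Λ z) =
          Λ (saddleEquiv (μ i) z) := by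
  obtain ⟨U, lam, hlam, hU⟩ := h.exists_eigenbasis
  obtain ⟨L, hL⟩ := exists_equiv_mulVec (A := A) (by
    have := h.det_ne_zero
    rw [Matrix.det_mul] at this
    exact left_ne_zero_of_mul this)
  -- a time `s` for which all the numbers `2 s λ` are at least `402`
  obtain ⟨s, hs, hsl⟩ : ∃ s : ℝ, 0 < s ∧ ∀ k, 402 ≤ 2 * s * |lam k| := by
    have h1 : ∀ᶠ s : ℝ in atTop, ∀ k, 402 ≤ 2 * s * |lam k| := by
      rw [eventually_all]
      intro k
      filter_upwards [eventually_ge_atTop (201 / |lam k|)] with s hs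
      rw [div_le_iff₀ (abs_pos.2 (hlam k))] at hs
      linarith
    obtain ⟨s, h2, h3⟩ := (h1.and (eventually_gt_atTop 0)).exists
    exact ⟨s, h3, h2⟩
  refine ⟨s, (splitEquiv d hs.ne').trans (U.prodCongr (U.trans L.symm)),
    fun i k => 2 + 2 * s * i * lam k, hs, fun i hi k => ?_, fun i z => ?_⟩
  · have h1 : (1 : ℝ) ≤ i := by exact_mod_cast hi
    have h2 : 402 ≤ |2 * s * i * lam k| := by
      rw [abs_mul, abs_of_nonneg (by positivity)]
      refine (hsl k).trans ?_
      have : 0 ≤ 2 * s * |lam k| := by positivity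
      nlinarith
    have h3 := abs_sub_abs_le_abs_sub (2 * s * i * lam k) (-2)
    rw [abs_neg, abs_two, sub_neg_eq_add, add_comm _ (2 : ℝ)] at h3
    linarith
  · have hA : ∀ x, A.mulVec (L.symm (U x)) = U x := fun x => by
      rw [← hL, L.apply_symm_apply]
    have hAB : ∀ x, B.mulVec (U x) = L.symm (U (lam * x)) := fun x => by
      rw [← hU, ← Matrix.mulVec_mulVec, ← hL, L.symm_apply_apply]
    have hΛ : ∀ z, ((splitEquiv d hs.ne').trans (U.prodCongr (U.trans L.symm))) z =
        (U (splitEquiv d hs.ne' z).1, L.symm (U (splitEquiv d hs.ne' z).2)) := fun z => rfl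
    have hshear : ∀ x w, shearMap A s (U x, L.symm (U w)) = (U (x + s • w), L.symm (U w)) := by
      intro x w
      rw [shearMap_apply]
      simp only [hA, map_add, map_smul]
    have hkick : ∀ x w, linearKick B i (U x, L.symm (U w)) =
        (U x, L.symm (U (w + (i : ℝ) • (lam * x)))) := by
      intro x w
      rw [linearKick_apply]
      simp only [hAB, map_add, map_smul]
    rw [ContinuousLinearMap.comp_apply, ContinuousLinearMap.comp_apply, hΛ, hΛ, hshear, hkick,
      hshear]
    refine Prod.ext (congrArg U ?_) (congrArg (fun x => L.symm (U x)) ?_)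
    · funext k
      simp [splitEquiv_apply, saddleEquiv_apply]
      field_simp
      ring
    · funext k
      simp [splitEquiv_apply, saddleEquiv_apply]
      field_simp
      ring

/-- The translation part of the affine model is arbitrary, because `B` is invertible. -/
theorem exists_translations {A B : Matrix (Fin d) (Fin d) ℝ} (hB : B.det ≠ 0) (s : ℝ) :
    ∃ b : ℝ, 0 ≤ b ∧ ∀ v : Cover d, ∃ θ θ' : Fin d → ℝ, ‖θ‖ ≤ b * ‖v‖ ∧ ‖θ'‖ ≤ b * ‖v‖ ∧
      shearMap A s (linearKick B 1 (θ, 0)) + (θ', 0) = v := by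
  obtain ⟨L, hL⟩ := exists_equiv_mulVec hB
  set β := ‖(L.symm : (Fin d → ℝ) →L[ℝ] (Fin d → ℝ))‖ with hβ
  set P := ‖(shearMap A s).comp (linearKick B 1)‖ with hP
  have hβ0 : 0 ≤ β := norm_nonneg _
  have hP0 : 0 ≤ P := norm_nonneg _
  refine ⟨β + (1 + P * β), by positivity, fun v => ?_⟩
  have hθ : ‖L.symm v.2‖ ≤ β * ‖v‖ :=
    ((L.symm : (Fin d → ℝ) →L[ℝ] (Fin d → ℝ)).le_opNorm _).trans
      (mul_le_mul_of_nonneg_left (norm_snd_le v) hβ0)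
  have h1 : ‖shearMap A s (linearKick B 1 (L.symm v.2, 0))‖ ≤ P * (β * ‖v‖) := by
    refine (((shearMap A s).comp (linearKick B 1)).le_opNorm (L.symm v.2, 0)).trans ?_
    gcongr
    exact max_le hθ (by simp; positivity)
  have hv := norm_nonneg v
  refine ⟨L.symm v.2, v.1 - (shearMap A s (linearKick B 1 (L.symm v.2, 0))).1,
    hθ.trans ?_, ?_, ?_⟩
  · gcongr
    linarith [mul_nonneg hP0 hβ0]
  · refine (norm_sub_le _ _).trans ?_
    have h2 := (norm_fst_le _).trans h1
    have h3 := norm_fst_le v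
    nlinarith [mul_nonneg hβ0 hv]
  · refine Prod.ext (by simp) ?_
    simp [shearMap_apply, linearKick_apply, ← hL]

end Diagonalisation

/-! ### Return maps from affine models -/

section ReturnMaps

variable {d : ℕ} {ι : Type*} {D : Set (Phase d)} {G : ι → Phase d → Phase d}

/-- The linear coordinates `Λ` of the scaled phase space, as a chart of the phase space. -/
noncomputable def scaledChart (Λ : Cover d ≃L[ℝ] Cover d) {ε : ℝ} (hε : ε ≠ 0) :
    Cover d ≃L[ℝ] Cover d :=
  Λ.trans ((ContinuousLinearEquiv.refl ℝ _).prodCongr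
    (ContinuousLinearEquiv.smulLeft (Units.mk0 ε hε)))

theorem chart_scaledChart (Λ : Cover d ≃L[ℝ] Cover d) {ε : ℝ} (hε : ε ≠ 0) (z : Cover d) :
    chart (scaledChart Λ hε) z = scaleProj ε (Λ z) := rfl

theorem scaleProj_injective {ε : ℝ} (hε : ε ≠ 0) {z z' : Cover d} (hz : ‖z‖ < 1 / 2)
    (hz' : ‖z'‖ < 1 / 2) (h : scaleProj ε z = scaleProj ε z') : z = z' := by
  refine Prod.ext (funext fun i => ?_) ?_
  · have h1 : ((z.1 i : ℝ) : UnitAddCircle) = (z'.1 i : ℝ) :=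
      congrFun (congrArg Prod.fst h) i
    rw [← sub_eq_zero, ← AddCircle.coe_sub] at h1
    obtain ⟨n, hn⟩ := (AddCircle.coe_eq_zero_iff 1).1 h1
    rw [zsmul_eq_mul, mul_one] at hn
    have h2 : |z.1 i - z'.1 i| < 1 := by
      have e1 := (norm_le_pi_norm z.1 i).trans (norm_fst_le z)
      have e2 := (norm_le_pi_norm z'.1 i).trans (norm_fst_le z')
      rw [Real.norm_eq_abs] at e1 e2
      have := abs_sub (z.1 i) (z'.1 i)
      linarith
    rw [← hn] at h2
    have h3 : n = 0 := Int.abs_lt_one_iff.1 (by exact_mod_cast h2)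
    rw [h3, Int.cast_zero] at hn
    linarith
  · have h1 : ε • z.2 = ε • z'.2 := congrArg Prod.snd h
    exact (smul_right_injective _ hε) h1

/-- A map close to the linear saddle `(a, y) ↦ (y / 20, μ y - 20 a)`. -/
structure IsNearSaddle (μ : Fin d → ℝ) (δ r : ℝ) (H : Cover d → Cover d) : Prop where
  lip : ∀ z z', ‖z‖ < r → ‖z'‖ < r → ‖H z - H z' - saddleEquiv μ (z - z')‖ ≤ δ * ‖z - z'‖

variable {μ : Fin d → ℝ} {δ r : ℝ} {H : Cover d → Cover d}

/-- The inverse of the expansion is approximated by `ν = μ⁻¹`. -/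
theorem IsNearSaddle.isSaddleMap (h : IsNearSaddle μ δ r H) (hμ : ∀ k, 400 ≤ |μ k|)
    (hδ : δ ≤ 1 / 20) : ∃ ν, IsSaddleMap r H ν := by
  have hμ0 : ∀ k, μ k ≠ 0 := fun k h0 => by have := hμ k; rw [h0, abs_zero] at this; linarith
  have hμi : ‖μ⁻¹‖ ≤ 1 / 400 := by
    refine (pi_norm_le_iff_of_nonneg (by norm_num)).2 fun k => ?_
    rw [Pi.inv_apply, norm_inv, Real.norm_eq_abs, inv_eq_one_div]
    exact one_div_le_one_div_of_le (by norm_num) (hμ k)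
  have hn : ∀ v : Fin d → ℝ, ‖μ⁻¹ * v‖ ≤ 1 / 400 * ‖v‖ := fun v =>
    (norm_mul_le _ _).trans (by gcongr)
  refine ⟨ContinuousLinearMap.mul ℝ _ μ⁻¹, ?_, ?_, fun z w hz hw => ?_, fun z w hz hw => ?_⟩
  · intro v v' hv
    funext k
    have := congrFun hv k
    simp only [ContinuousLinearMap.mul_apply', Pi.mul_apply, Pi.inv_apply] at this
    exact mul_left_cancel₀ (inv_ne_zero (hμ0 k)) this
  · refine ContinuousLinearMap.opNorm_le_bound _ (by norm_num) fun v => ?_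
    rw [ContinuousLinearMap.mul_apply']
    linarith [hn v, norm_nonneg v]
  · have h1 := (norm_fst_le _).trans (h.lip z w hz hw)
    rw [saddleEquiv_apply] at h1
    have h2 : ‖(1 / 20 : ℝ) • (z - w).2‖ ≤ 1 / 20 * ‖z - w‖ := by
      rw [norm_smul, Real.norm_of_nonneg (by norm_num)]
      gcongr
      exact norm_snd_le _
    have h3 := norm_add_le ((H z).1 - (H w).1 - (1 / 20 : ℝ) • (z - w).2)
      ((1 / 20 : ℝ) • (z - w).2)
    rw [sub_add_cancel] at h3
    have h4 : δ * ‖z - w‖ ≤ 1 / 20 * ‖z - w‖ := by gcongr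
    simp only [Prod.fst_sub] at h1
    linarith
  · have h1 := (norm_snd_le _).trans (h.lip z w hz hw)
    rw [saddleEquiv_apply] at h1
    simp only [Prod.snd_sub, Prod.fst_sub] at h1
    have h4 : δ * ‖z - w‖ ≤ 1 / 20 * ‖z - w‖ := by gcongr
    have e1 : z.2 - w.2 - ContinuousLinearMap.mul ℝ _ μ⁻¹ ((H z).2 - (H w).2) =
        μ⁻¹ * ((20 : ℝ) • (z.1 - w.1)) - μ⁻¹ * ((H z).2 - (H w).2 -
          (μ * (z.2 - w.2) - (20 : ℝ) • (z.1 - w.1))) := by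
      funext k
      simp only [ContinuousLinearMap.mul_apply', Pi.sub_apply, Pi.mul_apply, Pi.smul_apply,
        Pi.inv_apply, smul_eq_mul]
      have := hμ0 k
      field_simp
      ring
    rw [e1]
    have h5 := hn ((20 : ℝ) • (z.1 - w.1))
    have h6 := hn ((H z).2 - (H w).2 - (μ * (z.2 - w.2) - (20 : ℝ) • (z.1 - w.1)))
    rw [norm_smul, Real.norm_of_nonneg (by norm_num)] at h5
    have h7 := norm_fst_le (z - w)
    rw [Prod.fst_sub] at h7
    have h8 := norm_nonneg (z - w)
    refine (norm_sub_le _ _).trans ?_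
    linarith

theorem IsNearSaddle.bijective_fderiv (h : IsNearSaddle μ δ r H) (hδ0 : 0 ≤ δ)
    (hδ : δ * (20 + ‖μ‖) < 1) {z : Cover d} (hz : ‖z‖ < r) (hd : DifferentiableAt ℝ H z) :
    Function.Bijective (fderiv ℝ H z) := by
  set S : Cover d →L[ℝ] Cover d := (saddleEquiv μ : Cover d →L[ℝ] Cover d)
  have h1 : ‖fderiv ℝ H z - S‖ ≤ δ := by
    have h2 : HasFDerivAt (fun z => H z - S z) (fderiv ℝ H z - S) z :=
      hd.hasFDerivAt.sub S.hasFDerivAt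
    refine h2.le_of_lip' hδ0 ?_
    have h3 : IsOpen {z : Cover d | ‖z‖ < r} := isOpen_lt continuous_norm continuous_const
    filter_upwards [h3.mem_nhds hz] with z' hz'
    have := h.lip z' z hz' hz
    have e1 : H z' - S z' - (H z - S z) = H z' - H z - saddleEquiv μ (z' - z) := by
      rw [map_sub]
      change H z' - saddleEquiv μ z' - (H z - saddleEquiv μ z) = _
      abel
    rwa [e1]
  have hinj : Function.Injective (fderiv ℝ H z) := by
    rw [injective_iff_map_eq_zero]
    intro v hv
    have h4 := (fderiv ℝ H z - S).le_of_opNorm_le h1 v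
    rw [_root_.sub_apply, hv, zero_sub, norm_neg] at h4
    have h5 := ((saddleEquiv μ).symm : Cover d →L[ℝ] Cover d).le_of_opNorm_le
      (norm_saddleEquiv_symm_le μ) (S v)
    have h6 : ((saddleEquiv μ).symm : Cover d →L[ℝ] Cover d) (S v) = v :=
      (saddleEquiv μ).symm_apply_apply v
    rw [h6] at h5
    by_contra hv0
    have h7 : 0 < ‖v‖ := norm_pos_iff.2 hv0
    have h8 : (20 + ‖μ‖) * ‖S v‖ ≤ (20 + ‖μ‖) * (δ * ‖v‖) := by gcongr
    have h9 : δ * (20 + ‖μ‖) * ‖v‖ < 1 * ‖v‖ := by gcongr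
    linarith
  exact ⟨hinj, LinearMap.injective_iff_surjective (f := (fderiv ℝ H z).toLinearMap) |>.1 hinj⟩

theorem IsNearSaddle.exists_preimage (h : IsNearSaddle μ δ r H) (hδ0 : 0 ≤ δ) {r' : ℝ}
    (hr0 : 0 ≤ r') (hr : r' < r) {z : Cover d}
    (hz : ‖z - H 0‖ ≤ ((20 + ‖μ‖)⁻¹ - δ) * r') : ∃ x, ‖x‖ ≤ r' ∧ H x = z := by
  have h1 : ApproximatesLinearOn H (saddleEquiv μ : Cover d →L[ℝ] Cover d)
      (Metric.closedBall 0 r') ⟨δ, hδ0⟩ := fun x hx y hy =>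
    h.lip x y ((mem_closedBall_zero_iff.1 hx).trans_lt hr)
      ((mem_closedBall_zero_iff.1 hy).trans_lt hr)
  let N : (saddleEquiv μ : Cover d →L[ℝ] Cover d).NonlinearRightInverse :=
    { toFun := (saddleEquiv μ).symm
      nnnorm := ⟨20 + ‖μ‖, by positivity⟩
      bound' := ((saddleEquiv μ).symm : Cover d →L[ℝ] Cover d).le_of_opNorm_le
        (norm_saddleEquiv_symm_le μ)
      right_inv' := (saddleEquiv μ).apply_symm_apply }
  obtain ⟨x, hx, hxz⟩ := h1.surjOn_closedBall_of_nonlinearRightInverse N (b := 0) hr0 Subset.rfl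
    (show z ∈ _ by rw [mem_closedBall_iff_norm]; exact hz)
  exact ⟨x, mem_closedBall_zero_iff.1 hx, hxz⟩

section

variable {Λ : Cover d ≃L[ℝ] Cover d} {ε c a ρ : ℝ} {w : List ι} {F : Cover d → Cover d}
  {M : Cover d →L[ℝ] Cover d} {v : Cover d}

theorem norm_equiv_apply_lt (hρ : 0 < ρ) (ha : 2 * ‖(Λ : Cover d →L[ℝ] Cover d)‖ < a)
    {z : Cover d} (hz : ‖z‖ < 2 * ρ) : ‖Λ z‖ < a * ρ := by
  have h1 := (Λ : Cover d →L[ℝ] Cover d).le_opNorm z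
  have h2 : ‖(Λ : Cover d →L[ℝ] Cover d)‖ * ‖z‖ ≤ ‖(Λ : Cover d →L[ℝ] Cover d)‖ * (2 * ρ) := by
    gcongr
  have h3 : 2 * ‖(Λ : Cover d →L[ℝ] Cover d)‖ * ρ < a * ρ := by gcongr
  exact lt_of_le_of_lt (h1.trans h2) (by linarith)

/-- An affine lift whose linear part is conjugate to a saddle. -/
structure IsSaddleLift (D : Set (Phase d)) (G : ι → Phase d → Phase d) (ε : ℝ) (w : List ι)
    (F : Cover d → Cover d) (Λ : Cover d ≃L[ℝ] Cover d) (μ : Fin d → ℝ) (v : Cover d)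
    (c a ρ : ℝ) : Prop where
  eps_ne : ε ≠ 0
  pos : 0 < ρ
  one_le : 1 ≤ c
  radius : 2 * ‖(Λ : Cover d →L[ℝ] Cover d)‖ < a
  eig : ∀ k, 400 ≤ |μ k|
  affine : ∃ M : Cover d →L[ℝ] Cover d, (∀ z, M (Λ z) = Λ (saddleEquiv μ z)) ∧
    IsAffineLift D G ε w F M v c ρ (a * ρ)
  /-- The errors of order `ρ` are small. -/
  error : ‖(Λ.symm : Cover d →L[ℝ] Cover d)‖ * c * ‖(Λ : Cover d →L[ℝ] Cover d)‖ * ρ *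
    (20 + ‖μ‖) ≤ 1 / 2
  /-- The images of the balls are small. -/
  image : (2 * c * a + 2 * c) * ρ < 1 / 2

theorem IsSaddleLift.rho_le (h : IsSaddleLift D G ε w F Λ μ v c a ρ) :
    ρ ≤ 1 ∧ a * ρ < 1 / 2 := by
  have h1 := h.image
  have h2 := h.pos
  have h3 := h.one_le
  have h4 := h.radius
  have h5 : 0 < a := lt_of_le_of_lt (by positivity) h4
  have h6 : 0 < c * a * ρ := by positivity
  have h7 : 1 * ρ ≤ c * ρ := by gcongr
  have h8 : 1 * (a * ρ) ≤ c * (a * ρ) := by gcongr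
  constructor <;> nlinarith

theorem IsSaddleLift.isNearSaddle (h : IsSaddleLift D G ε w F Λ μ v c a ρ) :
    IsNearSaddle μ (‖(Λ.symm : Cover d →L[ℝ] Cover d)‖ * c * ‖(Λ : Cover d →L[ℝ] Cover d)‖ * ρ)
      (2 * ρ) (fun z => Λ.symm (F (Λ z))) where
  lip z z' hz hz' := by
    obtain ⟨M, hM, hF⟩ := h.affine
    have hρ := h.pos
    have hc := h.one_le
    have h1 := hF.lip _ _ (norm_equiv_apply_lt hρ h.radius hz)
      (norm_equiv_apply_lt hρ h.radius hz')
    have e1 : Λ.symm (F (Λ z)) - Λ.symm (F (Λ z')) - saddleEquiv μ (z - z') =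
        Λ.symm (F (Λ z) - F (Λ z') - M (Λ z - Λ z')) := by
      rw [← map_sub Λ, hM]
      simp only [map_sub, Λ.symm_apply_apply]
    rw [e1]
    have h2 := (Λ.symm : Cover d →L[ℝ] Cover d).le_opNorm (F (Λ z) - F (Λ z') - M (Λ z - Λ z'))
    have h3 : ‖Λ z - Λ z'‖ ≤ ‖(Λ : Cover d →L[ℝ] Cover d)‖ * ‖z - z'‖ := by
      rw [← map_sub]
      exact (Λ : Cover d →L[ℝ] Cover d).le_opNorm _
    calc _ ≤ ‖(Λ.symm : Cover d →L[ℝ] Cover d)‖ *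
          (c * ρ * (‖(Λ : Cover d →L[ℝ] Cover d)‖ * ‖z - z'‖)) := by
          refine h2.trans ?_
          gcongr
          exact h1.trans (by gcongr)
      _ = _ := by ring

/-- In the coordinates of the saddle, an affine lift is a return map. -/
theorem IsSaddleLift.isReturnMap (h : IsSaddleLift D G ε w F Λ μ v c a ρ) :
    IsReturnMap D G (scaledChart Λ h.eps_ne) ρ w (fun z => Λ.symm (F (Λ z))) := by
  obtain ⟨M, hM, hF⟩ := h.affine
  have hρ := h.pos
  have hc := h.one_le
  have hmem : ∀ z, ‖z‖ < 2 * ρ → Λ z ∈ Metric.ball (0 : Cover d) (a * ρ) := fun z hz =>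
    mem_ball_zero_iff.2 (norm_equiv_apply_lt hρ h.radius hz)
  set δ := ‖(Λ.symm : Cover d →L[ℝ] Cover d)‖ * c * ‖(Λ : Cover d →L[ℝ] Cover d)‖ * ρ with hδ
  have hδ0 : 0 ≤ δ := by positivity
  have hδe : δ * (20 + ‖μ‖) ≤ 1 / 2 := h.error
  have hδ1 : δ ≤ 1 / 20 := by nlinarith [norm_nonneg μ, mul_nonneg hδ0 (norm_nonneg μ)]
  have hsm : ContDiffOn ℝ 1 (fun z => Λ.symm (F (Λ z))) (Metric.ball 0 (2 * ρ)) :=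
    Λ.symm.contDiff.comp_contDiffOn (hF.lifts.smooth.comp Λ.contDiff.contDiffOn
      fun z hz => hmem z (mem_ball_zero_iff.1 hz))
  refine ⟨fun z hz => ?_, fun z hz => ?_, hsm, h.isNearSaddle.isSaddleMap h.eig hδ1,
    fun z hz => h.isNearSaddle.bijective_fderiv hδ0 (by linarith) hz
      ((hsm.differentiableOn one_ne_zero).differentiableAt
        (Metric.isOpen_ball.mem_nhds (mem_ball_zero_iff.2 hz))), fun z z' hz hz' he => ?_⟩
  · rw [chart_scaledChart]
    exact hF.lifts.dom _ (hmem z hz)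
  · rw [chart_scaledChart, hF.lifts.map _ (hmem z hz), chart_scaledChart, Λ.apply_symm_apply]
  · rw [chart_scaledChart, chart_scaledChart, Λ.apply_symm_apply] at he
    have h1 := hF.norm_apply_le (by linarith) hρ.le h.rho_le.1 (norm_equiv_apply_lt hρ h.radius hz)
    have h2 : 2 * c * ‖Λ z‖ ≤ 2 * c * (a * ρ) := by
      gcongr
      exact (norm_equiv_apply_lt hρ h.radius hz).le
    have h3 := scaleProj_injective h.eps_ne (by linarith [h.image])
      ((norm_equiv_apply_lt hρ h.radius hz').trans h.rho_le.2) he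
    change Λ.symm (F (Λ z)) = z'
    rw [h3, Λ.symm_apply_apply]

/-- The error of the affine model, in the coordinates of the saddle. -/
theorem IsSaddleLift.norm_apply_sub_le (h : IsSaddleLift D G ε w F Λ μ v c a ρ) {z : Cover d}
    (hz : ‖z‖ < 2 * ρ) :
    ‖Λ.symm (F (Λ z)) - (saddleEquiv μ z + Λ.symm v)‖ ≤
      ‖(Λ.symm : Cover d →L[ℝ] Cover d)‖ * c * (a + 1) * ρ ^ 2 := by
  obtain ⟨M, hM, hF⟩ := h.affine
  have hρ := h.pos
  have hc := h.one_le
  have h0 := norm_equiv_apply_lt hρ h.radius hz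
  have h1 := hF.norm_apply_sub_le h0
  have e1 : Λ.symm (F (Λ z)) - (saddleEquiv μ z + Λ.symm v) = Λ.symm (F (Λ z) - (M (Λ z) + v)) := by
    rw [hM, map_sub, map_add, Λ.symm_apply_apply]
  rw [e1]
  have h2 := (Λ.symm : Cover d →L[ℝ] Cover d).le_opNorm (F (Λ z) - (M (Λ z) + v))
  calc _ ≤ ‖(Λ.symm : Cover d →L[ℝ] Cover d)‖ * (c * ρ * (a * ρ) + c * ρ ^ 2) := by
        refine h2.trans ?_
        gcongr
        refine h1.trans ?_
        gcongr
    _ = _ := by ring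

/-- The translation part of the affine model is the image of a point close to the centre. -/
theorem IsSaddleLift.exists_preimage (h : IsSaddleLift D G ε w F Λ μ v c a ρ)
    (herr : ‖(Λ.symm : Cover d →L[ℝ] Cover d)‖ * c * (a + 1) * ρ ^ 2 * (20 + ‖μ‖) ≤ 1 / 40 * ρ) :
    ∃ x, ‖x‖ ≤ ρ / 20 ∧ Λ.symm (F (Λ x)) = Λ.symm v := by
  have hρ := h.pos
  have hc := h.one_le
  have h4 := h.norm_apply_sub_le (z := 0) (by simpa using hρ)
  rw [map_zero (saddleEquiv μ), zero_add, ← norm_neg, neg_sub] at h4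
  refine h.isNearSaddle.exists_preimage (r' := ρ / 20) (by positivity) (by positivity)
    (by linarith) (h4.trans ?_)
  have hδe := h.error
  set δ := ‖(Λ.symm : Cover d →L[ℝ] Cover d)‖ * c * ‖(Λ : Cover d →L[ℝ] Cover d)‖ * ρ
  -- the error is at most `ρ / 40` divided by the norm of the inverse of the saddle
  have h5 : 1 / 2 ≤ (20 + ‖μ‖) * ((20 + ‖μ‖)⁻¹ - δ) := by
    rw [mul_sub, mul_inv_cancel₀ (by positivity)]
    linarith
  have h7 : 0 < 20 + ‖μ‖ := by positivity
  refine le_of_mul_le_mul_right ?_ h7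
  calc _ ≤ 1 / 40 * ρ := herr
    _ = 1 / 2 * (ρ / 20) := by ring
    _ ≤ (20 + ‖μ‖) * ((20 + ‖μ‖)⁻¹ - δ) * (ρ / 20) := by gcongr
    _ = _ := by ring

end

end ReturnMaps

/-! ### The return system for small parameters -/

section ReturnSystem

variable {d : ℕ} {A B : Matrix (Fin d) (Fin d) ℝ} {γ e K : ℝ}

/-- Long blocks of iterations of the twist map, of given approximate length, translate the
zero section by any given vector, up to a small error. -/
theorem PerturbedPair.exists_block (hγ : 0 < γ) {η : ℝ} (hη : 0 < η) :
    ∃ N : ℕ, ∀ X : PerturbedPair A B γ e K, ∀ t : ℝ, 0 ≤ t → ∀ θ : Fin d → ℝ,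
      ∃ m : ℕ, t ≤ m ∧ m ≤ t + N + 1 ∧ ∃ l : Fin d → ℤ,
        ‖(m : ℝ) • X.β - (fun i => (l i : ℝ)) - θ‖ ≤ η := by
  obtain ⟨N, hN⟩ := exists_kronecker_bound d hγ hη
  refine ⟨N, fun X t ht θ => ?_⟩
  obtain ⟨k, hk, l, hl⟩ := hN X.β X.constantType (θ - (⌈t⌉₊ : ℝ) • X.β)
  refine ⟨⌈t⌉₊ + k, ?_, ?_, l, ?_⟩
  · push_cast
    linarith [Nat.le_ceil t, Nat.cast_nonneg (α := ℝ) k]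
  · push_cast
    have : (k : ℝ) ≤ N := by exact_mod_cast hk
    linarith [(Nat.ceil_lt_add_one ht).le]
  · convert hl using 2
    push_cast
    rw [add_smul]
    abel

/-- The words consisting of one kick between two long blocks of the twist map form a return
system, for every small `ε`. -/
theorem PerturbedPair.exists_returnSystem (hγ : 0 < γ) (he : 0 < e)
    (h : SimpleRealNonzeroSpectrum (A * B)) :
    ∃ (Λ : Cover d ≃L[ℝ] Cover d) (ρ : ℝ), 0 < ρ ∧ ∀ᶠ ε in 𝓝[>] (0 : ℝ), ∃ hε : ε ≠ 0,
      ∀ X : PerturbedPair A B γ e K, ∃ (W : Finset (List (Fin 2))) (w w' : List (Fin 2))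
        (F F' : Cover d → Cover d),
        IsReturnSystem (annulus d 1) (X.ifs ε) (scaledChart Λ hε) ρ W w F ∧
        IsReturnMap (annulus d 1) (X.ifs ε) (scaledChart Λ hε) ρ w' F' ∧ ‖F' 0‖ ≤ ρ / 20 ∧
        w'.length = w.length + 1 := by
  classical
  obtain ⟨s, Λ, μ, hs, hμ, hΛ⟩ := exists_saddleChart h
  have hB : B.det ≠ 0 := by
    have := h.det_ne_zero
    rw [Matrix.det_mul] at this
    exact right_ne_zero_of_mul this
  obtain ⟨b, hb, hbv⟩ := exists_translations (A := A) hB s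
  set n₁ := ‖(Λ : Cover d →L[ℝ] Cover d)‖ with hn₁
  set n₂ := ‖(Λ.symm : Cover d →L[ℝ] Cover d)‖ with hn₂
  set S : Cover d →L[ℝ] Cover d := (saddleEquiv (μ 1) : Cover d →L[ℝ] Cover d) with hS
  have hn₁0 : 0 ≤ n₁ := norm_nonneg _
  have hn₂0 : 0 ≤ n₂ := norm_nonneg _
  set a := 2 * n₁ + 1 with ha
  have ha0 : 0 < a := by positivity
  set b' := b * (n₁ * (‖S‖ + 1)) with hb'
  have hb'0 : 0 ≤ b' := by positivity
  obtain ⟨c₁, hc₁, h₁⟩ := PerturbedPair.isAffineLift_kickWord A B γ he K hs.le ha0 hb'0 1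
  obtain ⟨c₂, hc₂, h₂⟩ := PerturbedPair.isAffineLift_kickWord A B γ he K hs.le ha0 hb'0 2
  set c := max c₁ c₂ with hc
  have hc1 : 1 ≤ c := hc₁.trans (le_max_left _ _)
  set q := 20 + ‖μ 1‖ + ‖μ 2‖ with hq
  have hq0 : 0 < q := by positivity
  have hC1 : 0 < 1 / 2 / (n₂ * c * n₁ * q + 1) := by positivity
  have hC2 : 0 < 1 / 4 / (2 * c * a + 2 * c) := by positivity
  have hC3 : 0 < 1 / 40 / (n₂ * c * (a + 1) * q + 1) := by positivity
  obtain ⟨ρ, h₁, h₂, ⟨hρ, hρ1⟩, ⟨_, hρ2⟩, ⟨_, hρ3⟩⟩ := (h₁.and (h₂.and ((eventually_pos_le hC1).and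
    ((eventually_pos_le hC2).and (eventually_pos_le hC3))))).exists
  rw [le_div_iff₀ (by positivity)] at hρ1 hρ2 hρ3
  obtain ⟨N, hN⟩ := PerturbedPair.exists_block (A := A) (B := B) (γ := γ) (e := e) (K := K) hγ
    (pow_pos hρ 2)
  refine ⟨Λ, ρ, hρ, ?_⟩
  filter_upwards [h₁ N, h₂ N, eventually_pos_le one_pos] with ε h₁ h₂ ⟨hε, hε1⟩
  refine ⟨hε.ne', fun X => ?_⟩
  have hsε : 0 ≤ s / ε := by positivity
  have herr : ∀ i : ℕ, ‖μ i‖ ≤ ‖μ 1‖ + ‖μ 2‖ → n₂ * c * n₁ * ρ * (20 + ‖μ i‖) ≤ 1 / 2 := by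
    intro i hi
    calc n₂ * c * n₁ * ρ * (20 + ‖μ i‖) ≤ n₂ * c * n₁ * ρ * q := by gcongr; linarith
      _ ≤ _ := by linarith
  have hsl : ∀ (i : ℕ) (w : List (Fin 2)) (F : Cover d → Cover d) (v : Cover d), 1 ≤ i →
      ‖μ i‖ ≤ ‖μ 1‖ + ‖μ 2‖ →
      IsAffineLift (annulus d 1) (X.ifs ε) ε w F
        (((shearMap A s).comp (linearKick B i)).comp (shearMap A s)) v c ρ (a * ρ) →
      IsSaddleLift (annulus d 1) (X.ifs ε) ε w F Λ (μ i) v c a ρ := by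
    intro i w F v hi hi' hF
    exact ⟨hε.ne', hρ, hc1, by linarith, hμ i hi, ⟨_, hΛ i, hF⟩, herr i hi', by linarith⟩
  -- affine lifts with an arbitrary translation
  have hex : ∀ t : Cover d, ‖t‖ ≤ (‖S‖ + 1) * ρ → ∃ m n : ℕ, m ≤ s / ε + N + 1 ∧
      n ≤ s / ε + N + 1 ∧ ∃ F, IsSaddleLift (annulus d 1) (X.ifs ε) ε (kickWord m 1 n) F Λ (μ 1)
        (Λ t) c a ρ := by
    intro t ht
    obtain ⟨θ, θ', hθ, hθ', hv⟩ := hbv (Λ t)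
    have hΛt : b * ‖Λ t‖ ≤ b' * ρ := by
      have h3 := (Λ : Cover d →L[ℝ] Cover d).le_opNorm t
      calc b * ‖Λ t‖ ≤ b * (n₁ * ((‖S‖ + 1) * ρ)) := by
            gcongr
            exact h3.trans (by gcongr)
        _ = _ := by rw [hb']; ring
    obtain ⟨m, hm, hm', l, hl⟩ := hN X (s / ε) hsε θ
    obtain ⟨n, hn, hn', l', hl'⟩ := hN X (s / ε) hsε θ'
    obtain ⟨F, hF⟩ := h₁ X m hm hm' n hn hn' l θ (hθ.trans hΛt) hl l' θ' (hθ'.trans hΛt) hl'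
    refine ⟨m, n, hm', hn', F, hsl 1 _ F _ le_rfl (by linarith [norm_nonneg (μ 2)]) ?_⟩
    rw [Nat.cast_one, hv] at hF
    rw [Nat.cast_one]
    exact hF.mono hρ.le (le_max_left _ _)
  set Nmax := ⌈s / ε + N + 1⌉₊ + 1 with hNmax
  have hlt : ∀ m : ℕ, m ≤ s / ε + N + 1 → m < Nmax := by
    intro m hm
    have : m ≤ ⌈s / ε + N + 1⌉₊ := by exact_mod_cast hm.trans (Nat.le_ceil _)
    omega
  -- All words of bounded length that are return maps; the bound on the lengths makes the family
  -- finite.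
  set W : Finset (List (Fin 2)) :=
    ((Finset.range Nmax ×ˢ Finset.range Nmax).image fun p => kickWord p.1 1 p.2).filter
      fun u => ∃ H, IsReturnMap (annulus d 1) (X.ifs ε) (scaledChart Λ hε.ne') ρ u H with hW
  have hmemW : ∀ {m n : ℕ} {F : Cover d → Cover d} {v : Cover d}, m ≤ s / ε + N + 1 →
      n ≤ s / ε + N + 1 →
      IsSaddleLift (annulus d 1) (X.ifs ε) ε (kickWord m 1 n) F Λ (μ 1) v c a ρ →
      kickWord m 1 n ∈ W := by
    intro m n F v hm hn hF
    refine Finset.mem_filter.2 ⟨Finset.mem_image.2 ⟨(m, n), ?_, rfl⟩, _, hF.isReturnMap⟩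
    exact Finset.mem_product.2 ⟨Finset.mem_range.2 (hlt m hm), Finset.mem_range.2 (hlt n hn)⟩
  -- the error of the affine model is of order `ρ ^ 2`
  have hsmall : n₂ * c * (a + 1) * ρ ^ 2 * q ≤ 1 / 40 * ρ := by
    have : (n₂ * c * (a + 1) * q * ρ) * ρ ≤ 1 / 40 * ρ := by
      gcongr
      linarith
    linarith
  have hsmall' : n₂ * c * (a + 1) * ρ ^ 2 ≤ ρ / 20 := by
    have h3 : 1 ≤ q := by rw [hq]; linarith [norm_nonneg (μ 1), norm_nonneg (μ 2)]
    have h4 : n₂ * c * (a + 1) * ρ ^ 2 * 1 ≤ n₂ * c * (a + 1) * ρ ^ 2 * q := by gcongr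
    linarith
  have hS1 : ∀ z, ‖saddleEquiv (μ 1) z‖ ≤ ‖S‖ * ‖z‖ := fun z => S.le_opNorm z
  -- two words with consecutive lengths, whose return maps nearly fix the centre
  obtain ⟨m, hm, hm', l, hl⟩ := hN X (s / ε) hsε 0
  have hzero : ‖(0 : Fin d → ℝ)‖ ≤ b' * ρ := by rw [norm_zero]; positivity
  obtain ⟨F, hF⟩ := h₁ X m hm hm' m hm hm' l 0 hzero hl l 0 hzero hl
  obtain ⟨F', hF'⟩ := h₂ X m hm hm' m hm hm' l 0 hzero hl l 0 hzero hl
  have hF1 := hsl 1 _ F _ le_rfl (by linarith [norm_nonneg (μ 2)]) (hF.mono hρ.le (le_max_left _ _))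
  have hF2 := hsl 2 _ F' _ one_le_two (by linarith [norm_nonneg (μ 1)])
    (hF'.mono hρ.le (le_max_right _ _))
  have hcen : ∀ i : ℕ, ∀ (w : List (Fin 2)) (F : Cover d → Cover d),
      IsSaddleLift (annulus d 1) (X.ifs ε) ε w F Λ (μ i)
        (shearMap A s (linearKick B i (0, 0)) + (0, 0)) c a ρ → ‖Λ.symm (F (Λ 0))‖ ≤ ρ / 20 := by
    intro i w F hF
    have h3 := hF.norm_apply_sub_le (z := 0) (by simpa using hρ)
    have h4 : shearMap A s (linearKick B i (0, 0)) + (0, 0) = (0 : Cover d) := by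
      rw [Prod.mk_zero_zero, map_zero, map_zero, add_zero]
    simp only [h4, map_zero, add_zero, sub_zero] at h3 ⊢
    exact h3.trans hsmall'
  refine ⟨W, kickWord m 1 m, kickWord m 2 m, _, _, ⟨hρ, ?_, ?_, ?_, ?_, ?_, hmemW hm' hm' hF1,
    hF1.isReturnMap, hcen 1 _ _ hF1⟩, hF2.isReturnMap, hcen 2 _ _ hF2, ?_⟩
  · intro z z' hz hz' hzz
    have h3 := hF1.rho_le.2
    exact Λ.injective (scaleProj_injective hε.ne'
      ((norm_equiv_apply_lt hρ hF1.radius hz).trans h3)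
      ((norm_equiv_apply_lt hρ hF1.radius hz').trans h3) hzz)
  · intro z hz
    rw [chart_scaledChart, mem_annulus zero_le_one]
    have h3 := (norm_snd_le (Λ z)).trans_lt ((norm_equiv_apply_lt hρ hF1.radius hz).trans
      hF1.rho_le.2)
    change ‖ε • (Λ z).2‖ ≤ 1
    rw [norm_smul, Real.norm_of_nonneg hε.le]
    exact mul_le_one₀ hε1 (norm_nonneg _) (by linarith)
  · intro u hu
    exact (Finset.mem_filter.1 hu).2
  · intro z hz
    have h3 := hS1 z
    -- The translation is chosen so that the affine model sends `z` to the centre.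
    obtain ⟨m, n, hm, hn, F, hF⟩ := hex (-saddleEquiv (μ 1) z) (by
      rw [norm_neg]
      refine h3.trans ?_
      gcongr
      linarith)
    refine ⟨_, hmemW hm hn hF, _, hF.isReturnMap, ?_⟩
    have h4 := hF.norm_apply_sub_le (z := z) (by linarith)
    rw [Λ.symm_apply_apply, add_neg_cancel, sub_zero] at h4
    exact h4.trans hsmall'
  · intro z hz
    -- The affine model sends the centre to `z`.
    obtain ⟨m, n, hm, hn, F, hF⟩ := hex z (by nlinarith [norm_nonneg S])
    refine ⟨_, hmemW hm hn hF, _, hF.isReturnMap, ?_⟩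
    have h6 : n₂ * c * (a + 1) * ρ ^ 2 * (20 + ‖μ 1‖) ≤ 1 / 40 * ρ := by
      refine le_trans ?_ hsmall
      gcongr
      linarith [norm_nonneg (μ 2)]
    obtain ⟨x, hx, hxz⟩ := hF.exists_preimage h6
    exact ⟨x, hx, hxz.trans (Λ.symm_apply_apply z)⟩
  · rw [length_kickWord, length_kickWord]
    omega

end ReturnSystem

/-! ### Steering by nearly affine moves -/

section Control

variable {d : ℕ}

theorem phaseProj_sub_intCast (v : Cover d) (l : Fin d → ℤ) :
    phaseProj (v.1 - (fun i => (l i : ℝ)), v.2) = phaseProj v := by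
  rw [phaseProj, phaseProj, torusProj_sub_intCast]

/-- Motions which are close to the translation by `β'`, with a cubic drift of the actions, bring the
angle close to any given value in a bounded number of steps. -/
theorem exists_angle_control {γ : ℝ} (hγ : 0 < γ) {C : ℝ} (hC : 0 ≤ C) {η : ℝ} (hη : 0 < η) :
    ∃ M : ℝ, 0 < M ∧ ∀ {s : ℝ}, s * M ≤ 1 → s ≤ 1 → ∀ {β' : Fin d → ℝ}, IsConstantType γ β' →
      ∀ {Reach : Phase d → Phase d → Prop}, (∀ z, Reach z z) →
      (∀ {x y z}, Reach x y → Reach y z → Reach x z) →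
      (∀ v : Cover d, ‖v.2‖ ≤ 2 * s → ∃ v' : Cover d, Reach (phaseProj v) (phaseProj v') ∧
        ‖v'.2 - v.2‖ ≤ C * ‖v.2‖ ^ 3 ∧ ‖v'.1 - v.1 - β'‖ ≤ C * ‖v.2‖) →
      ∀ v : Cover d, ‖v.2‖ ≤ s → ∀ θ : Fin d → ℝ,
        ∃ v' : Cover d, Reach (phaseProj v) (phaseProj v') ∧ ‖v'.1 - θ‖ ≤ η ∧
          ‖v'.2 - v.2‖ ≤ M * ‖v.2‖ ^ 3 ∧ ‖v'.2‖ ≤ 2 * ‖v.2‖ := by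
  obtain ⟨N, hN⟩ := exists_kronecker_bound d hγ (half_pos hη)
  refine ⟨8 * C * N + 4 * C * N / η + 1, by positivity, ?_⟩
  intro s hs hs1 β' hβ' Reach hrefl htrans hstep v hv θ
  have hs0 : 0 ≤ s := (norm_nonneg _).trans hv
  have hv1 : ‖v.2‖ ≤ 1 := hv.trans hs1
  have hNC : 0 ≤ C * N := by positivity
  have hN8 : 8 * C * N * ‖v.2‖ ≤ 1 := by
    have h1 : 8 * C * N * ‖v.2‖ ≤ (8 * C * N + 4 * C * N / η + 1) * s := by
      gcongr
      have : 0 ≤ 4 * C * N / η := by positivity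
      linarith
    linarith
  have hNη : N * (2 * C * ‖v.2‖) ≤ η / 2 := by
    have h1 : 4 * C * N / η * ‖v.2‖ ≤ (8 * C * N + 4 * C * N / η + 1) * s := by
      gcongr
      linarith
    have h2 : 4 * C * N / η * ‖v.2‖ ≤ 1 := by linarith
    have h3 : 4 * C * N / η * ‖v.2‖ * η = 4 * C * N * ‖v.2‖ := by field_simp
    nlinarith
  have key : ∀ k : ℕ, k ≤ N → ∃ v' : Cover d, Reach (phaseProj v) (phaseProj v') ∧
      ‖v'.2 - v.2‖ ≤ k * (8 * C * ‖v.2‖ ^ 3) ∧ ‖v'.1 - v.1 - (k : ℝ) • β'‖ ≤ k * (2 * C * ‖v.2‖) ∧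
      ‖v'.2‖ ≤ 2 * ‖v.2‖ := by
    intro k
    induction k with
    | zero => intro _; exact ⟨v, hrefl _, by simp, by simp, by linarith [norm_nonneg v.2]⟩
    | succ k ih =>
      intro hk
      obtain ⟨v', hr, h1, h2, h3⟩ := ih (by omega)
      obtain ⟨v'', hr', h4, h5⟩ := hstep v' (by linarith)
      have h6 : ‖v''.2 - v.2‖ ≤ (k + 1 : ℕ) * (8 * C * ‖v.2‖ ^ 3) := by
        have e1 : v''.2 - v.2 = (v''.2 - v'.2) + (v'.2 - v.2) := by abel
        have e2 : C * ‖v'.2‖ ^ 3 ≤ C * (2 * ‖v.2‖) ^ 3 := by gcongr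
        rw [e1]
        refine (norm_add_le _ _).trans ?_
        push_cast
        linarith
      refine ⟨v'', htrans hr hr', h6, ?_, ?_⟩
      · have e1 : v''.1 - v.1 - ((k + 1 : ℕ) : ℝ) • β' =
            (v''.1 - v'.1 - β') + (v'.1 - v.1 - (k : ℝ) • β') := by
          push_cast
          rw [add_smul, one_smul]
          abel
        have e2 : C * ‖v'.2‖ ≤ C * (2 * ‖v.2‖) := by gcongr
        rw [e1]
        refine (norm_add_le _ _).trans ?_
        push_cast
        linarith
      · have e1 := norm_add_le v.2 (v''.2 - v.2)
        rw [add_sub_cancel] at e1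
        have e2 : ((k + 1 : ℕ) : ℝ) * (8 * C * ‖v.2‖ ^ 3) ≤ N * (8 * C * ‖v.2‖ ^ 3) := by
          gcongr
        have e3 : N * (8 * C * ‖v.2‖ ^ 3) = 8 * C * N * ‖v.2‖ * ‖v.2‖ ^ 2 := by ring
        have e4 : 8 * C * N * ‖v.2‖ * ‖v.2‖ ^ 2 ≤ 1 * ‖v.2‖ := by
          refine mul_le_mul hN8 ?_ (by positivity) zero_le_one
          rw [pow_two]
          exact mul_le_of_le_one_left (norm_nonneg _) hv1
        linarith
  obtain ⟨k, hk, l, hl⟩ := hN β' hβ' (θ - v.1)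
  obtain ⟨v', hr, h1, h2, h3⟩ := key k hk
  have hkN : (k : ℝ) ≤ N := by exact_mod_cast hk
  refine ⟨(v'.1 - fun i => (l i : ℝ), v'.2), by rwa [phaseProj_sub_intCast], ?_, ?_, h3⟩
  · have e1 : (v'.1 - fun i => (l i : ℝ)) - θ =
        (v'.1 - v.1 - (k : ℝ) • β') + ((k : ℝ) • β' - (θ - v.1) - fun i => (l i : ℝ)) := by abel
    have e2 : k * (2 * C * ‖v.2‖) ≤ N * (2 * C * ‖v.2‖) := by gcongr
    change ‖(v'.1 - fun i => (l i : ℝ)) - θ‖ ≤ η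
    rw [e1]
    refine (norm_add_le _ _).trans ?_
    linarith
  · refine h1.trans ?_
    have e2 : k * (8 * C * ‖v.2‖ ^ 3) ≤ N * (8 * C * ‖v.2‖ ^ 3) := by gcongr
    have e3 : 0 ≤ (4 * C * N / η + 1) * ‖v.2‖ ^ 3 := by positivity
    linarith

/-- Kicks, applied at well chosen angles, decrease the actions from the order `√ε` to an
arbitrarily small multiple of `ε`. -/
theorem exists_control {γ : ℝ} (hγ : 0 < γ) {C : ℝ} (hC : 0 < C)
    (L : (Fin d → ℝ) ≃L[ℝ] (Fin d → ℝ)) {c : ℝ} (hc : 0 < c) :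
    ∀ᶠ ε in 𝓝[>] (0 : ℝ), ∀ {β' : Fin d → ℝ}, IsConstantType γ β' →
      ∀ {Reach : Phase d → Phase d → Prop}, (∀ z, Reach z z) →
      (∀ {x y z}, Reach x y → Reach y z → Reach x z) →
      (∀ v : Cover d, ‖v.2‖ ≤ 2 * √ε → ∃ v' : Cover d, Reach (phaseProj v) (phaseProj v') ∧
        ‖v'.2 - v.2‖ ≤ C * ‖v.2‖ ^ 3 ∧ ‖v'.1 - v.1 - β'‖ ≤ C * ‖v.2‖) →
      (∀ v : Cover d, ‖v.1‖ ≤ 1 → ‖v.2‖ ≤ 2 * √ε → ∃ v' : Cover d,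
        Reach (phaseProj v) (phaseProj v') ∧
        ‖v'.2 - v.2 - ε • L v.1‖ ≤ ε * (C * (‖v.1‖ ^ 2 + ε + ‖v.2‖))) →
      ∀ v : Cover d, ‖v.2‖ ≤ √ε →
        ∃ v' : Cover d, Reach (phaseProj v) (phaseProj v') ∧ ‖v'.1‖ ≤ c ∧ ‖v'.2‖ ≤ c * ε := by
  set n₁ := ‖(L : (Fin d → ℝ) →L[ℝ] (Fin d → ℝ))‖ + 1 with hn₁
  set n₂ := ‖(L.symm : (Fin d → ℝ) →L[ℝ] (Fin d → ℝ))‖ + 1 with hn₂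
  have hn₁0 : 0 < n₁ := by positivity
  have hn₂0 : 0 < n₂ := by positivity
  have hL : ∀ x, ‖L x‖ ≤ n₁ * ‖x‖ := fun x =>
    ((L : (Fin d → ℝ) →L[ℝ] (Fin d → ℝ)).le_opNorm x).trans (by gcongr; linarith)
  have hLs : ∀ x, ‖L.symm x‖ ≤ n₂ * ‖x‖ := fun x =>
    ((L.symm : (Fin d → ℝ) →L[ℝ] (Fin d → ℝ)).le_opNorm x).trans (by gcongr; linarith)
  -- the size `δ` of the useful part of a kick, for which the quadratic part is negligible
  obtain ⟨δ, hδ, hδc, hδ1, hδ2⟩ : ∃ δ > 0, δ ≤ c / 2 ∧ 2 * n₂ * δ ≤ 1 ∧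
      C * (2 * n₂ * δ) ^ 2 ≤ δ / 8 := by
    refine ⟨min (c / 2) (min (1 / (2 * n₂)) (1 / (32 * C * n₂ ^ 2))), by positivity,
      min_le_left _ _, ?_, ?_⟩
    · have := (min_le_right (c / 2) _).trans (min_le_left (1 / (2 * n₂)) (1 / (32 * C * n₂ ^ 2)))
      rw [le_div_iff₀ (by positivity)] at this
      linarith
    · set δ := min (c / 2) (min (1 / (2 * n₂)) (1 / (32 * C * n₂ ^ 2))) with hδ
      have hδ0 : 0 < δ := by positivity
      have := (min_le_right (c / 2) _).trans (min_le_right (1 / (2 * n₂)) (1 / (32 * C * n₂ ^ 2)))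
      rw [← hδ, le_div_iff₀ (by positivity)] at this
      nlinarith
  obtain ⟨η, hη, hηc, hη1, hη2⟩ : ∃ η > 0, η ≤ c ∧ η ≤ n₂ * δ ∧ n₁ * η ≤ δ / 8 := by
    refine ⟨min c (min (n₂ * δ) (δ / 8 / n₁)), by positivity, min_le_left _ _,
      (min_le_right _ _).trans (min_le_left _ _), ?_⟩
    have := (min_le_right c _).trans (min_le_right (n₂ * δ) (δ / 8 / n₁))
    rw [le_div_iff₀ hn₁0] at this
    linarith
  obtain ⟨M, hM, hcontrol⟩ := exists_angle_control (d := d) hγ hC.le hη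
  have hs : ∀ᶠ ε in 𝓝[>] (0 : ℝ), √ε < min (min 1 (1 / M)) (min (δ / 8 / M) (δ / 8 / (3 * C))) := by
    have : Tendsto Real.sqrt (𝓝[>] 0) (𝓝 0) := by
      have := Real.continuous_sqrt.tendsto 0
      rw [Real.sqrt_zero] at this
      exact this.mono_left nhdsWithin_le_nhds
    exact this.eventually_lt_const (by positivity)
  filter_upwards [hs, eventually_pos_le one_pos] with ε hs ⟨hε, hε1⟩
  obtain ⟨⟨hs1, hsM⟩, hsδM, hsδC⟩ : (√ε < 1 ∧ √ε < 1 / M) ∧ √ε < δ / 8 / M ∧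
      √ε < δ / 8 / (3 * C) := by
    simpa only [lt_min_iff] using hs
  rw [lt_div_iff₀ (by positivity)] at hsM hsδM hsδC
  have hsq : √ε ^ 2 = ε := Real.sq_sqrt hε.le
  have hs0 : 0 < √ε := Real.sqrt_pos.2 hε
  have hεs : ε ≤ √ε := by nlinarith
  intro β' hβ' Reach hrefl htrans hstep hkick
  have hang := hcontrol hsM.le hs1.le hβ' hrefl htrans hstep
  -- one cycle decreases the actions by at least `ε δ / 2`
  have hcycle : ∀ v : Cover d, ‖v.2‖ ≤ √ε → ε * δ ≤ ‖v.2‖ →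
      ∃ v' : Cover d, Reach (phaseProj v) (phaseProj v') ∧ ‖v'.2‖ ≤ ‖v.2‖ - ε * δ / 2 := by
    intro v hv hvδ
    have hv0 : 0 < ‖v.2‖ := lt_of_lt_of_le (by positivity) hvδ
    -- The kick is applied near the angle `L⁻¹ u`, where it changes the actions by `ε u`.
    set u : Fin d → ℝ := (-(δ / ‖v.2‖)) • v.2 with hu
    have hun : ‖u‖ = δ := by
      rw [hu, norm_smul, norm_neg, Real.norm_of_nonneg (by positivity), div_mul_cancel₀ _ hv0.ne']
    obtain ⟨v₁, hr₁, h1, h2, h3⟩ := hang v hv (L.symm u)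
    have h4 : ‖v₁.1‖ ≤ 2 * n₂ * δ := by
      have e1 := norm_add_le (v₁.1 - L.symm u) (L.symm u)
      rw [sub_add_cancel] at e1
      have e2 := hLs u
      rw [hun] at e2
      linarith
    obtain ⟨v₂, hr₂, h5⟩ := hkick v₁ (by linarith) (by linarith)
    refine ⟨v₂, htrans hr₁ hr₂, ?_⟩
    have h6 : ‖v.2 + ε • u‖ = ‖v.2‖ - ε * δ := by
      have e1 : v.2 + ε • u = (1 - ε * δ / ‖v.2‖) • v.2 := by
        rw [hu, smul_smul, sub_smul, one_smul, sub_eq_add_neg, ← neg_smul]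
        congr 2
        ring
      rw [e1, norm_smul, Real.norm_of_nonneg, sub_mul, one_mul, div_mul_cancel₀ _ hv0.ne']
      rw [sub_nonneg, div_le_one hv0]
      exact hvδ
    have h7 : ‖ε • L (v₁.1 - L.symm u)‖ ≤ ε * (δ / 8) := by
      rw [norm_smul, Real.norm_of_nonneg hε.le]
      gcongr
      exact (hL _).trans (le_trans (by gcongr) hη2)
    have h8 : ‖v₁.2 - v.2‖ ≤ ε * (δ / 8) := by
      refine h2.trans ?_
      calc M * ‖v.2‖ ^ 3 ≤ M * √ε ^ 3 := by gcongr
        _ = √ε ^ 2 * (√ε * M) := by ring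
        _ ≤ √ε ^ 2 * (δ / 8) := by gcongr
        _ = _ := by rw [hsq]
    have h9 : C * (‖v₁.1‖ ^ 2 + ε + ‖v₁.2‖) ≤ δ / 8 + δ / 8 := by
      have e1 : C * ‖v₁.1‖ ^ 2 ≤ C * (2 * n₂ * δ) ^ 2 := by gcongr
      have e2 : C * (ε + ‖v₁.2‖) ≤ C * (3 * √ε) := by
        gcongr
        linarith
      nlinarith
    have h10 : ‖v₂.2 - v₁.2 - ε • L v₁.1‖ ≤ ε * (δ / 8 + δ / 8) := h5.trans (by gcongr)
    have e1 : v₂.2 = (v.2 + ε • u) + ε • L (v₁.1 - L.symm u) + (v₁.2 - v.2) +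
        (v₂.2 - v₁.2 - ε • L v₁.1) := by
      rw [map_sub, L.apply_symm_apply, smul_sub]
      abel
    rw [e1]
    refine (norm_add_le _ _).trans ?_
    have e2 := norm_add₃_le (a := v.2 + ε • u) (b := ε • L (v₁.1 - L.symm u)) (c := v₁.2 - v.2)
    linarith
  have hdesc : ∀ n : ℕ, ∀ v : Cover d, ‖v.2‖ ≤ √ε → ‖v.2‖ ≤ ε * δ + n * (ε * δ / 2) →
      ∃ v' : Cover d, Reach (phaseProj v) (phaseProj v') ∧ ‖v'.2‖ ≤ ε * δ ∧ ‖v'.2‖ ≤ √ε := by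
    intro n
    induction n with
    | zero => intro v hv h; exact ⟨v, hrefl _, by simpa using h, hv⟩
    | succ n ih =>
      intro v hv h
      rcases le_total ‖v.2‖ (ε * δ) with h1 | h1
      · exact ⟨v, hrefl _, h1, hv⟩
      · obtain ⟨v', hr, h2⟩ := hcycle v hv h1
        push_cast at h
        have h3 : 0 < ε * δ := by positivity
        obtain ⟨v'', hr', h4⟩ := ih v' (by linarith) (by linarith)
        exact ⟨v'', htrans hr hr', h4⟩
  -- The actions are decreased to `ε δ` first, and the angle is adjusted at the end.
  intro v hv
  obtain ⟨n, hn⟩ := exists_nat_ge (√ε / (ε * δ / 2))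
  rw [div_le_iff₀ (by positivity)] at hn
  have h0 : 0 < ε * δ := by positivity
  obtain ⟨v₁, hr₁, h1, h2⟩ := hdesc n v hv (by linarith)
  obtain ⟨v₂, hr₂, h3, -, h4⟩ := hang v₁ h2 0
  refine ⟨v₂, htrans hr₁ hr₂, ?_, ?_⟩
  · rw [sub_zero] at h3
    exact h3.trans hηc
  · nlinarith

end Control

/-! ### Words acting as open maps -/

section Openness

variable {d : ℕ}

/-- A continuous linear equivalence with a bound for its inverse, as a right inverse. -/
def rightInverseOfBound (S : Cover d ≃L[ℝ] Cover d) {n : ℝ} (hn : 0 ≤ n)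
    (hS : ∀ z, ‖S.symm z‖ ≤ n * ‖z‖) :
    (S : Cover d →L[ℝ] Cover d).NonlinearRightInverse where
  toFun := S.symm
  nnnorm := ⟨n, hn⟩
  bound' := hS
  right_inv' := S.apply_symm_apply

variable {S : Cover d ≃L[ℝ] Cover d} {n δ : ℝ} {f : Cover d → Cover d} {s : Set (Cover d)}

/-- A map close to a linear equivalence is open. -/
theorem map_nhds_eq_of_near (hn : 0 < n) (hS : ∀ z, ‖S.symm z‖ ≤ n * ‖z‖) (hδ0 : 0 ≤ δ)
    (hδ : δ * n < 1) (hf : ∀ z ∈ s, ∀ w ∈ s, ‖f z - f w - S (z - w)‖ ≤ δ * ‖z - w‖)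
    {z : Cover d} (hz : s ∈ 𝓝 z) : map f (𝓝 z) = 𝓝 (f z) := by
  have h1 : ApproximatesLinearOn f (S : Cover d →L[ℝ] Cover d) s ⟨δ, hδ0⟩ := hf
  refine h1.map_nhds_eq (rightInverseOfBound S hn.le hS) hz (Or.inr ?_)
  have h2 : δ < n⁻¹ := by rwa [← one_div, lt_div_iff₀ hn]
  exact h2

/-- A quantitative inverse function theorem, for maps close to a linear equivalence. -/
theorem exists_preimage_of_near (hn : 0 < n) (hS : ∀ z, ‖S.symm z‖ ≤ n * ‖z‖) (hδ0 : 0 ≤ δ)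
    (hf : ∀ z ∈ s, ∀ w ∈ s, ‖f z - f w - S (z - w)‖ ≤ δ * ‖z - w‖)
    {b y : Cover d} {r : ℝ} (hr : 0 ≤ r) (hb : Metric.closedBall b r ⊆ s)
    (hy : ‖y - f b‖ ≤ (n⁻¹ - δ) * r) : ∃ x, ‖x - b‖ ≤ r ∧ f x = y := by
  have h1 : ApproximatesLinearOn f (S : Cover d →L[ℝ] Cover d) s ⟨δ, hδ0⟩ := hf
  obtain ⟨x, hx, hxy⟩ := h1.surjOn_closedBall_of_nonlinearRightInverse
    (rightInverseOfBound S hn.le hS) (b := b) hr hb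
    (show y ∈ _ by rw [mem_closedBall_iff_norm]; exact hy)
  exact ⟨x, mem_closedBall_iff_norm.1 hx, hxy⟩

theorem isOpenMap_phaseProj : IsOpenMap (phaseProj : Cover d → Phase d) := by
  have h1 : IsOpenMap (torusProj : (Fin d → ℝ) → Torus d) :=
    IsOpenMap.piMap (fun _ => QuotientAddGroup.isOpenMap_coe) (by simp)
  exact h1.prodMap IsOpenMap.id

theorem map_phaseProj_nhds (v : Cover d) : map phaseProj (𝓝 v) = 𝓝 (phaseProj v) :=
  isOpenMap_phaseProj.map_nhds_eq continuous_phaseProj.continuousAt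

theorem phaseProj_surjective : Function.Surjective (phaseProj : Cover d → Phase d) := by
  intro z
  choose φ hφ using fun i => QuotientAddGroup.mk_surjective (z.1 i)
  exact ⟨(φ, z.2), Prod.ext (funext hφ) rfl⟩

/-- A word connects `z` to `z'` if its composition is defined near `z`, where it is continuous and
open, and maps `z` to `z'`. -/
def Connects {ι : Type*} (D : Set (Phase d)) (G : ι → Phase d → Phase d) (z z' : Phase d) : Prop :=
  ∃ w : List ι, (∀ᶠ x in 𝓝 z, x ∈ wordDom D G w) ∧ map (wordMap G w) (𝓝 z) = 𝓝 z'

variable {ι : Type*} {D : Set (Phase d)} {G : ι → Phase d → Phase d}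

theorem Connects.refl (z : Phase d) : Connects D G z z :=
  ⟨[], Eventually.of_forall fun _ => trivial, map_id⟩

theorem Connects.trans {x y z : Phase d} (h : Connects D G x y) (h' : Connects D G y z) :
    Connects D G x z := by
  obtain ⟨w, hw, hm⟩ := h
  obtain ⟨w', hw', hm'⟩ := h'
  refine ⟨w ++ w', ?_, ?_⟩
  · rw [← hm, eventually_map] at hw'
    filter_upwards [hw, hw'] with x h1 h2
    exact (wordDom_append D G w w' x).2 ⟨h1, h2⟩
  · have : wordMap G (w ++ w') = wordMap G w' ∘ wordMap G w :=
      funext fun x => wordMap_append G w w' x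
    rw [this, ← map_map, hm, hm']

theorem connects_of_lift {i : ι} {f : Cover d → Cover d} (hf : ∀ v, G i (phaseProj v) =
    phaseProj (f v)) {v : Cover d} (hv : map f (𝓝 v) = 𝓝 (f v)) (hD : D ∈ 𝓝 (phaseProj v)) :
    Connects D G (phaseProj v) (phaseProj (f v)) := by
  refine ⟨[i], ?_, ?_⟩
  · filter_upwards [hD] with x hx
    exact ⟨hx, trivial⟩
  · change map (id ∘ G i) _ = _
    have h1 : G i ∘ phaseProj = phaseProj ∘ f := funext hf
    rw [Function.id_comp, ← map_phaseProj_nhds, map_map, h1, ← map_map, hv, map_phaseProj_nhds]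

theorem annulus_mem_nhds {v : Cover d} (hv : ‖v.2‖ < 1) : annulus d 1 ∈ 𝓝 (phaseProj v) := by
  have h1 : IsOpen {z : Phase d | ‖z.2‖ < 1} := isOpen_lt continuous_snd.norm continuous_const
  filter_upwards [h1.mem_nhds hv] with z hz
  exact (mem_annulus zero_le_one).2 (le_of_lt hz)

end Openness

/-! ### Connecting the annulus to the centre -/

section Reach

variable {d : ℕ} {A B : Matrix (Fin d) (Fin d) ℝ} {γ e K : ℝ}

/-- The shear `(φ, J) ↦ (φ + A J, J)`. -/
noncomputable def shearEquiv (A : Matrix (Fin d) (Fin d) ℝ) : Cover d ≃L[ℝ] Cover d :=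
  ContinuousLinearEquiv.equivOfInverse (shearMap A 1) (shearMap A (-1))
    (fun z => by simp [shearMap_apply]) (fun z => by simp [shearMap_apply])

theorem shearEquiv_apply (z : Cover d) : shearEquiv A z = (z.1 + A.mulVec z.2, z.2) := by
  change shearMap A 1 z = _
  rw [shearMap_apply, one_smul]

theorem norm_shearEquiv_symm_le {α : ℝ} (hα : 0 ≤ α) (hA : ∀ v, ‖A.mulVec v‖ ≤ α * ‖v‖)
    (z : Cover d) : ‖(shearEquiv A).symm z‖ ≤ (1 + α) * ‖z‖ := by
  change ‖shearMap A (-1) z‖ ≤ _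
  rw [shearMap_apply]
  have h1 := norm_fst_le z
  have h2 := norm_snd_le z
  have h3 : ‖A.mulVec z.2‖ ≤ α * ‖z‖ := (hA _).trans (by gcongr)
  refine max_le ((norm_add_le _ _).trans ?_) ?_
  · rw [neg_smul, one_smul, norm_neg]
    linarith
  · have := mul_nonneg hα (norm_nonneg z)
    change ‖z.2‖ ≤ _
    linarith

namespace PerturbedPair

variable (X : PerturbedPair A B γ e K) {ε : ℝ}

/-- The lift of the twist map. -/
noncomputable def twistCover (ε : ℝ) (z : Cover d) : Cover d :=
  (z.1 + X.β + A.mulVec z.2 + familySlice X.Rφ ε z, z.2 + familySlice X.RJ ε z)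

/-- The lift of the kick. -/
noncomputable def kickCover (ε : ℝ) (z : Cover d) : Cover d :=
  (z.1 + ε • familySlice X.Pφ ε z, z.2 + ε • familySlice X.PJ ε z)

theorem ifs_zero_phaseProj (v : Cover d) :
    X.ifs ε 0 (phaseProj v) = phaseProj (X.twistCover ε v) := by
  change twistMap X.β A X.Rφ X.RJ ε (phaseProj v) = _
  simp only [twistMap, phaseProj, twistCover, familySlice, ← torusProj_add, add_assoc]

theorem ifs_one_phaseProj (v : Cover d) :
    X.ifs ε 1 (phaseProj v) = phaseProj (X.kickCover ε v) := by
  change kickMap X.Pφ X.PJ ε (phaseProj v) = _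
  simp only [kickMap, phaseProj, kickCover, familySlice, ← torusProj_add]

theorem norm_twistCover_sub_le (he : 0 < e) (hε : |ε| ≤ e) {s : ℝ} (hs : s ≤ 1) {z w : Cover d}
    (hz : ‖z.2‖ ≤ s) (hw : ‖w.2‖ ≤ s) :
    ‖X.twistCover ε z - X.twistCover ε w - shearEquiv A (z - w)‖ ≤ K * s * ‖z - w‖ := by
  have hK := X.c2_Rφ.nonneg he
  have hs0 : 0 ≤ s := (norm_nonneg _).trans hz
  have h1 := X.small.norm_angle_sub_le X.c2_Rφ he hε hs hz hw
  have h2 := X.small.norm_action_sub_le X.c2_RJ he hε hs hz hw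
  have e1 : X.twistCover ε z - X.twistCover ε w - shearEquiv A (z - w) =
      (familySlice X.Rφ ε z - familySlice X.Rφ ε w,
        familySlice X.RJ ε z - familySlice X.RJ ε w) := by
    rw [shearEquiv_apply]
    refine Prod.ext ?_ ?_
    · simp only [twistCover, Prod.fst_sub, Prod.snd_sub, Matrix.mulVec_sub]; abel
    · simp only [twistCover, Prod.snd_sub]; abel
  rw [e1]
  refine max_le h1 (h2.trans ?_)
  have : s ^ 2 ≤ s := by nlinarith
  gcongr

theorem norm_kickCover_sub_le (he : 0 < e) (hε0 : 0 ≤ ε) (hε : |ε| ≤ e) {z w : Cover d}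
    (hz : ‖z.2‖ ≤ 1) (hw : ‖w.2‖ ≤ 1) :
    ‖X.kickCover ε z - X.kickCover ε w - ContinuousLinearEquiv.refl ℝ (Cover d) (z - w)‖ ≤
      ε * K * ‖z - w‖ := by
  have key : ∀ {F : ℝ → Torus d → (Fin d → ℝ) → (Fin d → ℝ)}, IsC2Family e K F →
      ‖ε • (familySlice F ε z - familySlice F ε w)‖ ≤ ε * K * ‖z - w‖ := by
    intro F hF
    have := hF.norm_slice_sub_le hε (convex_norm_snd_le 1) (fun _ h => h) (L := 0) (C := K)
      (fun y hy => by rw [sub_zero]; exact hF.norm_spaceDeriv_le he hε hy) hz hw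
    rw [_root_.zero_apply, sub_zero] at this
    rw [norm_smul, Real.norm_of_nonneg hε0, mul_assoc]
    gcongr
  have e1 : X.kickCover ε z - X.kickCover ε w - (z - w) =
      (ε • (familySlice X.Pφ ε z - familySlice X.Pφ ε w),
        ε • (familySlice X.PJ ε z - familySlice X.PJ ε w)) := by
    refine Prod.ext ?_ ?_
    · simp only [kickCover, Prod.fst_sub, smul_sub]; abel
    · simp only [kickCover, Prod.snd_sub, smul_sub]; abel
  change ‖X.kickCover ε z - X.kickCover ε w - (z - w)‖ ≤ _
  rw [e1]
  exact max_le (key X.c2_Pφ) (key X.c2_PJ)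

theorem norm_angle_le (he : 0 < e) (hε : |ε| ≤ e) {z : Cover d} (hz : ‖z.2‖ ≤ 1) :
    ‖familySlice X.Rφ ε z‖ ≤ K * ‖z.2‖ ^ 2 := by
  have h := X.small.norm_angle_sub_le X.c2_Rφ he hε hz le_rfl (y' := (z.1, 0)) (by simp)
  have h1 : familySlice X.Rφ ε (z.1, 0) = 0 := X.small.angle_eq_zero hε _
  have h2 : ‖z - (z.1, 0)‖ = ‖z.2‖ := by simp [Prod.norm_def]
  rw [h1, sub_zero, h2] at h
  linarith

theorem norm_action_le (he : 0 < e) (hε : |ε| ≤ e) {z : Cover d} (hz : ‖z.2‖ ≤ 1) :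
    ‖familySlice X.RJ ε z‖ ≤ K * ‖z.2‖ ^ 3 := by
  have h := X.small.norm_action_sub_le X.c2_RJ he hε hz le_rfl (y' := (z.1, 0)) (by simp)
  have h1 : familySlice X.RJ ε (z.1, 0) = 0 := X.small.action_eq_zero hε _
  have h2 : ‖z - (z.1, 0)‖ = ‖z.2‖ := by simp [Prod.norm_def]
  rw [h1, sub_zero, h2] at h
  linarith

/-- The action part of the kick is `B φ` up to quadratic terms in the angle, and terms of the order
of `ε` and of the actions. -/
theorem norm_kick_sub_le (he : 0 < e) (hε0 : 0 ≤ ε) (hε : |ε| ≤ e) {z : Cover d}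
    (hz : ‖z.2‖ ≤ 1) :
    ‖familySlice X.PJ ε z - B.mulVec z.1‖ ≤ K * (‖z.1‖ ^ 2 + ε + ‖z.2‖) := by
  have hK := X.c2_Rφ.nonneg he
  have h0 : |(0 : ℝ)| ≤ e := by simpa using he.le
  have h1 := X.c2_PJ.norm_param_sub_le he hε h0 (y := z) (y' := (z.1, 0)) hz (by simp)
  have h2 : ‖z - (z.1, 0)‖ = ‖z.2‖ := by simp [Prod.norm_def]
  rw [h2, sub_zero, abs_of_nonneg hε0] at h1
  have h3 := X.c2_PJ.norm_slice_sub_le h0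
    ((convex_closedBall (0 : Cover d) ‖z.1‖).inter (convex_norm_snd_le 1)) (fun y hy => hy.2)
    (L := spaceDeriv e X.PJ 0 0) (C := K * ‖z.1‖) (fun y hy => by
      refine (X.c2_PJ.norm_spaceDeriv_sub_le he h0 h0 hy.2 (by simp)).trans ?_
      rw [sub_self, abs_zero, sub_zero, max_eq_right (norm_nonneg _)]
      gcongr
      exact mem_closedBall_zero_iff.1 hy.1) (y := (z.1, 0)) (y' := 0)
    ⟨mem_closedBall_zero_iff.2 (by simp [Prod.norm_def]), by simp⟩
    ⟨mem_closedBall_zero_iff.2 (by simp), by simp⟩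
  have h4 : familySlice X.PJ 0 0 = 0 := by
    have : torusProj (0 : Fin d → ℝ) = 0 := by funext i; simp [torusProj]
    change X.PJ 0 (torusProj 0) 0 = 0
    rw [this]
    exact X.torsion.1
  have h5 : ‖((z.1, 0) : Cover d)‖ = ‖z.1‖ := by simp [Prod.norm_def]
  rw [h4, sub_zero, sub_zero, X.torsion.spaceDeriv_eq X.c2_PJ he, h5] at h3
  have h6 : max ε ‖z.2‖ ≤ ε + ‖z.2‖ := max_le (by linarith [norm_nonneg z.2]) (by linarith)
  have h7 : K * max ε ‖z.2‖ ≤ K * (ε + ‖z.2‖) := by gcongr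
  have e1 : familySlice X.PJ ε z - B.mulVec z.1 = (familySlice X.PJ ε z -
      familySlice X.PJ 0 (z.1, 0)) + (familySlice X.PJ 0 (z.1, 0) - B.mulVec z.1) := by abel
  rw [e1]
  refine (norm_add_le _ _).trans ?_
  linarith

theorem norm_kick_le (hε : |ε| ≤ e) {z : Cover d} (hz : ‖z.2‖ ≤ 1) :
    ‖X.kickCover ε z - z‖ ≤ |ε| * K := by
  have key : ∀ {F : ℝ → Torus d → (Fin d → ℝ) → (Fin d → ℝ)}, IsC2Family e K F →
      ‖ε • familySlice F ε z‖ ≤ |ε| * K := by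
    intro F hF
    rw [norm_smul, Real.norm_eq_abs]
    gcongr
    exact hF.norm_le (x := (ε, z)) (mem_familyDomain.2 ⟨hε, hz⟩)
  have e1 : X.kickCover ε z - z = (ε • familySlice X.Pφ ε z, ε • familySlice X.PJ ε z) := by
    refine Prod.ext ?_ ?_ <;> simp [kickCover]
  rw [e1]
  exact max_le (key X.c2_Pφ) (key X.c2_PJ)

theorem connects_twist (he : 0 < e) (hε : |ε| ≤ e) {α : ℝ} (hα : 0 ≤ α)
    (hA : ∀ v, ‖A.mulVec v‖ ≤ α * ‖v‖) {s : ℝ} (hs : s ≤ 1) (hKs : K * s * (1 + α) < 1)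
    {v : Cover d} (hv : ‖v.2‖ < s) :
    Connects (annulus d 1) (X.ifs ε) (phaseProj v) (phaseProj (X.twistCover ε v)) := by
  have hK := X.c2_Rφ.nonneg he
  have hs0 : 0 ≤ s := (norm_nonneg _).trans hv.le
  refine connects_of_lift (i := 0) X.ifs_zero_phaseProj ?_ (annulus_mem_nhds (by linarith))
  have h1 : IsOpen {z : Cover d | ‖z.2‖ < s} := isOpen_lt continuous_snd.norm continuous_const
  exact map_nhds_eq_of_near (by positivity) (norm_shearEquiv_symm_le hα hA) (by positivity) hKs
    (fun z hz w hw => X.norm_twistCover_sub_le he hε hs (le_of_lt hz) (le_of_lt hw))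
    (h1.mem_nhds hv)

theorem connects_kick (he : 0 < e) (hε0 : 0 ≤ ε) (hε : |ε| ≤ e) (hKε : ε * K < 1) {v : Cover d}
    (hv : ‖v.2‖ < 1) :
    Connects (annulus d 1) (X.ifs ε) (phaseProj v) (phaseProj (X.kickCover ε v)) := by
  have hK := X.c2_Rφ.nonneg he
  refine connects_of_lift (i := 1) X.ifs_one_phaseProj ?_ (annulus_mem_nhds hv)
  have h1 : IsOpen {z : Cover d | ‖z.2‖ < 1} := isOpen_lt continuous_snd.norm continuous_const
  exact map_nhds_eq_of_near (n := 1) one_pos (fun z => by simp) (by positivity) (by linarith)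
    (fun z hz w hw => X.norm_kickCover_sub_le he hε0 hε (le_of_lt hz) (le_of_lt hw))
    (h1.mem_nhds hv)

/-- One step of the twist map is close to the translation of the angle by `β`, with a cubic drift of
the actions. -/
theorem norm_twistCover_drift (he : 0 < e) (hε : |ε| ≤ e) {α : ℝ}
    (hA : ∀ v, ‖A.mulVec v‖ ≤ α * ‖v‖) {v : Cover d} (hv : ‖v.2‖ ≤ 1) :
    ‖(X.twistCover ε v).2 - v.2‖ ≤ K * ‖v.2‖ ^ 3 ∧
      ‖(X.twistCover ε v).1 - v.1 - X.β‖ ≤ (α + K) * ‖v.2‖ := by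
  have hK := X.c2_Rφ.nonneg he
  constructor
  · have : (X.twistCover ε v).2 - v.2 = familySlice X.RJ ε v := by simp [twistCover]
    rw [this]
    exact X.norm_action_le he hε hv
  · have : (X.twistCover ε v).1 - v.1 - X.β = A.mulVec v.2 + familySlice X.Rφ ε v := by
      simp only [twistCover]; abel
    rw [this]
    refine (norm_add_le _ _).trans ?_
    have h1 := X.norm_angle_le he hε hv
    have h2 : K * ‖v.2‖ ^ 2 ≤ K * ‖v.2‖ := by
      gcongr
      rw [pow_two]
      exact mul_le_of_le_one_left (norm_nonneg _) hv
    linarith [hA v.2]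

theorem exists_twist_preimage (he : 0 < e) (hε : |ε| ≤ e) {α : ℝ} (hα : 0 ≤ α)
    (hA : ∀ v, ‖A.mulVec v‖ ≤ α * ‖v‖) {v : Cover d} (hv : 2 * ‖v.2‖ ≤ 1)
    (hKv : 3 * K * ‖v.2‖ * (1 + α) ≤ 1) :
    ∃ x : Cover d, ‖x.2‖ ≤ 2 * ‖v.2‖ ∧ X.twistCover ε x = v := by
  have hK := X.c2_Rφ.nonneg he
  have hv0 := norm_nonneg v.2
  set b : Cover d := (v.1 - X.β - A.mulVec v.2, v.2) with hb
  have h1 : v - X.twistCover ε b = -(familySlice X.Rφ ε b, familySlice X.RJ ε b) := by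
    refine Prod.ext ?_ ?_
    · simp only [twistCover, hb, Prod.fst_sub, Prod.fst_neg]; abel
    · simp only [twistCover, hb, Prod.snd_sub, Prod.snd_neg]; abel
  have h2 : ‖v - X.twistCover ε b‖ ≤ K * ‖v.2‖ ^ 2 := by
    rw [h1, norm_neg]
    refine max_le (X.norm_angle_le he hε (z := b) (by change ‖v.2‖ ≤ 1; linarith))
      ((X.norm_action_le he hε (z := b) (by change ‖v.2‖ ≤ 1; linarith)).trans ?_)
    change K * ‖v.2‖ ^ 3 ≤ _
    gcongr K * ?_
    exact pow_le_pow_of_le_one hv0 (by linarith) (by norm_num)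
  have hball : ∀ y ∈ Metric.closedBall b ‖v.2‖, ‖y.2‖ ≤ 2 * ‖v.2‖ := by
    intro y hy
    have h3 := (norm_snd_le (y - b)).trans (mem_closedBall_iff_norm.1 hy)
    have h4 := norm_add_le (y.2 - b.2) b.2
    rw [sub_add_cancel] at h4
    change ‖y.2 - v.2‖ ≤ _ at h3
    change ‖y.2‖ ≤ ‖y.2 - v.2‖ + ‖v.2‖ at h4
    linarith
  have h5 : 3 * K * ‖v.2‖ ≤ (1 + α)⁻¹ := by
    rw [← one_div, le_div_iff₀ (by positivity)]
    exact hKv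
  obtain ⟨x, hx, hxv⟩ := exists_preimage_of_near (f := X.twistCover ε) (S := shearEquiv A)
    (n := 1 + α) (δ := K * (2 * ‖v.2‖)) (s := {y | ‖y.2‖ ≤ 2 * ‖v.2‖}) (by positivity)
    (norm_shearEquiv_symm_le hα hA) (by positivity)
    (fun z hz w hw => X.norm_twistCover_sub_le he hε hv hz hw) hv0 hball (y := v) (by
      refine h2.trans ?_
      rw [pow_two, ← mul_assoc]
      refine mul_le_mul_of_nonneg_right ?_ hv0
      linarith)
  exact ⟨x, hball x (mem_closedBall_iff_norm.2 hx), hxv⟩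

theorem exists_kick_preimage (he : 0 < e) (hε0 : 0 ≤ ε) (hε : |ε| ≤ e) {v : Cover d}
    (hv : 2 * ‖v.2‖ ≤ 1) (hKε : 4 * (ε * K) ≤ 1) :
    ∃ x : Cover d, ‖x - v‖ ≤ 2 * (ε * K) ∧ X.kickCover ε x = v := by
  have hK := X.c2_Rφ.nonneg he
  have hball : ∀ y ∈ Metric.closedBall v (2 * (ε * K)), ‖y.2‖ ≤ 1 := by
    intro y hy
    have h3 := (norm_snd_le (y - v)).trans (mem_closedBall_iff_norm.1 hy)
    have h4 := norm_add_le (y.2 - v.2) v.2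
    rw [sub_add_cancel] at h4
    rw [Prod.snd_sub] at h3
    linarith
  have h1 := X.norm_kick_le hε (z := v) (by linarith [norm_nonneg v.2])
  rw [abs_of_nonneg hε0] at h1
  have h2 : 0 ≤ ε * K := by positivity
  exact exists_preimage_of_near (f := X.kickCover ε) (S := ContinuousLinearEquiv.refl ℝ _)
    (n := 1) (δ := ε * K) (s := {y | ‖y.2‖ ≤ 1}) one_pos (fun z => by simp) h2
    (fun z hz w hw => X.norm_kickCover_sub_le he hε0 hε hz hw) (by positivity) hball (y := v) (by
      rw [norm_sub_rev]
      refine h1.trans ?_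
      nlinarith)

/-- The inverse of the kick changes the actions by `- ε B φ`, up to the same errors as the kick. -/
theorem exists_kick_preimage_sub_le (he : 0 < e) (hε : 0 < ε) (hεe : |ε| ≤ e) {n₁ : ℝ}
    (hn₁ : 0 ≤ n₁) (hBn : ∀ x, ‖B.mulVec x‖ ≤ n₁ * ‖x‖) {v : Cover d} (hv : 4 * ‖v.2‖ ≤ 1)
    (hKε : 16 * (ε * K) < 1) :
    ∃ x : Cover d, Connects (annulus d 1) (X.ifs ε) (phaseProj x) (phaseProj v) ∧
      ‖x.2 - v.2 + ε • B.mulVec v.1‖ ≤ ε * (2 * K * ‖v.1‖ ^ 2 + K * ‖v.2‖ +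
        (K + 10 * K ^ 2 + 2 * n₁ * K) * ε) := by
  have hK := X.c2_Rφ.nonneg he
  obtain ⟨x, hx, hxv⟩ := X.exists_kick_preimage he hε.le hεe (v := v)
    (by linarith [norm_nonneg v.2]) (by linarith [mul_nonneg hε.le hK])
  have hεK := mul_nonneg hε.le hK
  have hx1 := (norm_fst_le (x - v)).trans hx
  have hx2 := (norm_snd_le (x - v)).trans hx
  rw [Prod.fst_sub] at hx1
  rw [Prod.snd_sub] at hx2
  have h2 : ‖x.2‖ ≤ ‖v.2‖ + 2 * (ε * K) := by
    have := norm_add_le (x.2 - v.2) v.2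
    rw [sub_add_cancel] at this
    linarith
  have h3 : ‖x.1‖ ≤ ‖v.1‖ + 2 * (ε * K) := by
    have := norm_add_le (x.1 - v.1) v.1
    rw [sub_add_cancel] at this
    linarith
  have hc := X.connects_kick he hε.le hεe (v := x) (by linarith) (by linarith)
  rw [hxv] at hc
  refine ⟨x, hc, ?_⟩
  have h1 := X.norm_kick_sub_le he hε.le hεe (z := x) (by linarith)
  have e2 : v.2 = x.2 + ε • familySlice X.PJ ε x := by rw [← hxv]; rfl
  have e1 : x.2 - v.2 + ε • B.mulVec v.1 =
      -(ε • ((familySlice X.PJ ε x - B.mulVec x.1) + B.mulVec (x.1 - v.1))) := by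
    rw [e2, Matrix.mulVec_sub]
    simp only [smul_add, smul_sub]
    abel
  rw [e1, norm_neg, norm_smul, Real.norm_of_nonneg hε.le]
  refine mul_le_mul_of_nonneg_left ?_ hε.le
  have h4 := (hBn (x.1 - v.1)).trans (mul_le_mul_of_nonneg_left hx1 hn₁)
  have h5 : ‖x.1‖ ^ 2 ≤ 2 * ‖v.1‖ ^ 2 + 8 * (K * ε) := by
    have h6 : ‖x.1‖ ^ 2 ≤ (‖v.1‖ + 2 * (ε * K)) ^ 2 := pow_le_pow_left₀ (norm_nonneg _) h3 2
    nlinarith [sq_nonneg (‖v.1‖ - 2 * (ε * K))]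
  refine (norm_add_le _ _).trans ((add_le_add h1 h4).trans ?_)
  have h8 : K * (‖x.1‖ ^ 2 + ε + ‖x.2‖) ≤
      K * ((2 * ‖v.1‖ ^ 2 + 8 * (K * ε)) + ε + (‖v.2‖ + 2 * (ε * K))) :=
    mul_le_mul_of_nonneg_left (by linarith) hK
  linarith

/-- Every point of the annulus of width `√ε` is connected to a point of the region where the return
maps are defined, and vice versa. -/
theorem eventually_connects (hγ : 0 < γ) (he : 0 < e) (hB : B.det ≠ 0) {c : ℝ} (hc : 0 < c) :
    ∀ᶠ ε in 𝓝[>] (0 : ℝ), ∀ X : PerturbedPair A B γ e K, ∀ v : Cover d, ‖v.2‖ ≤ √ε →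
      (∃ v' : Cover d, Connects (annulus d 1) (X.ifs ε) (phaseProj v) (phaseProj v') ∧
        ‖v'.1‖ ≤ c ∧ ‖v'.2‖ ≤ c * ε) ∧
      (∃ v' : Cover d, Connects (annulus d 1) (X.ifs ε) (phaseProj v') (phaseProj v) ∧
        ‖v'.1‖ ≤ c ∧ ‖v'.2‖ ≤ c * ε) := by
  obtain ⟨L, hL⟩ := exists_equiv_mulVec hB
  set α := ‖LinearMap.toContinuousLinearMap (Matrix.toLin' A)‖ with hα
  have hα0 : 0 ≤ α := norm_nonneg _
  have hαA : ∀ v, ‖A.mulVec v‖ ≤ α * ‖v‖ := fun v =>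
    (LinearMap.toContinuousLinearMap (Matrix.toLin' A)).le_opNorm v
  set n₁ := ‖(L : (Fin d → ℝ) →L[ℝ] (Fin d → ℝ))‖ with hn₁
  have hn₁0 : 0 ≤ n₁ := norm_nonneg _
  set κ := |K| with hκ
  have hκ0 : 0 ≤ κ := abs_nonneg _
  set C := 1 + 8 * κ + 2 * (α + κ) + 10 * κ ^ 2 + 2 * n₁ * κ with hC
  have hC0 : 0 < C := by positivity
  have hsqrt : Tendsto Real.sqrt (𝓝[>] 0) (𝓝 0) := by
    have := Real.continuous_sqrt.tendsto 0
    rw [Real.sqrt_zero] at this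
    exact this.mono_left nhdsWithin_le_nhds
  have hs : ∀ᶠ ε in 𝓝[>] (0 : ℝ), √ε < 1 / (16 * (κ + 1) * (1 + α)) :=
    hsqrt.eventually_lt_const (by positivity)
  filter_upwards [exists_control hγ hC0 L hc,
    exists_control hγ hC0 (L.trans (ContinuousLinearEquiv.neg ℝ)) hc, hs, eventually_pos_le he,
    eventually_pos_le one_pos] with ε hf hb hs ⟨hε, hεe⟩ ⟨_, hε1⟩ X v hv
  have hK := X.c2_Rφ.nonneg he
  have hκK : κ = K := abs_of_nonneg hK
  rw [hκK] at hC hs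
  have hεa : |ε| ≤ e := by rwa [abs_of_pos hε]
  rw [lt_div_iff₀ (by positivity)] at hs
  have hs0 : 0 < √ε := Real.sqrt_pos.2 hε
  have hsq : √ε ^ 2 = ε := Real.sq_sqrt hε.le
  have hs1 : 16 * √ε < 1 ∧ 16 * (K * √ε * (1 + α)) < 1 := by
    have h1 : 0 ≤ √ε * K := by positivity
    have h2 : 0 ≤ √ε * α := by positivity
    have h3 : 0 ≤ √ε * K * α := by positivity
    constructor <;> nlinarith
  obtain ⟨hs1, hs2⟩ := hs1
  have hKs : 16 * (K * √ε) < 1 := by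
    have : 0 ≤ K * √ε * α := by positivity
    linarith
  have hεs : ε ≤ √ε := by nlinarith
  have hKε : 16 * (ε * K) < 1 := by
    have : ε * K ≤ √ε * K := by gcongr
    linarith
  have hCK : 8 * K ≤ C ∧ 2 * (α + K) ≤ C := by
    have h1 : 0 ≤ K ^ 2 := by positivity
    have h2 : 0 ≤ n₁ * K := by positivity
    constructor <;> linarith
  have hBn : ∀ x, ‖B.mulVec x‖ ≤ n₁ * ‖x‖ := fun x => by
    rw [← hL]
    exact (L : (Fin d → ℝ) →L[ℝ] (Fin d → ℝ)).le_opNorm x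
  constructor
  · refine hf X.constantType (Reach := Connects (annulus d 1) (X.ifs ε)) Connects.refl
      (fun h h' => h.trans h') (fun v hv => ?_) (fun v hv1 hv => ?_) v hv
    · obtain ⟨h1, h2⟩ := X.norm_twistCover_drift he hεa hαA (v := v) (by linarith)
      refine ⟨X.twistCover ε v, X.connects_twist he hεa hα0 hαA (s := 4 * √ε) (by linarith)
        (by linarith) (by linarith), h1.trans ?_, h2.trans ?_⟩
      · gcongr; linarith [hCK.1]
      · gcongr; linarith [hCK.2, add_nonneg hα0 hK]
    · refine ⟨X.kickCover ε v, X.connects_kick he hε.le hεa (by linarith) (by linarith), ?_⟩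
      have h1 := X.norm_kick_sub_le he hε.le hεa (z := v) (by linarith)
      have e1 : (X.kickCover ε v).2 - v.2 - ε • L v.1 =
          ε • (familySlice X.PJ ε v - B.mulVec v.1) := by
        rw [hL, smul_sub]
        simp only [kickCover]
        abel
      rw [e1, norm_smul, Real.norm_of_nonneg hε.le]
      gcongr
      refine h1.trans ?_
      gcongr
      linarith [hCK.1]
  -- For backward orbits, the angle is translated by `-β` and the kick acts by `-B`.
  · refine hb X.constantType.neg (Reach := fun z z' => Connects (annulus d 1) (X.ifs ε) z' z)
      Connects.refl (fun h h' => h'.trans h) (fun v hv => ?_) (fun v hv1 hv => ?_) v hv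
    · have hKv : K * ‖v.2‖ * (1 + α) ≤ K * (2 * √ε) * (1 + α) := by gcongr
      obtain ⟨x, hx, rfl⟩ := X.exists_twist_preimage he hεa hα0 hαA (v := v) (by linarith)
        (by linarith)
      obtain ⟨h1, h2⟩ := X.norm_twistCover_drift he hεa hαA (v := x) (by linarith)
      set y := X.twistCover ε x
      refine ⟨x, X.connects_twist he hεa hα0 hαA (s := 5 * √ε) (by linarith)
        (by linarith) (by linarith), ?_, ?_⟩
      · rw [norm_sub_rev]
        have h3 : K * ‖x.2‖ ^ 3 ≤ K * (2 * ‖y.2‖) ^ 3 := by gcongr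
        have h4 : 8 * K * ‖y.2‖ ^ 3 ≤ C * ‖y.2‖ ^ 3 := by gcongr; exact hCK.1
        linarith
      · have e1 : x.1 - y.1 - -X.β = -(y.1 - x.1 - X.β) := by abel
        rw [e1, norm_neg]
        have h3 : (α + K) * ‖x.2‖ ≤ (α + K) * (2 * ‖y.2‖) := by gcongr
        have h4 : 2 * (α + K) * ‖y.2‖ ≤ C * ‖y.2‖ := by gcongr; exact hCK.2
        linarith
    · obtain ⟨x, hx, h1⟩ := X.exists_kick_preimage_sub_le he hε hεa hn₁0 hBn (v := v)
        (by linarith) hKε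
      refine ⟨x, hx, ?_⟩
      have e1 : x.2 - v.2 - ε • (L.trans (ContinuousLinearEquiv.neg ℝ)) v.1 =
          x.2 - v.2 + ε • B.mulVec v.1 := by
        have : (L.trans (ContinuousLinearEquiv.neg ℝ)) v.1 = -B.mulVec v.1 := by
          rw [← hL]; rfl
        rw [this, smul_neg, sub_neg_eq_add]
      rw [e1]
      refine h1.trans (mul_le_mul_of_nonneg_left ?_ hε.le)
      have h9 : 2 * K * ‖v.1‖ ^ 2 ≤ C * ‖v.1‖ ^ 2 :=
        mul_le_mul_of_nonneg_right (by linarith [hCK.1]) (by positivity)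
      have h10 : K * ‖v.2‖ ≤ C * ‖v.2‖ :=
        mul_le_mul_of_nonneg_right (by linarith [hCK.1]) (norm_nonneg _)
      have h11 : (K + 10 * K ^ 2 + 2 * n₁ * K) * ε ≤ C * ε :=
        mul_le_mul_of_nonneg_right (by linarith) hε.le
      linarith

end PerturbedPair

end Reach

/-! ### Mixing and blenders for small parameters -/

section Mixing

variable {d : ℕ}

/-- A relatively open subset of the annulus contains interior points of the annulus. -/
theorem exists_mem_norm_lt_of_isOpen {U : Set (Phase d)} (hU : IsOpen U) {r : ℝ} (hr : 0 < r)
    (h : (U ∩ annulus d r).Nonempty) : ∃ v : Cover d, phaseProj v ∈ U ∧ ‖v.2‖ < r := by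
  obtain ⟨z, hz, hzr⟩ := h
  obtain ⟨v, rfl⟩ := phaseProj_surjective z
  rw [mem_annulus hr.le] at hzr
  have h1 : Tendsto (fun t : ℝ => phaseProj (v.1, (1 - t) • v.2)) (𝓝[>] 0) (𝓝 (phaseProj v)) := by
    have h2 : Continuous fun t : ℝ => phaseProj (v.1, (1 - t) • v.2) :=
      continuous_phaseProj.comp (by fun_prop)
    have h3 := h2.tendsto 0
    simp only [sub_zero, one_smul] at h3
    exact h3.mono_left nhdsWithin_le_nhds
  obtain ⟨t, ht, ht0, ht1⟩ := ((h1.eventually (hU.mem_nhds hz)).and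
    (eventually_pos_le one_pos)).exists
  refine ⟨_, ht, ?_⟩
  change ‖(1 - t) • v.2‖ < r
  rw [norm_smul, Real.norm_of_nonneg (by linarith)]
  change ‖v.2‖ ≤ r at hzr
  nlinarith [norm_nonneg v.2]

/-- If all large lengths are realised by orbits between neighbourhoods of points of `O`, and every
point of the annulus is connected to a point of `O` and from a point of `O`, then the words of the
connections can be put before and after, because they act as open maps. -/
theorem isTopMixingOn_of_connects {ι : Type*} {D : Set (Phase d)} {G : ι → Phase d → Phase d}
    {r : ℝ} (hr : 0 < r) {O : Set (Phase d)}
    (hO : ∀ p ∈ O, ∀ q ∈ O, ∀ U ∈ 𝓝 p, ∀ V ∈ 𝓝 q, ∃ L₀ : ℕ, ∀ L, L₀ ≤ L →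
      ∃ x : List ι, x.length = L ∧ ∃ z ∈ U, z ∈ wordDom D G x ∧ wordMap G x z ∈ V)
    (hto : ∀ v : Cover d, ‖v.2‖ ≤ r → ∃ p ∈ O, Connects D G (phaseProj v) p)
    (hfrom : ∀ v : Cover d, ‖v.2‖ ≤ r → ∃ p ∈ O, Connects D G p (phaseProj v)) :
    IsTopMixingOn D G (annulus d r) := by
  intro U₀ U₁ hU₀ hU₁ h₀ h₁
  obtain ⟨v₀, hv₀, hr₀⟩ := exists_mem_norm_lt_of_isOpen hU₀ hr h₀
  obtain ⟨v₁, hv₁, hr₁⟩ := exists_mem_norm_lt_of_isOpen hU₁ hr h₁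
  obtain ⟨p, hp, w₀, hd₀, hm₀⟩ := hto v₀ hr₀.le
  obtain ⟨q, hq, w₁, hd₁, hm₁⟩ := hfrom v₁ hr₁.le
  have hnhds : ∀ {U : Set (Phase d)}, IsOpen U → ∀ {v : Cover d}, phaseProj v ∈ U → ‖v.2‖ < r →
      U ∩ annulus d r ∈ 𝓝 (phaseProj v) := by
    intro U hU v hv hvr
    have h1 : IsOpen {z : Phase d | ‖z.2‖ < r} := isOpen_lt (by fun_prop) continuous_const
    filter_upwards [hU.mem_nhds hv, h1.mem_nhds hvr] with z hz hzr
    exact ⟨hz, (mem_annulus hr.le).2 (le_of_lt hzr)⟩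
  have hU : wordMap G w₀ '' (U₀ ∩ annulus d r ∩ wordDom D G w₀) ∈ 𝓝 p := by
    rw [← hm₀]
    exact image_mem_map (inter_mem (hnhds hU₀ hv₀ hr₀) hd₀)
  have hV : wordDom D G w₁ ∩ wordMap G w₁ ⁻¹' (U₁ ∩ annulus d r) ∈ 𝓝 q := by
    refine inter_mem hd₁ (mem_map.1 ?_)
    rw [hm₁]
    exact hnhds hU₁ hv₁ hr₁
  obtain ⟨L₀, hL₀⟩ := hO p hp q hq _ hU _ hV
  refine ⟨L₀ + w₀.length + w₁.length, fun L hL => ?_⟩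
  obtain ⟨x, hx, _, ⟨z, ⟨hz, hzd⟩, rfl⟩, hzx, hzd₁, hz₁⟩ :=
    hL₀ (L - w₀.length - w₁.length) (by omega)
  refine ⟨w₀ ++ (x ++ w₁), by simp only [List.length_append]; omega,
    wordMap G (w₀ ++ (x ++ w₁)) z, ⟨z, ⟨hz, ?_⟩, rfl⟩, ?_⟩
  · exact (wordDom_append _ _ _ _ _).2 ⟨hzd, (wordDom_append _ _ _ _ _).2 ⟨hzx, hzd₁⟩⟩
  · rw [wordMap_append, wordMap_append]
    exact hz₁

/-- Small angles, with actions of order `ε`, are in the ball of radius `ρ` of the chart. -/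
theorem exists_chart_scaledChart_eq (Λ : Cover d ≃L[ℝ] Cover d) {ε : ℝ} (hε : 0 < ε) {c ρ : ℝ}
    (hcρ : ‖(Λ.symm : Cover d →L[ℝ] Cover d)‖ * c < ρ) {v : Cover d}
    (h1 : ‖v.1‖ ≤ c) (h2 : ‖v.2‖ ≤ c * ε) :
    ∃ u : Cover d, ‖u‖ < ρ ∧ chart (scaledChart Λ hε.ne') u = phaseProj v := by
  refine ⟨Λ.symm (v.1, ε⁻¹ • v.2), ?_, ?_⟩
  · refine ((Λ.symm : Cover d →L[ℝ] Cover d).le_opNorm _).trans_lt (lt_of_le_of_lt ?_ hcρ)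
    refine mul_le_mul_of_nonneg_left (max_le h1 ?_) (norm_nonneg _)
    change ‖ε⁻¹ • v.2‖ ≤ c
    rw [norm_smul, Real.norm_of_nonneg (by positivity), inv_mul_le_iff₀ hε, mul_comm]
    exact h2
  · rw [chart_scaledChart, Λ.apply_symm_apply]
    change phaseProj (v.1, ε • ε⁻¹ • v.2) = _
    rw [smul_inv_smul₀ hε.ne']

/-- The threshold for `ε` depends only on `d`, `A`, `B`, `γ`, `e` and `K`: the pair of families is
quantified after `ε`. -/
theorem PerturbedPair.eventually_blender_and_mixing {A B : Matrix (Fin d) (Fin d) ℝ} {γ e K : ℝ}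
    (hγ : 0 < γ) (he : 0 < e) (h : SimpleRealNonzeroSpectrum (A * B)) :
    ∀ᶠ ε in 𝓝[>] (0 : ℝ), ∀ X : PerturbedPair A B γ e K,
      HasSymbolicDoubleBlender (annulus d 1) (X.ifs ε) ∧
        IsTopMixingOn (annulus d 1) (X.ifs ε) (annulus d √ε) := by
  obtain ⟨Λ, ρ, hρ, hret⟩ := exists_returnSystem (K := K) hγ he h
  have hB : B.det ≠ 0 := by
    have := h.det_ne_zero
    rw [Matrix.det_mul] at this
    exact right_ne_zero_of_mul this
  set N := ‖(Λ.symm : Cover d →L[ℝ] Cover d)‖ with hN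
  have hN0 : 0 ≤ N := norm_nonneg _
  have hc : 0 < ρ / (N + 1) := by positivity
  have hNc : N * (ρ / (N + 1)) < ρ := by
    rw [mul_div_assoc', div_lt_iff₀ (by positivity)]
    linarith
  filter_upwards [hret, eventually_connects (A := A) (K := K) hγ he hB hc, self_mem_nhdsWithin]
    with ε ⟨_, hret⟩ hcon hε X
  have hε : 0 < ε := hε
  obtain ⟨W, w, w', F, F', S, hF', hF'0, hlen⟩ := hret X
  refine ⟨S.hasSymbolicDoubleBlender, isTopMixingOn_of_connects (Real.sqrt_pos.2 hε)
    (O := chart (scaledChart Λ hε.ne') '' Metric.ball 0 ρ) ?_ (fun v hv => ?_) fun v hv => ?_⟩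
  · rintro _ ⟨u, hu, rfl⟩ _ ⟨v, hv, rfl⟩ U hU V hV
    exact S.exists_connection hF' hF'0 hlen (mem_ball_zero_iff.1 hu) (mem_ball_zero_iff.1 hv) hU hV
  · obtain ⟨v', h1, h2, h3⟩ := (hcon X v hv).1
    obtain ⟨u, hu, huv⟩ := exists_chart_scaledChart_eq Λ hε hNc h2 h3
    exact ⟨_, ⟨u, mem_ball_zero_iff.2 hu, rfl⟩, huv ▸ h1⟩
  · obtain ⟨v', h1, h2, h3⟩ := (hcon X v hv).2
    obtain ⟨u, hu, huv⟩ := exists_chart_scaledChart_eq Λ hε hNc h2 h3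
    exact ⟨_, ⟨u, mem_ball_zero_iff.2 hu, rfl⟩, huv ▸ h1⟩

end Mixing

theorem mainTheorem3 (d : ℕ) (hd : 1 ≤ d) (A B : Matrix (Fin d) (Fin d) ℝ)
    (γ : ℝ) (hγ : 0 < γ) (e : ℝ) (he : 0 < e) (K : ℝ) :
    ∃ ε₀ : ℝ, 0 < ε₀ ∧ ε₀ ≤ e ∧ ε₀ ≤ 1 ∧
      ∀ (β : Fin d → ℝ) (Rφ RJ Pφ PJ : ℝ → Torus d → (Fin d → ℝ) → (Fin d → ℝ)),
        IsConstantType γ β →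
        IsC2Family e K Rφ → IsC2Family e K RJ → IsC2Family e K Pφ → IsC2Family e K PJ →
        SmallNonlinearity e K Rφ RJ →
        TransversalityTorsion A B PJ →
        ∀ ε : ℝ, 0 < ε → ε ≤ ε₀ →
          HasSymbolicDoubleBlender (annulus d 1)
            ![twistMap β A Rφ RJ ε, kickMap Pφ PJ ε] ∧
          IsTopMixingOn (annulus d 1)
            ![twistMap β A Rφ RJ ε, kickMap Pφ PJ ε] (annulus d (Real.sqrt ε)) := by
  by_cases h : SimpleRealNonzeroSpectrum (A * B)
  · obtain ⟨δ, hδ, hδs⟩ := mem_nhdsGT_iff_exists_Ioc_subset.1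
      (PerturbedPair.eventually_blender_and_mixing (K := K) hγ he h)
    refine ⟨min δ (min e 1), lt_min hδ (lt_min he one_pos),
      (min_le_right _ _).trans (min_le_left _ _), (min_le_right _ _).trans (min_le_right _ _), ?_⟩
    intro β Rφ RJ Pφ PJ hβ hRφ hRJ hPφ hPJ hR hP ε hε hε₀
    exact hδs ⟨hε, hε₀.trans (min_le_left _ _)⟩ ⟨β, Rφ, RJ, Pφ, PJ, hβ, hRφ, hRJ, hPφ, hPJ, hR, hP⟩
  -- the condition on the spectrum of `A * B` is part of the hypotheses on the perturbation
  · exact ⟨min e 1, lt_min he one_pos, min_le_left _ _, min_le_right _ _,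
      fun _ _ _ _ _ _ _ _ _ _ _ hP => absurd hP.2.2 h⟩
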